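/- Throughout, curves are over $\mathbb{C}$. A non-singular genus 2 curve is given by an equation $y^2=f(x)=a_0\prod_{i=1}^{6}(x-\alpha_i)$ with $a_0\neq 0$ and $\alpha_1,\dots,\alpha_6$ pairwise distinct. It has a degree 2 elliptic subcover if it admits a morphism of degree 2 to an elliptic curve $E$ that is maximal, i.e. does not factor through an unramified cover $E'\to E$ which is not an isomorphism. The Igusa invariants of a sextic $f$ are, with $(ij)=\alpha_i-\alpha_j$, $$i_2=a_0^2\sum_{15}(ij)^2(kl)^2(mn)^2,\qquad i_4=a_0^4\sum_{10}(ij)^2(jk)^2(ki)^2(lm)^2(mn)^2(nl)^2,$$ $$i_6=a_0^6\sum_{60}(ij)^2(jk)^2(ki)^2(lm)^2(mn)^2(nl)^2(il)^2(jm)^2(kn)^2,\qquad i_{10}=a_0^{10}\prod_{j<k}(jk)^2,$$ where each sum is over the distinct terms obtained by permuting the six roots (15, 10 and 60 of them). Put $$\begin{aligned}\chi_{30}={}&-19245600\,i_{10}^2i_4i_2^3+507384000\,i_{10}^2i_4^2i_2+77436\,i_{10}i_4^3i_2^4-81\,i_2^3i_6^4-i_2^7i_4^4+384\,i_4^6i_6\\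 &-78\,i_2^5i_4^5+31104\,i_6^5-3499200\,i_{10}i_2i_6^3+104976000\,i_{10}^2i_2^2i_6+972\,i_{10}i_2^6i_4^2+8748\,i_{10}i_2^4i_6^2\\ &+1332\,i_2^4i_4^4i_6-8910\,i_2^3i_4^3i_6^2-1728\,i_4^5i_2^2i_6+6048\,i_4^4i_2i_6^2+29376\,i_2^2i_4^2i_6^3-47952\,i_2i_4i_6^4\\ &+41472\,i_{10}i_4^5-236196\,i_{10}^2i_2^5+159\,i_4^6i_2^3-80\,i_4^7i_2-125971200000\,i_{10}^3-592272\,i_{10}i_4^4i_2^2\\ &-870912\,i_{10}i_2^3i_4^2i_6+3090960\,i_{10}i_2^2i_4i_6^2-5832\,i_{10}i_2^5i_4i_6+4743360\,i_{10}i_4^3i_2i_6-6912\,i_4^3i_6^3\\ &+12\,i_2^6i_4^3i_6-54\,i_2^5i_4^2i_6^2+108\,i_2^4i_4i_6^3-2099520000\,i_{10}^2i_4i_6-9331200\,i_{10}i_4^2i_6^2.\end{aligned}$$ (1) A non-singular genus 2 curve has a degree 2 elliptic subcover if and only if $\chi_{30}=0$. (2) Let $\alpha,\gamma\in\mathbb{R}$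 and let $X$ be the curve $y^2=(x^3+\alpha x+\gamma)^2+4$. The invariants of its sextic are $$\begin{aligned}i_2={}&-32\alpha^3-216\gamma^2-960,\\ i_4={}&64\alpha^6+864\alpha^3\gamma^2-2496\alpha^3+2916\gamma^4+18144\gamma^2+25920,\\ i_6={}&-157464\gamma^6-1749600\gamma^4-6397056\gamma^2-7672320-69984\alpha^3\gamma^4-285120\alpha^3\gamma^2\\ &-10368\alpha^6\gamma^2+648960\alpha^3-3840\alpha^6-512\alpha^9,\\ i_{10}={}&-47775744-23887872\gamma^2-884736\alpha^3\gamma^2+3538944\alpha^3-2985984\gamma^4-65536\alpha^6,\end{aligned}$$ and $\chi_{30}=0$ if and only if $\gamma^2\alpha^6\,Q(\alpha,\gamma)^2=0$, where $$\begin{aligned}Q(\alpha,\gamma)={}&-8000000+1146000\alpha^3-53088\alpha^6+784\alpha^9-6480000\gamma^2+327240\alpha^3\gamma^2\\&+7128\gamma^2\alpha^6-1749600\gamma^4-10935\gamma^4\alpha^3-157464\gamma^6.\end{aligned}$$ (3) $X$ is non-singular of genus 2 exactly when $(\alpha,\gamma)\neq(3,0)$; in that case $X$ has a degree 2 elliptic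 subcover if and only if $\gamma^2\alpha^6\,Q(\alpha,\gamma)^2=0$. In particular, $X$ always has one when $\alpha=0$. When $\alpha\neq0$, it has one only if $(\alpha,\gamma)$ lies on the real curve $\gamma\,Q(\alpha,\gamma)=0$: for each fixed $\alpha\neq 0$ this happens for only finitely many $\gamma$, while there are infinitely many pairs $(\alpha,\gamma)$ with $\alpha\neq0$, $\gamma\neq 0$ for which $X$ has one. -/

import Mathlib

open Polynomial

noncomputable section

/-! ### Binary sextics and their Igusa invariants -/

/-- A complex sextic `a₀ (x - α₁) ⋯ (x - α₆)`, given by its leading coefficient and an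
enumeration of its roots. -/
structure Sextic where
  lead : ℂ
  root : Fin 6 → ℂ

namespace Sextic

variable (S : Sextic)

/-- The polynomial `a₀ (x - α₁) ⋯ (x - α₆)`. -/
def poly : ℂ[X] := C S.lead * ∏ i, (X - C (S.root i))

/-- The squared difference `(α_i - α_j)²`. -/
def sqDiff (i j : Fin 6) : ℂ := (S.root i - S.root j) ^ 2

/-- `(α_i - α_j)² (α_j - α_k)² (α_k - α_i)²`. -/
def triangle (i j k : Fin 6) : ℂ := S.sqDiff i j * S.sqDiff j k * S.sqDiff k i

/-- The sum of the three products of two squared differences given by the three ways of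
splitting `{i, j, k, l}` into two pairs. -/
def pairSum (i j k l : Fin 6) : ℂ :=
  S.sqDiff i j * S.sqDiff k l + S.sqDiff i k * S.sqDiff j l + S.sqDiff i l * S.sqDiff j k

/-- The sum over the six bijections `{i, j, k} → {l, m, n}` of the product of the three
squared differences of matched roots. -/
def matchSum (i j k l m n : Fin 6) : ℂ :=
  S.sqDiff i l * S.sqDiff j m * S.sqDiff k n + S.sqDiff i l * S.sqDiff j n * S.sqDiff k m +
  S.sqDiff i m * S.sqDiff j l * S.sqDiff k n + S.sqDiff i m * S.sqDiff j n * S.sqDiff k l +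
  S.sqDiff i n * S.sqDiff j l * S.sqDiff k m + S.sqDiff i n * S.sqDiff j m * S.sqDiff k l

/-- The invariant of degree 2: the sum of 15 terms, one for each splitting of the six roots
into three pairs. -/
def i2 : ℂ :=
  S.lead ^ 2 *
    (S.sqDiff 0 1 * S.pairSum 2 3 4 5 + S.sqDiff 0 2 * S.pairSum 1 3 4 5 +
      S.sqDiff 0 3 * S.pairSum 1 2 4 5 + S.sqDiff 0 4 * S.pairSum 1 2 3 5 +
      S.sqDiff 0 5 * S.pairSum 1 2 3 4)

/-- The term of `i4` given by the splitting `{i, j, k}, {l, m, n}`. -/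
def split4 (i j k l m n : Fin 6) : ℂ := S.triangle i j k * S.triangle l m n

/-- The sum of the 6 terms of `i6` given by the splitting `{i, j, k}, {l, m, n}`. -/
def split6 (i j k l m n : Fin 6) : ℂ :=
  S.triangle i j k * S.triangle l m n * S.matchSum i j k l m n

/-- The sum of `t i j k l m n` over the 10 splittings `{i, j, k}, {l, m, n}` of the six indices
into two triples. -/
def sumSplit (t : Fin 6 → Fin 6 → Fin 6 → Fin 6 → Fin 6 → Fin 6 → ℂ) : ℂ :=
  t 0 1 2 3 4 5 + t 0 1 3 2 4 5 + t 0 1 4 2 3 5 + t 0 1 5 2 3 4 + t 0 2 3 1 4 5 +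
  t 0 2 4 1 3 5 + t 0 2 5 1 3 4 + t 0 3 4 1 2 5 + t 0 3 5 1 2 4 + t 0 4 5 1 2 3

/-- The invariant of degree 4 (10 terms). -/
def i4 : ℂ := S.lead ^ 4 * sumSplit S.split4

/-- The invariant of degree 6 (60 terms). -/
def i6 : ℂ := S.lead ^ 6 * sumSplit S.split6

/-- The invariant of degree 10: the discriminant of the sextic. -/
def i10 : ℂ := S.lead ^ 10 * ∏ j : Fin 6, ∏ k : Fin 6, if j < k then S.sqDiff j k else 1

/-- The invariant `χ₃₀`, as a polynomial in the Igusa invariants. -/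
def chi30 : ℂ :=
  -19245600 * S.i10 ^ 2 * S.i4 * S.i2 ^ 3 + 507384000 * S.i10 ^ 2 * S.i4 ^ 2 * S.i2
  + 77436 * S.i10 * S.i4 ^ 3 * S.i2 ^ 4 - 81 * S.i2 ^ 3 * S.i6 ^ 4 - S.i2 ^ 7 * S.i4 ^ 4
  + 384 * S.i4 ^ 6 * S.i6 - 78 * S.i2 ^ 5 * S.i4 ^ 5 + 31104 * S.i6 ^ 5
  - 3499200 * S.i10 * S.i2 * S.i6 ^ 3 + 104976000 * S.i10 ^ 2 * S.i2 ^ 2 * S.i6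
  + 972 * S.i10 * S.i2 ^ 6 * S.i4 ^ 2 + 8748 * S.i10 * S.i2 ^ 4 * S.i6 ^ 2
  + 1332 * S.i2 ^ 4 * S.i4 ^ 4 * S.i6 - 8910 * S.i2 ^ 3 * S.i4 ^ 3 * S.i6 ^ 2
  - 1728 * S.i4 ^ 5 * S.i2 ^ 2 * S.i6 + 6048 * S.i4 ^ 4 * S.i2 * S.i6 ^ 2
  + 29376 * S.i2 ^ 2 * S.i4 ^ 2 * S.i6 ^ 3 - 47952 * S.i2 * S.i4 * S.i6 ^ 4
  + 41472 * S.i10 * S.i4 ^ 5 - 236196 * S.i10 ^ 2 * S.i2 ^ 5 + 159 * S.i4 ^ 6 * S.i2 ^ 3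
  - 80 * S.i4 ^ 7 * S.i2 - 125971200000 * S.i10 ^ 3 - 592272 * S.i10 * S.i4 ^ 4 * S.i2 ^ 2
  - 870912 * S.i10 * S.i2 ^ 3 * S.i4 ^ 2 * S.i6 + 3090960 * S.i10 * S.i2 ^ 2 * S.i4 * S.i6 ^ 2
  - 5832 * S.i10 * S.i2 ^ 5 * S.i4 * S.i6 + 4743360 * S.i10 * S.i4 ^ 3 * S.i2 * S.i6
  - 6912 * S.i4 ^ 3 * S.i6 ^ 3 + 12 * S.i2 ^ 6 * S.i4 ^ 3 * S.i6
  - 54 * S.i2 ^ 5 * S.i4 ^ 2 * S.i6 ^ 2 + 108 * S.i2 ^ 4 * S.i4 * S.i6 ^ 3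
  - 2099520000 * S.i10 ^ 2 * S.i4 * S.i6 - 9331200 * S.i10 * S.i4 ^ 2 * S.i6 ^ 2

end Sextic

/-! ### Genus 2 curves and elliptic subcovers -/

/-- A non-singular genus 2 curve over `ℂ`: the double cover `y² = f(x)` of the projective line,
where `f` is a sextic with six distinct roots. -/
structure GenusTwoCurve extends Sextic where
  lead_ne_zero : lead ≠ 0
  root_injective : Function.Injective root

namespace GenusTwoCurve

/-- The polynomial `Y² - f(x)` over the field `ℂ(x)`. -/
def equation (D : GenusTwoCurve) : (RatFunc ℂ)[X] :=
  X ^ 2 - C (algebraMap ℂ[X] (RatFunc ℂ) D.poly)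

lemma equation_irreducible (D : GenusTwoCurve) : Irreducible D.equation := by
  refine X_pow_sub_C_irreducible_of_prime Nat.prime_two fun b hb => ?_
  have hint : IsIntegral ℂ[X] b := by
    refine ⟨X ^ 2 - C D.poly, monic_X_pow_sub_C _ two_ne_zero, ?_⟩
    simp [hb]
  obtain ⟨g, rfl⟩ := IsIntegrallyClosed.isIntegral_iff.mp hint
  rw [← map_pow] at hb
  have hg : g ^ 2 = D.poly := IsFractionRing.injective ℂ[X] (RatFunc ℂ) hb
  have h0 : D.poly.eval (D.root 0) = 0 := by
    simp only [Sextic.poly, eval_mul, eval_prod]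
    rw [Finset.prod_eq_zero (Finset.mem_univ 0) (by simp), mul_zero]
  have hroot : g.eval (D.root 0) = 0 := by
    rw [← hg, eval_pow] at h0
    exact pow_eq_zero_iff two_ne_zero |>.mp h0
  obtain ⟨q, hq⟩ := dvd_iff_isRoot.mpr hroot
  have hne : (X - C (D.root 0)) ≠ 0 := X_sub_C_ne_zero _
  have hfac : D.poly =
      (X - C (D.root 0)) * (C D.lead * ∏ i : Fin 5, (X - C (D.root i.succ))) := by
    rw [Sextic.poly, Fin.prod_univ_succ]
    ring
  have h1 : (X - C (D.root 0)) * q ^ 2 = C D.lead * ∏ i : Fin 5, (X - C (D.root i.succ)) := by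
    apply mul_left_cancel₀ hne
    rw [← hfac, ← hg, hq]
    ring
  have h2 := congrArg (eval (D.root 0)) h1
  simp only [eval_mul, eval_prod, eval_sub, eval_X, eval_C, sub_self, zero_mul] at h2
  rcases mul_eq_zero.mp h2.symm with h | h
  · exact D.lead_ne_zero h
  · obtain ⟨i, -, hi⟩ := Finset.prod_eq_zero_iff.mp h
    exact absurd (D.root_injective (sub_eq_zero.mp hi)) (Fin.succ_ne_zero i).symm

instance (D : GenusTwoCurve) : Fact (Irreducible D.equation) := ⟨D.equation_irreducible⟩

/-- The function field `ℂ(x)[Y] / (Y² - f(x))` of the curve `y² = f(x)`. -/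
abbrev FunctionField (D : GenusTwoCurve) : Type := AdjoinRoot D.equation

end GenusTwoCurve

/-- `F` is the function field of an elliptic curve over `ℂ`. -/
def IsEllipticFunctionField (F : Type) [Field F] [Algebra ℂ F] : Prop :=
  ∃ W : WeierstrassCurve ℂ, W.IsElliptic ∧ Nonempty (W.toAffine.FunctionField ≃ₐ[ℂ] F)

/-- The curve with function field `K` has an elliptic subcover of degree `n`: it admits a morphism
`ψ` of degree `n` to an elliptic curve which is maximal, i.e. does not factor through an unramified
cover `E' → E` other than isomorphisms. In terms of function fields `ψ` is a subfield `E` of `K`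
which is the function field of an elliptic curve, with `[K : E] = n`. The intermediate curves `E'`
unramified over `E` are those of genus 1. -/
def HasEllipticSubcover (n : ℕ) (K : Type) [Field K] [Algebra ℂ K] : Prop :=
  ∃ E : IntermediateField ℂ K, IsEllipticFunctionField E ∧ Module.finrank E K = n ∧
    ∀ E' : IntermediateField ℂ K, E ≤ E' → IsEllipticFunctionField E' → E' = E

/-! ### The quotient monopole curve -/

/-- The right hand side `(x³ + αx + γ)² + 4` of the equation of the quotient monopole curve `X`
with `β = 1`. -/
def quotientSextic (α γ : ℝ) : ℂ[X] := (X ^ 3 + C (α : ℂ) * X + C (γ : ℂ)) ^ 2 + 4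

/-- The set of the real `(α, γ)` for which the curve `y² = (x³ + αx + γ)² + 4` is a non-singular
genus 2 curve that has an elliptic subcover of degree 2. -/
def ellipticLocus : Set (ℝ × ℝ) :=
  {p | ∃ D : GenusTwoCurve, D.poly = quotientSextic p.1 p.2 ∧ HasEllipticSubcover 2 D.FunctionField}

/-- The polynomial whose square is a factor of `χ₃₀` of the curve `X`. -/
def chiFactor (α γ : ℝ) : ℝ :=
  -8000000 + 1146000 * α ^ 3 - 53088 * α ^ 6 + 784 * α ^ 9 - 6480000 * γ ^ 2
  + 327240 * α ^ 3 * γ ^ 2 + 7128 * γ ^ 2 * α ^ 6 - 1749600 * γ ^ 4 - 10935 * γ ^ 4 * α ^ 3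
  - 157464 * γ ^ 6

end

/-! Criterion. A subfield of index 2 in `K = ℂ(x, y)` is the fixed field of an involution `τ`. If
`τ` fixes `x`, the fixed field is `ℂ(x)`, which is rational and not elliptic. Otherwise `τ` acts on
the holomorphic differentials `(k x + l) dx / y`, and the quotient of two of them shows that `τ x`
is a Möbius transform of `x` (`exists_mobius`). This transform exchanges the six roots in pairs
without fixed points (`hasInvolution_of_algEquiv`). Conversely, a Möbius involution that exchanges
the roots in pairs is conjugate to `z ↦ -z`. In the coordinate `z` the curve reads `w² = a (z² - e₁)
(z² - e₂) (z² - e₃)` and covers the elliptic curve with the cubic `a (u - e₁) (u - e₂) (u - e₃)`.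
Maximality is automatic: an extension of degree 2 has no proper intermediate field, and `K` itself,
of genus 2, is not elliptic.

Differentials are tested on embeddings `φ : K → ℂ((t))`. With the Euler derivation, `g dx` becomes
`φ g * euler (φ x) * dt / t`, so it has no pole exactly when `φ g * euler (φ x)` has positive order
(`IsSmall`). For `y² = f(x)` with `f` squarefree of degree `2 m`, the holomorphic differentials are
`r dx / y` with `deg r ≤ m - 2` (`isHolomorphic`, `exists_of_isHolomorphic`). The cases `m = 1, 2,
3` separate the genera 0, 1, 2.

From roots to `χ₃₀`. For a given splitting into three pairs, an involution exists when a 3 × 3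
determinant `pairDet` vanishes. By `chi30_eq`, `χ₃₀` is `-2¹¹ 3⁹ a₀³⁰` times the square of the
product of the fifteen determinants. Both sides transform alike under Möbius maps, so the roots may
be taken to be `a, b, c, 0, 1, ∞`. The remaining identity in three variables is verified by
Kronecker substitution (`PolyExpr.eval_eq_zero`): a polynomial vanishes if it vanishes at integers
that grow fast enough compared with its coefficients.

For the curve `X`, the invariants `i₂, i₄, i₆` come from their expressions in the coefficients and
`i₁₀` from a resultant computation. Then `χ₃₀` is a nonzero constant times `γ² α⁶ Q²`, and the
statements on the real locus follow by elementary analysis of `Q`. -/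

noncomputable section

/-! ### Laurent series -/

namespace LaurentSeries

/-- The Euler derivation `t d/dt` on Laurent series. -/
def euler (a : LaurentSeries ℂ) : LaurentSeries ℂ where
  coeff n := n * a.coeff n
  isPWO_support' := a.isPWO_support.mono fun n hn h0 => hn (by simp [h0])

lemma coeff_euler (a : LaurentSeries ℂ) (n : ℤ) : (euler a).coeff n = n * a.coeff n := rfl

lemma euler_add (a b : LaurentSeries ℂ) : euler (a + b) = euler a + euler b := by
  ext n; simp [coeff_euler, mul_add]

lemma euler_mul (a b : LaurentSeries ℂ) : euler (a * b) = euler a * b + a * euler b := by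
  ext n
  rw [HahnSeries.coeff_add, coeff_euler,
    HahnSeries.coeff_mul_left' a.isPWO_support (x := euler a)
      (fun n hn h0 => hn (by simp [h0, coeff_euler])),
    HahnSeries.coeff_mul_right' b.isPWO_support (y := euler b)
      (fun n hn h0 => hn (by simp [h0, coeff_euler])),
    HahnSeries.coeff_mul, Finset.mul_sum, ← Finset.sum_add_distrib]
  refine Finset.sum_congr rfl fun ij hij => ?_
  obtain ⟨-, -, h⟩ := Finset.mem_antidiagonal.mp hij
  simp only [coeff_euler]
  rw [← h]
  push_cast
  ring

lemma algebraMap_eq (c : ℂ) : algebraMap ℂ (LaurentSeries ℂ) c =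
    HahnSeries.ofPowerSeries ℤ ℂ (PowerSeries.C c) := by
  simp [RingHom.algebraMap_toAlgebra]

lemma euler_algebraMap (c : ℂ) : euler (algebraMap ℂ (LaurentSeries ℂ) c) = 0 := by
  ext n
  rw [coeff_euler, algebraMap_eq, HahnSeries.ofPowerSeries_C]
  rcases eq_or_ne n 0 with rfl | h
  · simp
  · simp [h]

/-- The subring of power series. -/
def regular : Subring (LaurentSeries ℂ) := (HahnSeries.ofPowerSeries ℤ ℂ).range

/-- A Laurent series is small if it is a power series without constant term. -/
def IsSmall (a : LaurentSeries ℂ) : Prop :=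
  ∃ p : PowerSeries ℂ, PowerSeries.constantCoeff p = 0 ∧ HahnSeries.ofPowerSeries ℤ ℂ p = a

lemma algebraMap_mem (c : ℂ) : algebraMap ℂ (LaurentSeries ℂ) c ∈ regular :=
  ⟨_, (algebraMap_eq c).symm⟩

lemma aeval_mem {a : LaurentSeries ℂ} (ha : a ∈ regular) (p : ℂ[X]) : aeval a p ∈ regular := by
  induction p using Polynomial.induction_on' with
  | add p q hp hq => rw [map_add]; exact add_mem hp hq
  | monomial n c => rw [aeval_monomial]; exact mul_mem (algebraMap_mem c) (pow_mem ha n)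

namespace IsSmall

variable {a b : LaurentSeries ℂ}

lemma mem (ha : IsSmall a) : a ∈ regular := by
  obtain ⟨p, -, rfl⟩ := ha
  exact ⟨p, rfl⟩

lemma zero : IsSmall 0 := ⟨0, by simp, by simp⟩

lemma add (ha : IsSmall a) (hb : IsSmall b) : IsSmall (a + b) := by
  obtain ⟨p, hp, rfl⟩ := ha
  obtain ⟨q, hq, rfl⟩ := hb
  exact ⟨p + q, by simp [hp, hq], by simp⟩

lemma mul_mem (ha : IsSmall a) (hb : b ∈ regular) : IsSmall (a * b) := by
  obtain ⟨p, hp, rfl⟩ := ha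
  obtain ⟨q, rfl⟩ := hb
  exact ⟨p * q, by simp [hp], by simp⟩

lemma mem_mul (ha : a ∈ regular) (hb : IsSmall b) : IsSmall (a * b) := by
  rw [mul_comm]; exact hb.mul_mem ha

lemma neg (ha : IsSmall a) : IsSmall (-a) := by
  obtain ⟨p, hp, rfl⟩ := ha
  exact ⟨-p, by simp [hp], by simp⟩

lemma sub (ha : IsSmall a) (hb : IsSmall b) : IsSmall (a - b) := by
  rw [sub_eq_add_neg]; exact ha.add hb.neg

end IsSmall

lemma not_isSmall_algebraMap {c : ℂ} (hc : c ≠ 0) :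
    ¬ IsSmall (algebraMap ℂ (LaurentSeries ℂ) c) := by
  rintro ⟨p, hp, h⟩
  rw [algebraMap_eq] at h
  rw [HahnSeries.ofPowerSeries_injective h] at hp
  exact hc (by simpa using hp)

lemma not_isSmall_one : ¬ IsSmall (1 : LaurentSeries ℂ) := by
  rw [← map_one (algebraMap ℂ (LaurentSeries ℂ))]
  exact not_isSmall_algebraMap one_ne_zero

lemma isSmall_euler {a : LaurentSeries ℂ} (ha : a ∈ regular) : IsSmall (euler a) := by
  obtain ⟨p, rfl⟩ := ha
  refine ⟨PowerSeries.mk fun n => n * PowerSeries.coeff n p, by simp, ?_⟩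
  ext n
  rw [coeff_euler]
  obtain ⟨k, rfl | rfl⟩ := n.eq_nat_or_neg
  · rw [HahnSeries.ofPowerSeries_apply_coeff, HahnSeries.ofPowerSeries_apply_coeff]
    simp
  · rcases Nat.eq_zero_or_pos k with rfl | hk
    · rw [show -((0 : ℕ) : ℤ) = ((0 : ℕ) : ℤ) by simp, HahnSeries.ofPowerSeries_apply_coeff,
        HahnSeries.ofPowerSeries_apply_coeff]
      simp
    · have (q : PowerSeries ℂ) : (HahnSeries.ofPowerSeries ℤ ℂ q).coeff (-(k : ℤ)) = 0 := by
        rw [HahnSeries.ofPowerSeries_apply, HahnSeries.embDomain_of_notMem_range]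
        rintro ⟨j, hj⟩
        simp at hj
        lia
      rw [this, this, mul_zero]

lemma exists_isSmall_sub {a : LaurentSeries ℂ} (ha : a ∈ regular) :
    ∃ c : ℂ, IsSmall (a - algebraMap ℂ (LaurentSeries ℂ) c) := by
  obtain ⟨p, rfl⟩ := ha
  refine ⟨PowerSeries.constantCoeff p, p - PowerSeries.C (PowerSeries.constantCoeff p), by simp, ?_⟩
  rw [map_sub, algebraMap_eq]

lemma inv_mem {a : LaurentSeries ℂ} (ha : a ∈ regular) (h : ¬ IsSmall a) : a⁻¹ ∈ regular := by
  obtain ⟨p, rfl⟩ := ha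
  have hp : PowerSeries.constantCoeff p ≠ 0 := fun h0 => h ⟨p, h0, rfl⟩
  refine ⟨p⁻¹, ?_⟩
  refine eq_inv_of_mul_eq_one_left ?_
  rw [← map_mul, PowerSeries.inv_mul_cancel _ hp, map_one]

/-- The uniformizer `t`. -/
def param : LaurentSeries ℂ := HahnSeries.ofPowerSeries ℤ ℂ PowerSeries.X

lemma isSmall_param : IsSmall param := ⟨PowerSeries.X, by simp, rfl⟩

lemma param_ne_zero : param ≠ 0 := by
  rw [param, Ne, map_eq_zero_iff _ HahnSeries.ofPowerSeries_injective]
  exact PowerSeries.X_ne_zero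

lemma euler_param : euler param = param := by
  ext n
  rw [coeff_euler, param, HahnSeries.ofPowerSeries_X]
  rcases eq_or_ne n 1 with rfl | h
  · simp
  · simp [h]

lemma isSmall_iff {a : LaurentSeries ℂ} : IsSmall a ↔ ∃ b ∈ regular, a = param * b := by
  constructor
  · rintro ⟨p, hp, rfl⟩
    obtain ⟨q, rfl⟩ := PowerSeries.X_dvd_iff.mpr hp
    exact ⟨_, ⟨q, rfl⟩, by rw [map_mul, param]⟩
  · rintro ⟨b, hb, rfl⟩
    exact isSmall_param.mul_mem hb

/-- Splitting off the lowest power of `t` leaves an invertible power series, and a negative order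
turns into a positive one in the inverse. So `regular` is a valuation ring whose maximal ideal
consists of the small series. -/
lemma isSmall_inv {a : LaurentSeries ℂ} (ha : a ∉ regular) : IsSmall a⁻¹ := by
  have ha0 : a ≠ 0 := fun h => ha (h ▸ zero_mem _)
  have hp : PowerSeries.constantCoeff a.powerSeriesPart ≠ 0 := by
    rw [← PowerSeries.coeff_zero_eq_constantCoeff_apply, powerSeriesPart_coeff]
    simpa using HahnSeries.coeff_order_eq_zero.not.mpr ha0
  have hunit : (HahnSeries.ofPowerSeries ℤ ℂ a.powerSeriesPart)⁻¹ ∈ regular := by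
    refine inv_mem ⟨_, rfl⟩ ?_
    rintro ⟨q, hq, h⟩
    rw [HahnSeries.ofPowerSeries_injective h] at hq
    exact hp hq
  have key := single_order_mul_powerSeriesPart a
  have hneg : a.order < 0 := by
    by_contra! h
    obtain ⟨n, hn⟩ := Int.eq_ofNat_of_zero_le h
    exact ha ⟨_, X_order_mul_powerSeriesPart hn.symm⟩
  obtain ⟨n, hn⟩ := Int.eq_ofNat_of_zero_le (a := -a.order) (by lia)
  have h2 : (HahnSeries.single a.order (1 : ℂ))⁻¹ = param ^ n := by
    rw [param, HahnSeries.ofPowerSeries_X, HahnSeries.single_pow]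
    refine inv_eq_of_mul_eq_one_right ?_
    rw [HahnSeries.single_mul_single]
    simp
    rw [show a.order + n = 0 by lia]; rfl
  rw [← key, mul_inv, h2]
  refine IsSmall.mul_mem ?_ hunit
  obtain ⟨k, rfl⟩ : ∃ k, n = k + 1 := ⟨n - 1, by lia⟩
  rw [pow_succ]
  exact isSmall_param.mem_mul (pow_mem isSmall_param.mem k)

/-- Hensel's lemma for `X² - p` in `ℂ⟦t⟧`, starting from a square root `d` of the constant term. The
derivative `2 d` is a unit because `d ≠ 0`. -/
lemma exists_sq {a : LaurentSeries ℂ} (ha : a ∈ regular) (h : ¬ IsSmall a) :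
    ∃ b ∈ regular, b ^ 2 = a ∧ ¬ IsSmall b := by
  obtain ⟨p, rfl⟩ := ha
  have hp : PowerSeries.constantCoeff p ≠ 0 := fun h0 => h ⟨p, h0, rfl⟩
  obtain ⟨d, hd⟩ := IsAlgClosed.exists_pow_nat_eq (PowerSeries.constantCoeff p) (n := 2) (by norm_num)
  have hd0 : d ≠ 0 := by rintro rfl; exact hp (by rw [← hd]; norm_num)
  have := IsAdicComplete.henselianRing (PowerSeries ℂ) (Ideal.span {PowerSeries.X})
  obtain ⟨q, hq, -⟩ := HenselianRing.is_henselian (I := Ideal.span {(PowerSeries.X : PowerSeries ℂ)})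
    (X ^ 2 - C p) (monic_X_pow_sub_C p two_ne_zero) (PowerSeries.C d)
    (by
      rw [Ideal.mem_span_singleton, PowerSeries.X_dvd_iff]
      simp [hd])
    (by
      refine IsUnit.map _ (PowerSeries.isUnit_iff_constantCoeff.mpr ?_)
      simp [hd0])
  have hq' : q ^ 2 = p := by simpa [sub_eq_zero, IsRoot] using hq
  refine ⟨HahnSeries.ofPowerSeries ℤ ℂ q, ⟨q, rfl⟩, by rw [← map_pow, hq'], ?_⟩
  intro hs
  apply h
  rw [← hq', map_pow, pow_two]
  exact hs.mul_mem hs.mem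

/-- If `a` had a pole, then `1 = a² a⁻²` would be small. -/
lemma mem_of_sq_mem {a : LaurentSeries ℂ} (ha : a ^ 2 ∈ regular) : a ∈ regular := by
  by_contra h
  have h1 := isSmall_inv h
  have ha0 : a ≠ 0 := fun h0 => h (h0 ▸ zero_mem _)
  refine not_isSmall_one ?_
  rw [show (1 : LaurentSeries ℂ) = a ^ 2 * (a⁻¹ * a⁻¹) by field_simp]
  exact IsSmall.mem_mul ha (h1.mul_mem h1.mem)

lemma isSmall_aeval_sub {a : LaurentSeries ℂ} {c : ℂ}
    (ha : IsSmall (a - algebraMap ℂ (LaurentSeries ℂ) c)) (p : ℂ[X]) :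
    IsSmall (aeval a p - algebraMap ℂ (LaurentSeries ℂ) (p.eval c)) := by
  obtain ⟨q, hq⟩ := (X_sub_C_dvd_sub_C_eval (a := c) (p := p))
  have : aeval a p - algebraMap ℂ (LaurentSeries ℂ) (p.eval c) =
      (a - algebraMap ℂ (LaurentSeries ℂ) c) * aeval a q := by
    have := congrArg (aeval a) hq
    simpa using this
  rw [this]
  have h2 : a ∈ regular := by simpa using add_mem ha.mem (algebraMap_mem c)
  exact ha.mul_mem (aeval_mem h2 q)

lemma isSmall_aeval_iff {a : LaurentSeries ℂ} {c : ℂ}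
    (ha : IsSmall (a - algebraMap ℂ (LaurentSeries ℂ) c)) (p : ℂ[X]) :
    IsSmall (aeval a p) ↔ p.eval c = 0 := by
  have h := isSmall_aeval_sub ha p
  constructor
  · intro h1
    by_contra h0
    apply not_isSmall_algebraMap h0
    simpa using h1.sub h
  · intro h0
    simpa [h0] using h

lemma euler_aeval (a : LaurentSeries ℂ) (p : ℂ[X]) :
    euler (aeval a p) = aeval a (Polynomial.derivative p) * euler a := by
  have hpow (n : ℕ) : euler (a ^ n) = n * a ^ (n - 1) * euler a := by
    induction n with
    | zero => simpa using euler_algebraMap 1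
    | succ n ih =>
      rw [pow_succ, euler_mul, ih]
      rcases n with _ | n
      · simp
      · simp [pow_succ]; ring
  induction p using Polynomial.induction_on' with
  | add p q hp hq => simp only [map_add, euler_add, hp, hq, add_mul]
  | monomial n c =>
    rw [aeval_monomial, euler_mul, euler_algebraMap, hpow, derivative_monomial, aeval_monomial]
    simp
    ring

/-- After division by a power of `X`, an algebraic relation has nonzero constant term, and its value
at a small series cannot be small. -/
lemma transcendental_of_small {a : LaurentSeries ℂ} (ha : IsSmall a) (h0 : a ≠ 0) :
    Transcendental ℂ a := by
  rintro ⟨p, hp, h⟩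
  obtain ⟨q, hq, hX⟩ := exists_eq_pow_rootMultiplicity_mul_and_not_dvd p hp 0
  rw [hq] at h
  simp only [map_mul, map_pow, C_0, sub_zero, aeval_X, mul_eq_zero] at h
  rcases h with h | h
  · exact h0 (eq_zero_of_pow_eq_zero h)
  · have : IsSmall (aeval a q) := h ▸ IsSmall.zero
    rw [isSmall_aeval_iff (c := 0) (by simpa using ha)] at this
    exact hX (dvd_iff_isRoot.mpr this)

end LaurentSeries

/-! ### Double covers of the projective line -/

/-- The field `K` is the function field `ℂ(x, y)` of the curve `y² = f(x)`. -/
structure IsDoubleCover {K : Type} [Field K] [Algebra ℂ K] (f : ℂ[X]) (x y : K) : Prop where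
  transcendental : Transcendental ℂ x
  sq : y ^ 2 = aeval x f
  adjoin_eq : IntermediateField.adjoin ℂ {x, y} = ⊤

/-- The equation `Y² - f` over `ℂ(X)`. -/
def coverEquation (f : ℂ[X]) : (RatFunc ℂ)[X] := X ^ 2 - C (algebraMap ℂ[X] (RatFunc ℂ) f)

lemma exists_simple_factor {f : ℂ[X]} (hf : Squarefree f) {c : ℂ} (hc : f.eval c = 0) :
    ∃ g : ℂ[X], f = (X - C c) * g ∧ g.eval c ≠ 0 := by
  obtain ⟨g, hg⟩ := dvd_iff_isRoot.mpr hc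
  refine ⟨g, hg, fun h => ?_⟩
  obtain ⟨k, hk⟩ := dvd_iff_isRoot.mpr h
  refine not_isUnit_X_sub_C c (hf _ ⟨k, ?_⟩)
  rw [mul_assoc, ← hk, hg]

lemma coverEquation_irreducible {f : ℂ[X]} (hf : Squarefree f) (hd : 0 < f.natDegree) :
    Irreducible (coverEquation f) := by
  refine X_pow_sub_C_irreducible_of_prime Nat.prime_two fun b hb => ?_
  have hint : IsIntegral ℂ[X] b := by
    refine ⟨X ^ 2 - C f, monic_X_pow_sub_C _ two_ne_zero, ?_⟩
    simp [hb]
  obtain ⟨g, rfl⟩ := IsIntegrallyClosed.isIntegral_iff.mp hint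
  rw [← map_pow] at hb
  have hg : g ^ 2 = f := IsFractionRing.injective ℂ[X] (RatFunc ℂ) hb
  have hu : IsUnit g := hf g ⟨1, by rw [← hg]; ring⟩
  have : f.natDegree = 0 := natDegree_eq_zero_of_isUnit (hg ▸ hu.pow 2)
  lia

namespace IsDoubleCover

variable {K : Type} [Field K] [Algebra ℂ K] {f : ℂ[X]} {x y : K}

lemma aeval_ne_zero {L : Type} [Field L] [Algebra ℂ L] {x : L} (hx : Transcendental ℂ x) {p : ℂ[X]}
    (hp : p ≠ 0) : aeval x p ≠ 0 := fun h => hx ⟨p, hp, h⟩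

/-- The map `ℂ(X) → L` that sends `X` to a transcendental element. -/
def ratFuncHom {L : Type} [Field L] [Algebra ℂ L] (x : L) (hx : Transcendental ℂ x) :
    RatFunc ℂ →ₐ[ℂ] L :=
  RatFunc.liftAlgHom (aeval x) fun p hp => by
    rw [Submonoid.mem_comap]
    exact mem_nonZeroDivisors_of_ne_zero (aeval_ne_zero hx (nonZeroDivisors.ne_zero hp))

lemma ratFuncHom_algebraMap {L : Type} [Field L] [Algebra ℂ L] (x : L) (hx : Transcendental ℂ x)
    (p : ℂ[X]) : ratFuncHom x hx (algebraMap ℂ[X] (RatFunc ℂ) p) = aeval x p := by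
  have := RatFunc.liftAlgHom_apply_div' (φ := aeval x) (fun p hp => by
    rw [Submonoid.mem_comap]
    exact mem_nonZeroDivisors_of_ne_zero (aeval_ne_zero hx (nonZeroDivisors.ne_zero hp))) p 1
  simpa [ratFuncHom] using this

/-- The map `ℂ(X)[Y]/(Y² - f) → L` given by a solution of `y² = f(x)`. -/
def modelHom {L : Type} [Field L] [Algebra ℂ L] {x y : L} (hx : Transcendental ℂ x)
    (h : y ^ 2 = aeval x f) : AdjoinRoot (coverEquation f) →ₐ[ℂ] L :=
  AdjoinRoot.liftAlgHom _ (ratFuncHom x hx) y (by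
    simp [coverEquation, ratFuncHom_algebraMap, h])

lemma modelHom_of {L : Type} [Field L] [Algebra ℂ L] {x y : L} (hx : Transcendental ℂ x)
    (h : y ^ 2 = aeval x f) (a : RatFunc ℂ) :
    modelHom hx h (AdjoinRoot.of _ a) = ratFuncHom x hx a := by
  simp [modelHom]

lemma modelHom_root {L : Type} [Field L] [Algebra ℂ L] {x y : L} (hx : Transcendental ℂ x)
    (h : y ^ 2 = aeval x f) : modelHom hx h (AdjoinRoot.root _) = y := by
  simp [modelHom]

lemma modelHom_bijective (hf : Squarefree f) (hd : 0 < f.natDegree) (h : IsDoubleCover f x y) :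
    Function.Bijective (modelHom h.transcendental h.sq) := by
  have := Fact.mk (coverEquation_irreducible hf hd)
  refine ⟨RingHom.injective (modelHom h.transcendental h.sq).toRingHom, fun z => ?_⟩
  have hle : IntermediateField.adjoin ℂ {x, y} ≤ (modelHom h.transcendental h.sq).fieldRange := by
    rw [IntermediateField.adjoin_le_iff]
    rintro _ (rfl | rfl)
    · exact ⟨AdjoinRoot.of _ (algebraMap ℂ[X] _ X), (modelHom_of _ _ _).trans
        (by rw [ratFuncHom_algebraMap, aeval_X])⟩
    · exact ⟨AdjoinRoot.root _, modelHom_root _ _⟩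
  rw [h.adjoin_eq] at hle
  exact hle trivial

/-- The identification of `ℂ(x, y)` with `ℂ(X)[Y]/(Y² - f)`. -/
def modelEquiv (hf : Squarefree f) (hd : 0 < f.natDegree) (h : IsDoubleCover f x y) :
    AdjoinRoot (coverEquation f) ≃ₐ[ℂ] K :=
  AlgEquiv.ofBijective (modelHom h.transcendental h.sq) (h.modelHom_bijective hf hd)

/-- Solutions of `y² = f(x)` with `x` transcendental are the images of the generic one. -/
lemma exists_algHom (hf : Squarefree f) (hd : 0 < f.natDegree) (h : IsDoubleCover f x y)
    {L : Type} [Field L] [Algebra ℂ L] {x' y' : L} (hx : Transcendental ℂ x')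
    (h' : y' ^ 2 = aeval x' f) : ∃ φ : K →ₐ[ℂ] L, φ x = x' ∧ φ y = y' := by
  have h1 : (h.modelEquiv hf hd).symm x = AdjoinRoot.of _ (algebraMap ℂ[X] _ X) := by
    rw [AlgEquiv.symm_apply_eq]
    exact ((modelHom_of h.transcendental h.sq _).trans (by rw [ratFuncHom_algebraMap, aeval_X])).symm
  have h2 : (h.modelEquiv hf hd).symm y = AdjoinRoot.root _ := by
    rw [AlgEquiv.symm_apply_eq]
    exact (modelHom_root h.transcendental h.sq).symm
  refine ⟨(modelHom hx h').comp (h.modelEquiv hf hd).symm.toAlgHom, ?_, ?_⟩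
  · change modelHom hx h' ((h.modelEquiv hf hd).symm x) = x'
    rw [h1, modelHom_of, ratFuncHom_algebraMap, aeval_X]
  · change modelHom hx h' ((h.modelEquiv hf hd).symm y) = y'
    rw [h2, modelHom_root]

lemma nonempty_algEquiv (hf : Squarefree f) (hd : 0 < f.natDegree) (h : IsDoubleCover f x y)
    {L : Type} [Field L] [Algebra ℂ L] {x' y' : L} (h' : IsDoubleCover f x' y') :
    Nonempty (K ≃ₐ[ℂ] L) :=
  ⟨(h.modelEquiv hf hd).symm.trans (h'.modelEquiv hf hd)⟩

lemma y_ne_zero (hd : 0 < f.natDegree) (h : IsDoubleCover f x y) : y ≠ 0 := by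
  rintro rfl
  have := h.sq
  refine aeval_ne_zero h.transcendental (p := f) ?_ (by rw [← this]; norm_num)
  rintro rfl
  simp at hd

lemma exists_ratFuncHom_eq {L : Type} [Field L] [Algebra ℂ L] {x : L} (hx : Transcendental ℂ x)
    (a : RatFunc ℂ) : ∃ p d : ℂ[X], IsCoprime p d ∧ d ≠ 0 ∧
      ratFuncHom x hx a = aeval x p / aeval x d := by
  refine ⟨a.num, a.denom, a.isCoprime_num_denom, a.denom_ne_zero, ?_⟩
  rw [← ratFuncHom_algebraMap x hx, ← ratFuncHom_algebraMap x hx, ← map_div₀,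
    RatFunc.num_div_denom]

/-- Every element of `ℂ(x, y)` is the sum of a rational function of `x` and of the quotient of a
rational function of `x` by `y`. -/
lemma exists_eq_add (hf : Squarefree f) (hd : 0 < f.natDegree) (h : IsDoubleCover f x y) (g : K) :
    ∃ p d q e : ℂ[X], IsCoprime p d ∧ d ≠ 0 ∧ IsCoprime q e ∧ e ≠ 0 ∧
      g = aeval x p / aeval x d + aeval x q / aeval x e / y := by
  obtain ⟨z, rfl⟩ := (h.modelHom_bijective hf hd).2 g
  obtain ⟨P, rfl⟩ := AdjoinRoot.mk_surjective z
  have hm : (coverEquation f).Monic := monic_X_pow_sub_C _ two_ne_zero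
  have hdeg : (P %ₘ coverEquation f).degree ≤ 1 := by
    have h0 : (coverEquation f).natDegree = 2 := natDegree_X_pow_sub_C
    have h1 := natDegree_modByMonic_lt P hm (fun h => by simp [h] at h0)
    have h2 : (P %ₘ coverEquation f).natDegree ≤ 1 := by lia
    exact degree_le_of_natDegree_le h2
  have hP : AdjoinRoot.mk (coverEquation f) P = AdjoinRoot.mk _ (P %ₘ coverEquation f) := by
    rw [AdjoinRoot.mk_eq_mk]
    exact ⟨P /ₘ coverEquation f, by
      rw [eq_comm, ← sub_eq_zero]
      linear_combination (modByMonic_add_div P (coverEquation f))⟩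
  rw [hP, eq_X_add_C_of_degree_le_one hdeg]
  set b := (P %ₘ coverEquation f).coeff 1
  set a := (P %ₘ coverEquation f).coeff 0
  obtain ⟨p, d, h1, h2, h3⟩ := exists_ratFuncHom_eq h.transcendental a
  -- Since `b y = b f / y`, the fraction for the second summand is that of `b f`.
  obtain ⟨q, e, h4, h5, h6⟩ := exists_ratFuncHom_eq h.transcendental
    (b * algebraMap ℂ[X] (RatFunc ℂ) f)
  refine ⟨p, d, q, e, h1, h2, h4, h5, ?_⟩
  rw [← h3, ← h6, map_mul, ratFuncHom_algebraMap, ← h.sq]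
  simp only [map_add, map_mul, AdjoinRoot.mk_C, AdjoinRoot.mk_X, modelHom_of, modelHom_root]
  have := h.y_ne_zero hd
  field_simp
  ring

end IsDoubleCover

/-! ### Holomorphic differentials -/

open LaurentSeries

/-- The differential `g dx` is holomorphic: it has no pole at the centre of any parametrization by
Laurent series. -/
def IsHolomorphic {K : Type} [Field K] [Algebra ℂ K] (g x : K) : Prop :=
  ∀ φ : K →ₐ[ℂ] LaurentSeries ℂ, IsSmall (φ g * euler (φ x))

lemma aeval_eq_pow_mul_reverse {L : Type} [Field L] [Algebra ℂ L] {a : L} (ha : a ≠ 0) (p : ℂ[X]) :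
    aeval a p = a ^ p.natDegree * aeval a⁻¹ p.reverse := by
  have := invertibleOfNonzero ha
  have h := eval₂_reverse_mul_pow (algebraMap ℂ L) a p
  rw [invOf_eq_inv] at h
  rw [aeval_def, aeval_def, ← h, mul_comm]

namespace LaurentSeries

lemma isSmall_pow {a : LaurentSeries ℂ} (ha : IsSmall a) {n : ℕ} (hn : n ≠ 0) :
    IsSmall (a ^ n) := by
  obtain ⟨k, rfl⟩ := Nat.exists_eq_succ_of_ne_zero hn
  rw [pow_succ]
  exact ha.mem_mul (pow_mem ha.mem k)

lemma isSmall_of_two_mul {a : LaurentSeries ℂ} (h : IsSmall (2 * a)) : IsSmall a := by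
  have h2 := h.mem_mul (algebraMap_mem (1 / 2))
  rw [← mul_assoc] at h2
  have : algebraMap ℂ (LaurentSeries ℂ) (1 / 2) * 2 = 1 := by
    rw [← map_ofNat (algebraMap ℂ (LaurentSeries ℂ)) 2, ← map_mul]
    norm_num
  rwa [this, one_mul] at h2

lemma two_ne_zero : (2 : LaurentSeries ℂ) ≠ 0 := by
  rw [← map_ofNat (algebraMap ℂ (LaurentSeries ℂ)) 2]
  simp

lemma euler_inv {a : LaurentSeries ℂ} (ha : a ≠ 0) : euler a⁻¹ = -(euler a / a ^ 2) := by
  have h := euler_mul a a⁻¹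
  rw [mul_inv_cancel₀ ha, ← map_one (algebraMap ℂ (LaurentSeries ℂ)), euler_algebraMap] at h
  field_simp
  field_simp at h
  linear_combination -h

lemma mem_of_isSmall_param_mul {a : LaurentSeries ℂ} (h : IsSmall (param * a)) : a ∈ regular := by
  obtain ⟨b, hb, h⟩ := isSmall_iff.mp h
  rwa [mul_left_cancel₀ param_ne_zero h]

/-- The constant term of `p.reverse` is the leading coefficient of `p`. Together with
`aeval_eq_pow_mul_reverse` this gives the exact pole order of `p` at infinity, where `T = 1 / x` is
small. -/
lemma reverse_small {p : ℂ[X]} {T : LaurentSeries ℂ} (hT : IsSmall T) (hp : p ≠ 0) :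
    ¬ IsSmall (aeval T p.reverse) := by
  rw [isSmall_aeval_iff (c := 0) (by simpa using hT), ← coeff_zero_eq_eval_zero, coeff_zero_reverse]
  exact leadingCoeff_ne_zero.mpr hp

end LaurentSeries

lemma eval_derivative_ne_zero {f : ℂ[X]} (hf : Squarefree f) {c : ℂ} (hc : f.eval c = 0) :
    (Polynomial.derivative f).eval c ≠ 0 := by
  obtain ⟨g, rfl, hg⟩ := exists_simple_factor hf hc
  simpa using hg

namespace IsDoubleCover

variable {K : Type} [Field K] [Algebra ℂ K] {f : ℂ[X]} {x y : K}

/-- Every differential of `ℂ(x, y)` is a multiple of `dx`. -/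
lemma exists_euler_eq (hd : 0 < f.natDegree) (h : IsDoubleCover f x y) (a : K) :
    ∃ b : K, ∀ φ : K →ₐ[ℂ] LaurentSeries ℂ, euler (φ a) = φ b * euler (φ x) := by
  have ha : a ∈ IntermediateField.adjoin ℂ {x, y} := by rw [h.adjoin_eq]; trivial
  induction ha using IntermediateField.adjoin_induction with
  | mem a ha =>
    rcases ha with rfl | rfl
    · exact ⟨1, by simp⟩
    -- The relation `a² = f(x)` gives `2 a da = f'(x) dx`.
    · refine ⟨aeval x (Polynomial.derivative f) / (2 * a), fun φ => ?_⟩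
      have hy : φ a ≠ 0 := by simpa using h.y_ne_zero hd
      have h20 := LaurentSeries.two_ne_zero
      have h1 : φ a ^ 2 = aeval (φ x) f := by rw [← map_pow, h.sq, aeval_algHom_apply]
      have h2 := euler_aeval (φ x) f
      rw [← h1, pow_two, euler_mul] at h2
      rw [map_div₀, ← aeval_algHom_apply, map_mul, map_ofNat]
      field_simp
      linear_combination h2
  | algebraMap c => exact ⟨0, fun φ => by simp [euler_algebraMap]⟩
  | add a b _ _ ha hb =>
    obtain ⟨u, hu⟩ := ha
    obtain ⟨v, hv⟩ := hb
    exact ⟨u + v, fun φ => by rw [map_add, euler_add, hu, hv, map_add, add_mul]⟩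
  | inv a _ ha =>
    obtain ⟨u, hu⟩ := ha
    rcases eq_or_ne a 0 with rfl | h0
    · refine ⟨0, fun φ => ?_⟩
      simpa using euler_algebraMap 0
    · refine ⟨-(u / a ^ 2), fun φ => ?_⟩
      rw [map_inv₀, euler_inv (by simpa using h0), hu]
      simp
      ring
  | mul a b _ _ ha hb =>
    obtain ⟨u, hu⟩ := ha
    obtain ⟨v, hv⟩ := hb
    exact ⟨u * b + a * v, fun φ => by simp only [map_mul, euler_mul, hu, hv, map_add]; ring⟩

/-- Three kinds of centre occur. Over a root of `f` one uses `dx / y = 2 dy / f'(x)`, where `f'`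
does not vanish. Over any other finite point `y` is a unit. Over infinity, with `T = 1 / x`, the
series `W = y T ^ m` is a unit because `W² = f.reverse(T)`. There `r dx / y = -r.reverse(T) T ^ k
W⁻¹ dT` with `k = m - 2 - deg r ≥ 0`. -/
lemma isHolomorphic {m : ℕ} (hf : Squarefree f) (hm : 0 < m) (hd : f.natDegree = 2 * m)
    (h : IsDoubleCover f x y) {r : ℂ[X]} (hr : r.natDegree + 2 ≤ m) :
    IsHolomorphic (aeval x r / y) x := by
  intro φ
  have hY : φ y ≠ 0 := by simpa using h.y_ne_zero (by lia)
  have hsq : φ y ^ 2 = aeval (φ x) f := by rw [← map_pow, h.sq, aeval_algHom_apply]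
  rw [map_div₀, ← aeval_algHom_apply]
  set X := φ x
  set Y := φ y
  by_cases hX : X ∈ regular
  · obtain ⟨c, hc⟩ := exists_isSmall_sub hX
    have hYr : Y ∈ regular := mem_of_sq_mem (hsq ▸ aeval_mem hX f)
    by_cases h0 : f.eval c = 0
    · have hdf := mt (isSmall_aeval_iff hc _).mp (eval_derivative_ne_zero hf h0)
      have hdf0 : aeval X (Polynomial.derivative f) ≠ 0 := fun h0 => hdf (h0 ▸ IsSmall.zero)
      have h2 := euler_aeval X f
      rw [← hsq, pow_two, euler_mul] at h2
      have : aeval X r / Y * euler X =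
          2 * aeval X r * (aeval X (Polynomial.derivative f))⁻¹ * euler Y := by
        field_simp
        linear_combination -aeval X r * h2
      rw [this]
      refine (isSmall_euler hYr).mem_mul (mul_mem (mul_mem ?_ (aeval_mem hX r))
        (inv_mem (aeval_mem hX _) hdf))
      exact ofNat_mem _ 2
    · have hYs : ¬ IsSmall Y := fun hs => mt (isSmall_aeval_iff hc _).mp h0 (hsq ▸
        isSmall_pow hs _root_.two_ne_zero)
      rw [div_eq_mul_inv]
      exact (isSmall_euler hX).mem_mul (mul_mem (aeval_mem hX r) (inv_mem hYr hYs))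
  · have hT := isSmall_inv hX
    have hX0 : X ≠ 0 := fun h0 => hX (h0 ▸ zero_mem _)
    have hf0 : f ≠ 0 := hf.ne_zero
    set T := X⁻¹ with hTdef
    have hXT : X = T⁻¹ := by rw [hTdef, inv_inv]
    have hT0 : T ≠ 0 := inv_ne_zero hX0
    have hW : (Y * T ^ m) ^ 2 = aeval T f.reverse := by
      rw [mul_pow, hsq, aeval_eq_pow_mul_reverse hX0, hd, ← hTdef, hXT, inv_pow]
      field_simp
      ring
    have hWr : Y * T ^ m ∈ regular := mem_of_sq_mem (hW ▸ aeval_mem hT.mem _)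
    have hWs : ¬ IsSmall (Y * T ^ m) := fun hs =>
      reverse_small hT hf0 (hW ▸ isSmall_pow hs _root_.two_ne_zero)
    obtain ⟨k, hk⟩ := Nat.exists_eq_add_of_le hr
    have : aeval X r / Y * euler X =
        -(aeval T r.reverse * T ^ k * (Y * T ^ m)⁻¹ * euler T) := by
      rw [aeval_eq_pow_mul_reverse hX0, ← hTdef]
      rw [hXT, euler_inv hT0, hk, inv_pow]
      field_simp
      ring
    rw [this]
    exact ((isSmall_euler hT.mem).mem_mul (mul_mem (mul_mem (aeval_mem hT.mem _)
      (pow_mem hT.mem _)) (inv_mem hWr hWs))).neg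

/-- A holomorphic differential `(P + Q / y) dx` on `ℂ(x, y)` splits into two parts. -/
lemma isSmall_parts (hf : Squarefree f) (hd : 0 < f.natDegree) (h : IsDoubleCover f x y)
    {p d q e : ℂ[X]}
    (hg : IsHolomorphic (aeval x p / aeval x d + aeval x q / aeval x e / y) x)
    {X Y : LaurentSeries ℂ} (hX : Transcendental ℂ X) (hY : Y ^ 2 = aeval X f) :
    IsSmall (aeval X p / aeval X d * euler X) ∧
      IsSmall (aeval X q / aeval X e / Y * euler X) := by
  obtain ⟨φ, hφx, hφy⟩ := h.exists_algHom hf hd hX hY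
  -- The conjugate parametrization `(X, -Y)` changes the sign of the second part only. Sum and
  -- difference are therefore twice the two parts.
  obtain ⟨ψ, hψx, hψy⟩ := h.exists_algHom hf hd hX (y' := -Y) (by rw [← hY]; ring)
  have h1 := hg φ
  have h2 := hg ψ
  simp only [map_add, map_div₀, ← aeval_algHom_apply, hφx, hφy, hψx, hψy] at h1 h2
  constructor
  · refine isSmall_of_two_mul ?_
    convert h1.add h2 using 1
    ring
  · refine isSmall_of_two_mul ?_
    convert h1.sub h2 using 1
    ring

/-- A zero of a denominator at `c` would be a pole over `c`. This is tested on one parametrization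
centred there: `x = c + t`, with `y` a unit, if `f(c) ≠ 0`, and `x = c + t²`, `y = t U` with a unit
`U`, if `c` is a root of `f`. Each part is small separately, which forces the numerator to vanish at
`c` too, against coprimality. -/
lemma eval_ne_zero_of_isHolomorphic (hf : Squarefree f) (hd : 0 < f.natDegree)
    (h : IsDoubleCover f x y) {p d q e : ℂ[X]} (hpd : IsCoprime p d) (hqe : IsCoprime q e)
    (hd0 : d ≠ 0) (he0 : e ≠ 0)
    (hg : IsHolomorphic (aeval x p / aeval x d + aeval x q / aeval x e / y) x) (c : ℂ) :
    d.eval c ≠ 0 ∧ e.eval c ≠ 0 := by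
  have hcop {a b : ℂ[X]} (hab : IsCoprime a b) (ha : a.eval c = 0) (hb : b.eval c = 0) : False := by
    obtain ⟨u, v, huv⟩ := hab
    simpa [ha, hb] using congrArg (eval c) huv
  by_cases h0 : f.eval c = 0
  · obtain ⟨g, hfg, hgc⟩ := exists_simple_factor hf h0
    set X := algebraMap ℂ (LaurentSeries ℂ) c + param ^ 2 with hX
    have hXc : X - algebraMap ℂ (LaurentSeries ℂ) c = param ^ 2 := by simp [hX]
    have hs : IsSmall (X - algebraMap ℂ (LaurentSeries ℂ) c) :=
      hXc ▸ isSmall_pow isSmall_param two_ne_zero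
    have hXr : X ∈ regular := by simpa using add_mem hs.mem (algebraMap_mem c)
    have htr : Transcendental ℂ X := by
      intro halg
      have := halg.sub (isAlgebraic_algebraMap (R := ℂ) (A := LaurentSeries ℂ) c)
      rw [hXc] at this
      exact transcendental_of_small (isSmall_pow isSmall_param _root_.two_ne_zero)
        (pow_ne_zero 2 param_ne_zero) this
    obtain ⟨U, hU, hU2, hUs⟩ := exists_sq (aeval_mem hXr g) (mt (isSmall_aeval_iff hs g).mp hgc)
    have hU0 : U ≠ 0 := fun h0 => hUs (h0 ▸ IsSmall.zero)
    have hY : (param * U) ^ 2 = aeval X f := by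
      rw [hfg, map_mul, ← hU2, map_sub, aeval_X, aeval_C, hXc]
      ring
    obtain ⟨h1, h2⟩ := h.isSmall_parts hf hd hg htr hY
    have hEX : euler X = 2 * param ^ 2 := by
      rw [hX, euler_add, euler_algebraMap, pow_two, euler_mul, euler_param]
      ring
    rw [hEX] at h1 h2
    have ht := param_ne_zero
    constructor
    · intro hdc
      obtain ⟨b, hb, h1⟩ := isSmall_iff.mp (isSmall_of_two_mul
        (a := aeval X p / aeval X d * param ^ 2) (by convert h1 using 1; ring))
      obtain ⟨d', hd'⟩ := dvd_iff_isRoot.mpr hdc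
      have hdX := aeval_ne_zero htr hd0
      rw [hd', map_mul, map_sub, aeval_X, aeval_C, hXc] at h1 hdX
      have hdX' := (mul_ne_zero_iff.mp hdX).2
      have : aeval X p = param * (aeval X d' * b) := by
        field_simp at h1
        linear_combination h1
      refine hcop hpd ((isSmall_aeval_iff hs p).mp ?_) hdc
      rw [this]
      exact isSmall_param.mul_mem (mul_mem (aeval_mem hXr _) hb)
    · intro hec
      have hes := (isSmall_aeval_iff hs e).mpr hec
      have heX := aeval_ne_zero htr he0
      obtain ⟨b, hb, h2⟩ := isSmall_iff.mp (isSmall_of_two_mul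
        (a := aeval X q / aeval X e / (param * U) * param ^ 2) (by convert h2 using 1; ring))
      have : aeval X q = aeval X e * (U * b) := by
        field_simp at h2
        linear_combination h2
      refine hcop hqe ((isSmall_aeval_iff hs q).mp ?_) hec
      rw [this]
      exact hes.mul_mem (mul_mem hU hb)
  · set X := algebraMap ℂ (LaurentSeries ℂ) c + param with hX
    have hXc : X - algebraMap ℂ (LaurentSeries ℂ) c = param := by simp [hX]
    have hs : IsSmall (X - algebraMap ℂ (LaurentSeries ℂ) c) := hXc ▸ isSmall_param
    have hXr : X ∈ regular := by simpa using add_mem hs.mem (algebraMap_mem c)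
    have htr : Transcendental ℂ X := by
      intro halg
      have := halg.sub (isAlgebraic_algebraMap (R := ℂ) (A := LaurentSeries ℂ) c)
      rw [hXc] at this
      exact transcendental_of_small isSmall_param param_ne_zero this
    obtain ⟨Y, hY, hY2, hYs⟩ := exists_sq (aeval_mem hXr f) (mt (isSmall_aeval_iff hs f).mp h0)
    have hY0 : Y ≠ 0 := fun h0 => hYs (h0 ▸ IsSmall.zero)
    obtain ⟨h1, h2⟩ := h.isSmall_parts hf hd hg htr hY2
    have hEX : euler X = param := by
      rw [hX, euler_add, euler_algebraMap, euler_param, zero_add]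
    rw [hEX, mul_comm] at h1 h2
    constructor
    · intro hdc
      have hds := (isSmall_aeval_iff hs d).mpr hdc
      refine hcop hpd ((isSmall_aeval_iff hs p).mp ?_) hdc
      have := hds.mul_mem (mem_of_isSmall_param_mul h1)
      rwa [mul_div_cancel₀ _ (aeval_ne_zero htr hd0)] at this
    · intro hec
      have hes := (isSmall_aeval_iff hs e).mpr hec
      refine hcop hqe ((isSmall_aeval_iff hs q).mp ?_) hec
      have := (hes.mul_mem (mem_of_isSmall_param_mul h2)).mul_mem hY
      have heX := aeval_ne_zero htr he0
      convert this using 1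
      field_simp

/-- The holomorphic differentials on `y² = f(x)`. -/
lemma exists_of_isHolomorphic {m : ℕ} (hf : Squarefree f) (hm : 0 < m) (hd : f.natDegree = 2 * m)
    (h : IsDoubleCover f x y) {g : K} (hg : IsHolomorphic g x) :
    ∃ r : ℂ[X], (r ≠ 0 → r.natDegree + 2 ≤ m) ∧ g = aeval x r / y := by
  obtain ⟨p, d, q, e, hpd, hd0, hqe, he0, rfl⟩ := h.exists_eq_add hf (by lia) g
  have hev := h.eval_ne_zero_of_isHolomorphic hf (by lia) hpd hqe hd0 he0 hg
  have hconst {d : ℂ[X]} (hd : ∀ c, d.eval c ≠ 0) : ∃ k : ℂ, k ≠ 0 ∧ d = C k := by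
    have hdeg : d.degree = 0 := by
      by_contra hne
      obtain ⟨c, hc⟩ := IsAlgClosed.exists_root d hne
      exact hd c hc
    rw [eq_C_of_degree_eq_zero hdeg] at hd ⊢
    exact ⟨_, by simpa using hd 0, rfl⟩
  obtain ⟨k, hk, rfl⟩ := hconst fun c => (hev c).1
  obtain ⟨l, hl, rfl⟩ := hconst fun c => (hev c).2
  have ht := param_ne_zero
  -- The denominators are constants by now. The parametrization at infinity, `x = 1 / t` and `y =
  -- t⁻ᵐ W` with a unit `W`, bounds the numerators.
  have htr : Transcendental ℂ (param⁻¹) := by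
    intro halg
    have := halg.inv
    rw [inv_inv] at this
    exact transcendental_of_small isSmall_param ht this
  obtain ⟨W, hW, hW2, hWs⟩ := exists_sq (aeval_mem isSmall_param.mem f.reverse)
    (reverse_small isSmall_param hf.ne_zero)
  have hW0 : W ≠ 0 := fun h0 => hWs (h0 ▸ IsSmall.zero)
  have hY : (param⁻¹ ^ m * W) ^ 2 = aeval param⁻¹ f := by
    rw [aeval_eq_pow_mul_reverse (inv_ne_zero ht), inv_inv, ← hW2, hd]
    ring
  obtain ⟨h1, h2⟩ := h.isSmall_parts hf (by lia) hg htr hY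
  have hE : euler param⁻¹ = -param⁻¹ := by
    rw [euler_inv ht, euler_param]
    field_simp
  have hkL : algebraMap ℂ (LaurentSeries ℂ) k ≠ 0 := by simpa using hk
  have hlL : algebraMap ℂ (LaurentSeries ℂ) l ≠ 0 := by simpa using hl
  have hlK : algebraMap ℂ K l ≠ 0 := by simpa using hl
  simp only [aeval_C, hE] at h1 h2 ⊢
  -- A nonzero polynomial part `p dx` has a pole at infinity, since `dx = -dt / t²`.
  have hp : p = 0 := by
    by_contra hp
    have hs := reverse_small isSmall_param hp
    refine hs ?_
    have := h1.mem_mul (mul_mem (algebraMap_mem (-k)) (pow_mem isSmall_param.mem (p.natDegree + 1)))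
    convert this using 1
    rw [aeval_eq_pow_mul_reverse (inv_ne_zero ht), inv_inv, map_neg, inv_pow]
    field_simp
    ring
  subst hp
  refine ⟨C l⁻¹ * q, fun hq0 => ?_, ?_⟩
  · have hq : q ≠ 0 := by rintro rfl; simp at hq0
    rw [natDegree_C_mul (inv_ne_zero hl)]
    by_contra! hlt
    -- If `m + j = deg q + 1`, then multiplication by `-l W t ^ j` turns the small series of the
    -- second part into `q.reverse(t)`, which is not small.
    obtain ⟨j, hj⟩ := Nat.exists_eq_add_of_le (Nat.le_of_lt_succ hlt)
    have hs := reverse_small isSmall_param hq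
    refine hs ?_
    have := h2.mem_mul (mul_mem (mul_mem (algebraMap_mem (-l)) hW) (pow_mem isSmall_param.mem j))
    convert this using 1
    rw [aeval_eq_pow_mul_reverse (inv_ne_zero ht), inv_inv, map_neg, inv_pow, inv_pow]
    have hpow : param ^ m * param ^ j = param ^ q.natDegree * param := by
      rw [← pow_add, ← pow_succ, ← hj]
    field_simp
    linear_combination -aeval param q.reverse * hpow
  · simp
    field_simp

end IsDoubleCover

/-! ### Products of distinct linear factors -/

/-- The polynomial `a (X - r₁) ⋯ (X - rₙ)`. -/
def linProd (a : ℂ) {n : ℕ} (r : Fin n → ℂ) : ℂ[X] := C a * ∏ i, (X - C (r i))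

lemma natDegree_linProd {a : ℂ} (ha : a ≠ 0) {n : ℕ} (r : Fin n → ℂ) :
    (linProd a r).natDegree = n := by
  rw [linProd, natDegree_C_mul ha, natDegree_prod_of_monic _ _ fun i _ => monic_X_sub_C _]
  simp

lemma squarefree_linProd {a : ℂ} (ha : a ≠ 0) {n : ℕ} {r : Fin n → ℂ} (hr : Function.Injective r) :
    Squarefree (linProd a r) := by
  exact (Separable.unit_mul (isUnit_C.mpr ha.isUnit)
    (separable_prod_X_sub_C_iff.mpr hr)).squarefree

lemma aeval_linProd {K : Type} [Field K] [Algebra ℂ K] (a : ℂ) {n : ℕ} (r : Fin n → ℂ) (x : K) :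
    aeval x (linProd a r) = algebraMap ℂ K a * ∏ i, (x - algebraMap ℂ K (r i)) := by
  simp [linProd]

namespace IsDoubleCover

variable {K : Type} [Field K] [Algebra ℂ K] {f : ℂ[X]} {x y : K}

/-- If `x` were algebraic, so would be `y` and all of `K`. Hence any transcendental element `z`
guarantees that `x` is transcendental. -/
lemma of_adjoin_eq_top {z : K} (hz : Transcendental ℂ z) (hsq : y ^ 2 = aeval x f)
    (hadj : IntermediateField.adjoin ℂ {x, y} = ⊤) : IsDoubleCover f x y := by
  refine ⟨fun hx => hz ?_, hsq, hadj⟩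
  have hy : IsAlgebraic ℂ y := by
    refine IsAlgebraic.of_pow two_pos ?_
    rw [hsq, isAlgebraic_iff_isIntegral]
    exact IsIntegral.of_mem_of_fg _ (hx.isIntegral.fg_adjoin_singleton) _
      (aeval_mem_adjoin_singleton _ _)
  have := IntermediateField.isAlgebraic_adjoin (K := ℂ) (S := {x, y}) (by
    rintro s (rfl | rfl)
    · exact hx.isIntegral
    · exact hy.isIntegral)
  rw [hadj] at this
  have h1 := this.isAlgebraic (⟨z, trivial⟩ : (⊤ : IntermediateField ℂ K))
  exact IntermediateField.isAlgebraic_iff.mp h1 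

lemma of_mem {g : ℂ[X]} {u v : K} (h : IsDoubleCover f x y) (hsq : v ^ 2 = aeval u g)
    (hx : x ∈ IntermediateField.adjoin ℂ {u, v}) (hy : y ∈ IntermediateField.adjoin ℂ {u, v}) :
    IsDoubleCover g u v := by
  refine of_adjoin_eq_top h.transcendental hsq ?_
  rw [eq_top_iff, ← h.adjoin_eq, IntermediateField.adjoin_le_iff]
  rintro _ (rfl | rfl) <;> assumption

lemma map {L : Type} [Field L] [Algebra ℂ L] (h : IsDoubleCover f x y) (e : K ≃ₐ[ℂ] L) :
    IsDoubleCover f (e x) (e y) := by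
  refine ⟨?_, ?_, ?_⟩
  · exact (isAlgebraic_algHom_iff e.toAlgHom e.injective).not.mpr h.transcendental
  · rw [← map_pow, h.sq]
    exact (aeval_algHom_apply e.toAlgHom x f).symm
  · have := congrArg (IntermediateField.map e.toAlgHom) h.adjoin_eq
    rw [IntermediateField.adjoin_map, Set.image_pair] at this
    refine this.trans ?_
    rw [← AlgHom.fieldRange_eq_map, AlgHom.fieldRange_eq_top]
    exact e.surjective

lemma aeval_injective (h : IsDoubleCover f x y) : Function.Injective (aeval (R := ℂ) x) :=
  transcendental_iff_injective.mp h.transcendental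

/-- On `ℂ(x, y)` the differential `dx` does not vanish. -/
lemma exists_euler_ne_zero {m : ℕ} (hf : Squarefree f) (hm : 0 < m) (hd : f.natDegree = 2 * m)
    (h : IsDoubleCover f x y) : ∃ φ : K →ₐ[ℂ] LaurentSeries ℂ, euler (φ x) ≠ 0 := by
  by_contra! h0
  -- If `dx` vanished on every parametrization, then `x ^ m dx / y` would be holomorphic, against
  -- the degree bound.
  obtain ⟨r, hr, hr2⟩ := h.exists_of_isHolomorphic hf hm hd (g := aeval x (X ^ m : ℂ[X]) / y)
    (fun φ => by rw [h0, mul_zero]; exact IsSmall.zero)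
  rw [div_left_inj' (h.y_ne_zero (by lia))] at hr2
  have hrX := h.aeval_injective hr2
  rw [← hrX, natDegree_X_pow] at hr
  have := hr (pow_ne_zero m X_ne_zero)
  lia

end IsDoubleCover

/-! ### Function fields of elliptic curves -/

namespace WeierstrassCurve

variable (W : WeierstrassCurve ℂ)

/-- The coordinate `x` of a Weierstrass curve. -/
def coordX : W.toAffine.FunctionField :=
  algebraMap W.toAffine.CoordinateRing _ (Affine.CoordinateRing.mk W.toAffine (C X))

/-- The coordinate `y` of a Weierstrass curve. -/
def coordY : W.toAffine.FunctionField :=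
  algebraMap W.toAffine.CoordinateRing _ (Affine.CoordinateRing.mk W.toAffine X)

lemma algebraMap_mk_C (p : ℂ[X]) :
    algebraMap W.toAffine.CoordinateRing W.toAffine.FunctionField
      (Affine.CoordinateRing.mk W.toAffine (C p)) = aeval W.coordX p := by
  induction p using Polynomial.induction_on' with
  | add p q hp hq => rw [C_add, map_add, map_add, hp, hq, map_add]
  | monomial n c =>
    rw [← C_mul_X_pow_eq_monomial]
    simp only [map_mul, map_pow, aeval_C, aeval_X]
    rfl

lemma coord_equation : W.coordY ^ 2 + aeval W.coordX (C W.a₁ * X + C W.a₃) * W.coordY =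
    aeval W.coordX (X ^ 3 + C W.a₂ * X ^ 2 + C W.a₄ * X + C W.a₆) := by
  have h : Affine.CoordinateRing.mk W.toAffine (X ^ 2 + C (C W.a₁ * X + C W.a₃) * X
    - C (X ^ 3 + C W.a₂ * X ^ 2 + C W.a₄ * X + C W.a₆)) = 0 := AdjoinRoot.mk_self
  have h2 := congrArg (algebraMap W.toAffine.CoordinateRing W.toAffine.FunctionField) h
  simp only [map_sub, map_add, map_mul, map_pow] at h2
  rw [← algebraMap_mk_C, ← algebraMap_mk_C]
  simp only [map_add, map_mul, map_pow, coordY]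
  rw [map_zero] at h2
  linear_combination h2

/-- Completing the square: `(2 y + a₁ x + a₃)² = 4 x³ + b₂ x² + 2 b₄ x + b₆`, and this cubic is the
2-torsion polynomial. -/
lemma isDoubleCover_functionField :
    IsDoubleCover W.twoTorsionPolynomial.toPoly W.coordX
      (2 * W.coordY + aeval W.coordX (C W.a₁ * X + C W.a₃)) := by
  refine ⟨?_, ?_, ?_⟩
  · rw [transcendental_iff_injective]
    intro p q hpq
    rw [← algebraMap_mk_C, ← algebraMap_mk_C] at hpq
    have h1 := IsFractionRing.injective W.toAffine.CoordinateRing W.toAffine.FunctionField hpq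
    exact FaithfulSMul.algebraMap_injective ℂ[X] W.toAffine.CoordinateRing h1
  · have h := W.coord_equation
    simp only [twoTorsionPolynomial, Cubic.toPoly, b₂, b₄, b₆]
    simp only [map_add, map_mul, aeval_C, aeval_X, map_pow, map_ofNat] at h ⊢
    linear_combination 4 * h
  · set S := IntermediateField.adjoin ℂ {W.coordX,
      2 * W.coordY + aeval W.coordX (C W.a₁ * X + C W.a₃)}
    have hX : W.coordX ∈ S := IntermediateField.subset_adjoin _ _ (by simp)
    have hp (p : ℂ[X]) : aeval W.coordX p ∈ S := by
      induction p using Polynomial.induction_on' with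
      | add p q hp hq => rw [map_add]; exact add_mem hp hq
      | monomial n c => rw [aeval_monomial]; exact mul_mem (algebraMap_mem S c) (pow_mem hX n)
    have hV : 2 * W.coordY + aeval W.coordX (C W.a₁ * X + C W.a₃) ∈ S :=
      IntermediateField.subset_adjoin _ _ (by simp)
    have hY : W.coordY ∈ S := by
      have := mul_mem (algebraMap_mem S (1 / 2)) (sub_mem hV (hp (C W.a₁ * X + C W.a₃)))
      convert this using 1
      rw [add_sub_cancel_right, ← mul_assoc, ← map_ofNat (algebraMap ℂ W.toAffine.FunctionField) 2, ← map_mul]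
      norm_num
    have hR (a : W.toAffine.CoordinateRing) :
        algebraMap W.toAffine.CoordinateRing W.toAffine.FunctionField a ∈ S := by
      obtain ⟨p, q, rfl⟩ := Affine.CoordinateRing.exists_smul_basis_eq a
      rw [Affine.CoordinateRing.smul, Affine.CoordinateRing.smul, mul_one, map_add, map_mul,
        algebraMap_mk_C, algebraMap_mk_C]
      exact add_mem (hp p) (mul_mem (hp q) hY)
    rw [eq_top_iff]
    intro z _
    obtain ⟨a, b, -, rfl⟩ := IsFractionRing.div_surjective (A := W.toAffine.CoordinateRing) z
    exact div_mem (hR a) (hR b)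

end WeierstrassCurve

section Elliptic

variable {F : Type} [Field F] [Algebra ℂ F]

lemma IsEllipticFunctionField.exists_cubic (h : IsEllipticFunctionField F) :
    ∃ (e : Fin 3 → ℂ) (x y : F), Function.Injective e ∧ IsDoubleCover (linProd 4 e) x y := by
  obtain ⟨W, hW, ⟨φ⟩⟩ := h
  have hΔ : W.twoTorsionPolynomial.discr ≠ 0 := by
    rw [W.twoTorsionPolynomial_discr]
    exact mul_ne_zero (by norm_num) hW.isUnit.ne_zero
  have ha : W.twoTorsionPolynomial.a ≠ 0 := by simp [WeierstrassCurve.twoTorsionPolynomial]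
  obtain ⟨e₁, e₂, e₃, he⟩ := (Cubic.splits_iff_roots_eq_three (φ := RingHom.id ℂ) ha).mp
    (IsAlgClosed.splits _)
  have hne := (Cubic.discr_ne_zero_iff_roots_ne ha he).mp hΔ
  have hpoly := Cubic.eq_prod_three_roots ha he
  have h1 := W.isDoubleCover_functionField.map φ
  have hlin : W.twoTorsionPolynomial.toPoly = linProd 4 ![e₁, e₂, e₃] := by
    rw [Cubic.map_toPoly, Polynomial.map_id] at hpoly
    rw [hpoly, linProd, Fin.prod_univ_three]
    simp [WeierstrassCurve.twoTorsionPolynomial, mul_assoc]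
  rw [hlin] at h1
  refine ⟨_, _, _, ?_, h1⟩
  intro i j hij
  fin_cases i <;> fin_cases j <;> simp_all

/-- The substitution `X = L x`, `Y = 2 L y` turns the leading coefficient `L` into 4 and the roots
into `L eᵢ`. This is the completed square of a Weierstrass curve with `a₁ = a₃ = 0`, whose
discriminant is nonzero because the roots are distinct. -/
lemma isEllipticFunctionField_of_cubic {L : ℂ} (hL : L ≠ 0) {e : Fin 3 → ℂ}
    (he : Function.Injective e) {x y : F} (h : IsDoubleCover (linProd L e) x y) :
    IsEllipticFunctionField F := by
  set W : WeierstrassCurve ℂ :=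
    ⟨0, -(L * (e 0 + e 1 + e 2)), 0, L ^ 2 * (e 0 * e 1 + e 0 * e 2 + e 1 * e 2),
      -(L ^ 3 * (e 0 * e 1 * e 2))⟩ with hWdef
  have hlin : W.twoTorsionPolynomial.toPoly = linProd 4 fun i => L * e i := by
    rw [linProd, Fin.prod_univ_three]
    simp only [WeierstrassCurve.twoTorsionPolynomial, Cubic.toPoly, hWdef, WeierstrassCurve.b₂,
      WeierstrassCurve.b₄, WeierstrassCurve.b₆]
    simp only [C_mul, C_add, C_neg, C_pow, map_ofNat, C_0]
    ring
  have hinj : Function.Injective fun i => L * e i := fun i j hij => he (mul_left_cancel₀ hL hij)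
  have hΔ : IsUnit W.Δ := by
    have h01 : e 0 - e 1 ≠ 0 := sub_ne_zero.mpr (he.ne (by decide))
    have h02 : e 0 - e 2 ≠ 0 := sub_ne_zero.mpr (he.ne (by decide))
    have h12 : e 1 - e 2 ≠ 0 := sub_ne_zero.mpr (he.ne (by decide))
    have : W.Δ = 16 * L ^ 6 * ((e 0 - e 1) * (e 0 - e 2) * (e 1 - e 2)) ^ 2 := by
      simp only [WeierstrassCurve.Δ, hWdef, WeierstrassCurve.b₂, WeierstrassCurve.b₄,
        WeierstrassCurve.b₆, WeierstrassCurve.b₈]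
      ring
    rw [this, isUnit_iff_ne_zero]
    exact mul_ne_zero (mul_ne_zero (by norm_num) (pow_ne_zero _ hL))
      (pow_ne_zero _ (mul_ne_zero (mul_ne_zero h01 h02) h12))
  refine ⟨W, ⟨hΔ⟩, ?_⟩
  have hL' : algebraMap ℂ F L ≠ 0 := by simpa using hL
  have hcov : IsDoubleCover (linProd 4 fun i => L * e i) (algebraMap ℂ F L * x)
      (algebraMap ℂ F (2 * L) * y) := by
    refine h.of_mem ?_ ?_ ?_
    · rw [mul_pow, h.sq, aeval_linProd, aeval_linProd, Fin.prod_univ_three, Fin.prod_univ_three]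
      simp only [map_mul, map_ofNat]
      ring
    · have := mul_mem (algebraMap_mem (IntermediateField.adjoin ℂ {algebraMap ℂ F L * x,
        algebraMap ℂ F (2 * L) * y}) L⁻¹) (IntermediateField.subset_adjoin ℂ _ (Set.mem_insert _ _))
      rwa [map_inv₀, inv_mul_cancel_left₀ hL'] at this
    · have := mul_mem (algebraMap_mem (IntermediateField.adjoin ℂ {algebraMap ℂ F L * x,
        algebraMap ℂ F (2 * L) * y}) (2 * L)⁻¹)
        (IntermediateField.subset_adjoin ℂ _ (Set.mem_insert_of_mem _ rfl))
      rwa [map_inv₀, inv_mul_cancel_left₀ (by simpa using hL)] at this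
  have h1 := W.isDoubleCover_functionField
  rw [hlin] at h1
  refine h1.nonempty_algEquiv (squarefree_linProd (by norm_num) hinj) ?_ hcov
  rw [natDegree_linProd (by norm_num)]
  norm_num

/-- Moving a point of an elliptic curve to infinity gives a model with a quartic. -/
lemma IsEllipticFunctionField.exists_quartic (h : IsEllipticFunctionField F) :
    ∃ (f : ℂ[X]) (x y : F), Squarefree f ∧ f.natDegree = 2 * 2 ∧ IsDoubleCover f x y := by
  obtain ⟨e, u, v, he, hcov⟩ := h.exists_cubic
  obtain ⟨c, hc⟩ := Infinite.exists_notMem_finset (Finset.univ.image e)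
  have hce (i : Fin 3) : c - e i ≠ 0 := by
    intro h0
    exact hc (Finset.mem_image.mpr ⟨i, Finset.mem_univ i, (sub_eq_zero.mp h0).symm⟩)
  have huc : u - algebraMap ℂ F c ≠ 0 := by
    intro h0
    rw [sub_eq_zero] at h0
    exact hcov.transcendental (h0 ▸ isAlgebraic_algebraMap c)
  set x := (u - algebraMap ℂ F c)⁻¹ with hx
  have hx0 : x ≠ 0 := inv_ne_zero huc
  have hu : u = algebraMap ℂ F c + x⁻¹ := by rw [hx, inv_inv]; ring
  have hcF (i : Fin 3) : algebraMap ℂ F c - algebraMap ℂ F (e i) ≠ 0 := by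
    rw [← map_sub]; exact (_root_.map_ne_zero _).mpr (hce i)
  -- With `u = c + 1 / x`, the equation times `x⁴` reads `(v x²)² = 4 x ∏ ((c - eᵢ) x + 1)`. The
  -- root 0 is the image of the point at infinity. The even degree is what the computation of
  -- holomorphic differentials requires.
  set a : ℂ := 4 * ((c - e 0) * (c - e 1) * (c - e 2))
  set r : Fin 4 → ℂ := ![0, -(c - e 0)⁻¹, -(c - e 1)⁻¹, -(c - e 2)⁻¹]
  have ha : a ≠ 0 := mul_ne_zero (by norm_num) (mul_ne_zero (mul_ne_zero (hce 0) (hce 1)) (hce 2))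
  have hr : Function.Injective r := by
    have hij {i j : Fin 3} (h : c - e i = c - e j) : i = j := he (by linear_combination -h)
    intro i j hrij
    fin_cases i <;> fin_cases j <;> simp [r, hce] at hrij ⊢ <;>
      first
      | exact absurd (sub_eq_zero.mpr hrij) (hce _)
      | exact absurd (sub_eq_zero.mpr hrij.symm) (hce _)
      | exact absurd (he hrij) (by decide)
  refine ⟨linProd a r, x, v * x ^ 2, squarefree_linProd ha hr, natDegree_linProd ha r, ?_⟩
  have hxm : x ∈ IntermediateField.adjoin ℂ {x, v * x ^ 2} :=
    IntermediateField.subset_adjoin ℂ _ (Set.mem_insert _ _)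
  refine hcov.of_mem ?_ ?_ ?_
  · rw [mul_pow, hcov.sq, aeval_linProd, aeval_linProd, Fin.prod_univ_three, Fin.prod_univ_four, hu]
    have h0 := hcF 0
    have h1 := hcF 1
    have h2 := hcF 2
    simp only [r, a, Matrix.cons_val_zero, Matrix.cons_val_one, Matrix.cons_val, map_neg, map_inv₀,
      map_sub, map_mul, map_zero, map_ofNat]
    field_simp
    ring
  · rw [hu]
    exact add_mem (algebraMap_mem _ c) (inv_mem hxm)
  · have := div_mem (IntermediateField.subset_adjoin ℂ {x, v * x ^ 2} (Set.mem_insert_of_mem _ rfl))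
      (pow_mem hxm 2)
    rwa [mul_div_cancel_right₀ _ (pow_ne_zero 2 hx0)] at this

/-- A field of genus 2 is not the function field of an elliptic curve. -/
lemma IsDoubleCover.not_isEllipticFunctionField {f : ℂ[X]} {x y : F} (hf : Squarefree f)
    (hd : f.natDegree = 2 * 3) (h : IsDoubleCover f x y) : ¬ IsEllipticFunctionField F := by
  intro hell
  obtain ⟨g, u, v, hg, hgd, hcov⟩ := hell.exists_quartic
  have hy := h.y_ne_zero (by lia)
  have hv := hcov.y_ne_zero (by lia)
  obtain ⟨b, hb⟩ := hcov.exists_euler_eq (by lia) x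
  have hb0 : b ≠ 0 := by
    rintro rfl
    obtain ⟨φ, hφ⟩ := h.exists_euler_ne_zero hf (by norm_num) hd
    exact hφ (by rw [hb]; simp)
  -- For a quartic the holomorphic differentials are the constant multiples of `du / v`. Both `dx /
  -- y` and `x dx / y` would be such multiples, which would make their quotient `x` constant.
  have key (r : ℂ[X]) (hr : r.natDegree ≤ 1) (hr0 : r ≠ 0) :
      ∃ k : ℂ, k ≠ 0 ∧ aeval x r * b / y = algebraMap ℂ F k / v := by
    have h1 := h.isHolomorphic hf (by norm_num) hd (r := r) (by lia)
    have h2 : IsHolomorphic (aeval x r * b / y) u := fun φ => by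
      have := h1 φ
      rw [hb] at this
      convert this using 1
      simp only [map_div₀, map_mul]
      ring
    obtain ⟨s, hs, hs2⟩ := hcov.exists_of_isHolomorphic hg (by norm_num) hgd h2
    have hs0 : s ≠ 0 := by
      rintro rfl
      have := IsDoubleCover.aeval_ne_zero h.transcendental hr0
      rw [map_zero, zero_div] at hs2
      simp_all
    have hdeg : s.natDegree = 0 := by have := hs hs0; lia
    rw [eq_C_of_natDegree_eq_zero hdeg] at hs2 hs0
    exact ⟨s.coeff 0, by simpa using hs0, by rw [hs2, aeval_C]⟩
  obtain ⟨k, hk, hk2⟩ := key 1 (by simp) one_ne_zero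
  obtain ⟨l, -, hl2⟩ := key X (by simp) X_ne_zero
  rw [map_one] at hk2
  rw [aeval_X] at hl2
  have hk' : algebraMap ℂ F k ≠ 0 := by simpa using hk
  refine h.transcendental ?_
  have : x = algebraMap ℂ F (l / k) := by
    rw [map_div₀]
    field_simp at hk2 hl2 ⊢
    refine mul_left_cancel₀ hy ?_
    linear_combination hl2 - x * hk2
  rw [this]
  exact isAlgebraic_algebraMap _

/-- A field of rational functions is not the function field of an elliptic curve. -/
lemma not_isEllipticFunctionField_of_adjoin_eq_top {t : F} (ht : Transcendental ℂ t)
    (htop : IntermediateField.adjoin ℂ {t} = ⊤) : ¬ IsEllipticFunctionField F := by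
  intro hell
  obtain ⟨g, u, v, hg, hgd, hcov⟩ := hell.exists_quartic
  have hv := hcov.y_ne_zero (by lia)
  have ht0 : t ≠ 0 := by rintro rfl; exact ht isAlgebraic_zero
  -- The rational field is presented as the conic `y² = x² + 1`, with `t = x + y`. This is the case
  -- `m = 1`, in which no nonzero holomorphic differential exists, whereas `du / v` is one on an
  -- elliptic curve.
  set x := (t - t⁻¹) * algebraMap ℂ F (1 / 2)
  set y := (t + t⁻¹) * algebraMap ℂ F (1 / 2)
  set f : ℂ[X] := linProd 1 ![Complex.I, -Complex.I]
  have hfd : f.natDegree = 2 * 1 := natDegree_linProd one_ne_zero _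
  have hf : Squarefree f := by
    refine squarefree_linProd one_ne_zero ?_
    intro i j hij
    have h1 : Complex.I ≠ -Complex.I := by
      intro h
      have := congrArg Complex.im h
      norm_num at this
    fin_cases i <;> fin_cases j <;> simp_all
  have h2 : algebraMap ℂ F (1 / 2) * 2 = 1 := by
    rw [← map_ofNat (algebraMap ℂ F) 2, ← map_mul]
    norm_num
  have hI : algebraMap ℂ F Complex.I ^ 2 = -1 := by
    rw [← map_pow, Complex.I_sq, map_neg, map_one]
  have hcov2 : IsDoubleCover f x y := by
    refine IsDoubleCover.of_adjoin_eq_top ht ?_ ?_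
    · rw [aeval_linProd, Fin.prod_univ_two]
      simp only [x, y, Matrix.cons_val_zero, Matrix.cons_val_one, map_neg, map_one]
      have : t * t⁻¹ = 1 := mul_inv_cancel₀ ht0
      linear_combination hI + (algebraMap ℂ F (1 / 2) ^ 2 * 4) * this +
        (algebraMap ℂ F (1 / 2) * 2 + 1) * h2
    · rw [eq_top_iff, ← htop, IntermediateField.adjoin_le_iff, Set.singleton_subset_iff]
      have : t = x + y := by simp only [x, y]; linear_combination -t * h2
      rw [this]
      exact add_mem (IntermediateField.subset_adjoin ℂ _ (Set.mem_insert _ _))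
        (IntermediateField.subset_adjoin ℂ _ (Set.mem_insert_of_mem _ rfl))
  obtain ⟨b, hb⟩ := hcov2.exists_euler_eq (by lia) u
  have h1 := hcov.isHolomorphic hg (by norm_num) hgd (r := 1) (by simp)
  have h3 : IsHolomorphic (b / v) x := fun φ => by
    have := h1 φ
    rw [hb] at this
    convert this using 1
    simp only [map_div₀, map_one]
    ring
  obtain ⟨r, hr, hr2⟩ := hcov2.exists_of_isHolomorphic hf one_pos hfd h3
  have hr0 : r = 0 := by
    by_contra h0
    have := hr h0
    lia
  rw [hr0, map_zero, zero_div, div_eq_zero_iff] at hr2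
  obtain ⟨φ, hφ⟩ := hcov.exists_euler_ne_zero hg (by norm_num) hgd
  apply hφ
  rw [hb, hr2.resolve_right hv]
  simp

end Elliptic

/-! ### From elliptic subcovers to involutions of the roots -/

/-- There is an involution of the projective line that exchanges the six points in pairs: three
pairs with `b α α' + d (α + α') = c`. -/
def HasInvolution (a : Fin 6 → ℂ) : Prop :=
  ∃ σ : Fin 6 → Fin 6, (∀ i, σ (σ i) = i) ∧ (∀ i, σ i ≠ i) ∧
    ∃ b c d : ℂ, (b ≠ 0 ∨ c ≠ 0 ∨ d ≠ 0) ∧ ∀ i, b * (a i * a (σ i)) + d * (a i + a (σ i)) = c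

/-- Over a subfield of index 2 there is an involution whose fixed elements lie in the subfield. -/
lemma exists_algEquiv_of_finrank_eq_two {K : Type} [Field K] [Algebra ℂ K]
    (E : IntermediateField ℂ K) (h2 : Module.finrank E K = 2) :
    ∃ τ : K ≃ₐ[ℂ] K, (∃ z, τ z ≠ z) ∧ (∀ z, τ (τ z) = z) ∧ ∀ z, τ z = z ↔ z ∈ E := by
  have hq : Algebra.IsQuadraticExtension E K := ⟨h2⟩
  have hfin : FiniteDimensional E K := Module.finite_of_finrank_pos (by lia)
  have hchar : CharZero E := algebraRat.charZero E
  have hcard : Nat.card (K ≃ₐ[E] K) = 2 := by rw [IsGalois.card_aut_eq_finrank, h2]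
  have hnt : Nontrivial (K ≃ₐ[E] K) := by
    have := Nat.finite_of_card_ne_zero (α := K ≃ₐ[E] K) (by lia)
    exact Finite.one_lt_card_iff_nontrivial.mp (by lia)
  obtain ⟨τ, hτ⟩ := exists_ne (1 : K ≃ₐ[E] K)
  have hall (f : K ≃ₐ[E] K) : f = 1 ∨ f = τ := by
    by_contra! hf
    obtain ⟨u, v, -, huv⟩ := Nat.card_eq_two_iff.mp hcard
    have m (g : K ≃ₐ[E] K) : g = u ∨ g = v := by
      have : g ∈ ({u, v} : Set _) := huv ▸ Set.mem_univ g
      simpa using this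
    rcases m f with h | h <;> rcases m τ with h' | h' <;> rcases m 1 with h'' | h'' <;>
      simp_all
  refine ⟨τ.restrictScalars ℂ, ?_, fun z => ?_, fun z => ⟨fun hz => ?_, fun hz => τ.commutes ⟨z, hz⟩⟩⟩
  · by_contra! h
    exact hτ (AlgEquiv.ext h)
  · have h1 : τ ^ 2 = 1 := hcard ▸ pow_card_eq_one'
    rw [pow_two] at h1
    exact DFunLike.congr_fun h1 z
  · have : z ∈ (⊥ : IntermediateField E K) := by
      rw [IsGalois.mem_bot_iff_fixed]
      intro f
      rcases hall f with rfl | rfl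
      · rfl
      · exact hz
    obtain ⟨e, rfl⟩ := IntermediateField.mem_bot.mp this
    exact e.2

namespace IsDoubleCover

variable {K : Type} [Field K] [Algebra ℂ K] {f : ℂ[X]} {x y : K}

/-- An automorphism of a field of genus 2 acts on `x` by a linear fractional transformation. -/
lemma exists_mobius (hf : Squarefree f) (hd : f.natDegree = 2 * 3) (h : IsDoubleCover f x y)
    (τ : K ≃ₐ[ℂ] K) : ∃ p₀ p₁ q₀ q₁ : ℂ, q₁ * p₀ - q₀ * p₁ ≠ 0 ∧
      algebraMap ℂ K p₁ * x + algebraMap ℂ K p₀ ≠ 0 ∧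
      τ x * (algebraMap ℂ K p₁ * x + algebraMap ℂ K p₀) =
        algebraMap ℂ K q₁ * x + algebraMap ℂ K q₀ ∧
      τ y * (algebraMap ℂ K p₁ * x + algebraMap ℂ K p₀) ^ 3 =
        algebraMap ℂ K (q₁ * p₀ - q₀ * p₁) * y := by
  have hy := h.y_ne_zero (by lia)
  have hτy : τ y ≠ 0 := by simpa using hy
  obtain ⟨b, hb⟩ := h.exists_euler_eq (by lia) (τ x)
  obtain ⟨φ, hφ⟩ := h.exists_euler_ne_zero hf (by norm_num) hd
  have hb0 : b ≠ 0 := by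
    rintro rfl
    apply hφ
    simpa using hb (φ.comp τ.symm.toAlgHom)
  -- The pullbacks under `τ` of `dx / y` and `x dx / y` are holomorphic again, hence linear
  -- polynomials in `x` times `dx / y`. Their quotient is `τ x`; here `b` stands for `d(τ x) / dx`.
  have key (r : ℂ[X]) (hr : r.natDegree ≤ 1) :
      ∃ k l : ℂ, aeval (τ x) r * b * y = (algebraMap ℂ K k * x + algebraMap ℂ K l) * τ y := by
    have h1 := h.isHolomorphic hf (by norm_num) hd (r := r) (by lia)
    have h2 : IsHolomorphic (aeval (τ x) r * b / τ y) x := fun φ => by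
      have := h1 (φ.comp τ.toAlgHom)
      have h3 := hb φ
      have h4 : (φ.comp τ.toAlgHom) (aeval x r / y) = φ (aeval (τ x) r / τ y) := by
        change φ (τ (aeval x r / y)) = _
        rw [map_div₀ τ]
        congr 2
        exact (aeval_algHom_apply τ.toAlgHom x r).symm
      rw [h4, show (φ.comp τ.toAlgHom) x = φ (τ x) from rfl, h3] at this
      convert this using 1
      simp only [map_div₀, map_mul]
      ring
    obtain ⟨s, hs, hs2⟩ := h.exists_of_isHolomorphic hf (by norm_num) hd h2
    have hdeg : s.natDegree ≤ 1 := by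
      rcases eq_or_ne s 0 with rfl | hs0
      · simp
      · have := hs hs0
        lia
    refine ⟨s.coeff 1, s.coeff 0, ?_⟩
    have hsx : aeval x s = algebraMap ℂ K (s.coeff 1) * x + algebraMap ℂ K (s.coeff 0) := by
      conv_lhs => rw [eq_X_add_C_of_natDegree_le_one hdeg]
      simp
    rw [← hsx]
    field_simp at hs2
    linear_combination hs2
  obtain ⟨p₁, p₀, hp⟩ := key 1 (by simp)
  obtain ⟨q₁, q₀, hq⟩ := key X (by simp)
  rw [map_one, one_mul] at hp
  rw [aeval_X] at hq
  set s := algebraMap ℂ K p₁ * x + algebraMap ℂ K p₀ with hs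
  have hs0 : s ≠ 0 := by
    intro h0
    rw [h0, zero_mul] at hp
    exact mul_ne_zero hb0 hy hp
  have hx : τ x * s = algebraMap ℂ K q₁ * x + algebraMap ℂ K q₀ := by
    refine mul_right_cancel₀ hτy ?_
    linear_combination hq - τ x * hp
  -- Differentiating `τ x * s = q₁ x + q₀` gives the usual derivative of a Möbius map, its
  -- determinant over `s²`. It determines `τ y` through `b y = s τ y`.
  have hbs : b * s ^ 2 = algebraMap ℂ K (q₁ * p₀ - q₀ * p₁) := by
    refine φ.toRingHom.injective ?_
    change φ (b * s ^ 2) = φ (algebraMap ℂ K _)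
    refine mul_right_cancel₀ hφ ?_
    have h1 := congrArg (fun z => euler (φ z)) hx
    have h2 := congrArg φ hx
    have h3 : φ s = algebraMap ℂ _ p₁ * φ x + algebraMap ℂ _ p₀ := by simp [hs]
    have h4 : euler (φ s) = algebraMap ℂ _ p₁ * euler (φ x) := by
      simp [h3, euler_add, euler_mul, euler_algebraMap]
    simp only [map_mul, map_add, AlgHom.commutes, euler_mul, euler_add, euler_algebraMap, hb, h4]
      at h1 h2
    simp only [map_mul, map_sub, AlgHom.commutes, map_pow]
    rw [h3] at h1 h2 ⊢
    linear_combination (algebraMap ℂ (LaurentSeries ℂ) p₁ * φ x +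
      algebraMap ℂ (LaurentSeries ℂ) p₀) * h1 - algebraMap ℂ (LaurentSeries ℂ) p₁ * euler (φ x) * h2
  have hΔ : q₁ * p₀ - q₀ * p₁ ≠ 0 := by
    intro h0
    rw [h0, map_zero] at hbs
    exact mul_ne_zero hb0 (pow_ne_zero 2 hs0) hbs
  refine ⟨p₀, p₁, q₀, q₁, hΔ, hs0, hx, ?_⟩
  rw [← hbs]
  linear_combination -s ^ 2 * hp

lemma eq_zero_of_quadratic (h : IsDoubleCover f x y) {u v w : ℂ}
    (h0 : algebraMap ℂ K u * x ^ 2 + algebraMap ℂ K v * x + algebraMap ℂ K w = 0) :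
    u = 0 ∧ v = 0 ∧ w = 0 := by
  have : aeval x (C u * X ^ 2 + C v * X + C w) = aeval x (0 : ℂ[X]) := by simpa using h0
  have hp := h.aeval_injective this
  refine ⟨?_, ?_, ?_⟩
  · simpa [coeff_X, coeff_C] using congrArg (coeff · 2) hp
  · simpa [coeff_X, coeff_C] using congrArg (coeff · 1) hp
  · simpa [coeff_X, coeff_C] using congrArg (coeff · 0) hp

/-- An involution that fixes `x` has the fixed field `ℂ(x)`, which is not elliptic. -/
lemma not_isElliptic_of_fixed (hf : Squarefree f) (hd : 0 < f.natDegree) (h : IsDoubleCover f x y)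
    {E : IntermediateField ℂ K} {τ : K ≃ₐ[ℂ] K} (hne : ∃ z, τ z ≠ z)
    (hE : ∀ z, τ z = z ↔ z ∈ E) (hx : τ x = x) : ¬ IsEllipticFunctionField E := by
  have hy := h.y_ne_zero hd
  have haev (p : ℂ[X]) : τ (aeval x p) = aeval x p := by
    have := aeval_algHom_apply τ.toAlgHom x p
    change aeval (τ x) p = τ (aeval x p) at this
    rw [← this, hx]
  have hτy : τ y = -y := by
    have : τ y ^ 2 = y ^ 2 := by rw [← map_pow, h.sq, haev]
    refine (sq_eq_sq_iff_eq_or_eq_neg.mp this).resolve_left fun h1 => ?_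
    obtain ⟨z, hz⟩ := hne
    obtain ⟨p, d, q, e, -, -, -, -, rfl⟩ := h.exists_eq_add hf hd z
    exact hz (by simp only [map_add, map_div₀, haev, h1])
  have hxE : x ∈ E := (hE x).mp hx
  have h2 : (2 : K) ≠ 0 := by
    rw [← map_ofNat (algebraMap ℂ K) 2]
    simp
  refine not_isEllipticFunctionField_of_adjoin_eq_top (t := (⟨x, hxE⟩ : E)) ?_ ?_
  · intro halg
    exact h.transcendental (IntermediateField.isAlgebraic_iff.mp halg)
  · rw [eq_top_iff]
    rintro ⟨z, hz⟩ -
    have hz' := (hE z).mpr hz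
    obtain ⟨p, d, q, e, -, -, -, -, hzeq⟩ := h.exists_eq_add hf hd z
    have h3 : aeval x q / aeval x e / y = 0 := by
      rw [hzeq] at hz'
      simp only [map_add, map_div₀, haev, hτy] at hz'
      have : 2 * (aeval x q / aeval x e / y) = 0 := by
        rw [div_neg] at hz'
        linear_combination -hz'
      exact (mul_eq_zero.mp this).resolve_left h2
    have hmem (p : ℂ[X]) : aeval (⟨x, hxE⟩ : E) p ∈ IntermediateField.adjoin ℂ {(⟨x, hxE⟩ : E)} :=
      (IntermediateField.algebra_adjoin_le_adjoin ℂ _) (aeval_mem_adjoin_singleton _ _)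
    have : (⟨z, hz⟩ : E) = aeval (⟨x, hxE⟩ : E) p / aeval (⟨x, hxE⟩ : E) d := by
      apply Subtype.ext
      change z = E.val (_ / _)
      rw [map_div₀, ← aeval_algHom_apply, ← aeval_algHom_apply]
      rw [hzeq, h3, add_zero]
      rfl
    rw [this]
    exact div_mem (hmem p) (hmem d)

/-- An involution of the field of genus 2 that moves `x` exchanges the branch points in pairs. -/
lemma hasInvolution_of_algEquiv {a : ℂ} (ha : a ≠ 0) {r : Fin 6 → ℂ} (hr : Function.Injective r)
    (h : IsDoubleCover (linProd a r) x y) {τ : K ≃ₐ[ℂ] K} (hinv : ∀ z, τ (τ z) = z)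
    (hx : τ x ≠ x) : HasInvolution r := by
  have hf := squarefree_linProd ha hr
  have hd : (linProd a r).natDegree = 2 * 3 := natDegree_linProd ha r
  have hy := h.y_ne_zero (by lia)
  obtain ⟨p₀, p₁, q₀, q₁, hΔ, hs0, hτx, hτy⟩ := h.exists_mobius hf hd τ
  set s := algebraMap ℂ K p₁ * x + algebraMap ℂ K p₀ with hs
  have hτs : τ s = algebraMap ℂ K p₁ * τ x + algebraMap ℂ K p₀ := by simp [hs]
  have h2 : x * τ s = algebraMap ℂ K q₁ * τ x + algebraMap ℂ K q₀ := by
    have := congrArg τ hτx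
    simpa [hinv] using this
  -- The Möbius map composed with itself is the identity. Cleared of denominators, this is a
  -- polynomial relation for the transcendental `x`, so its coefficients vanish.
  have hquad : algebraMap ℂ K (p₁ * (q₁ + p₀)) * x ^ 2 + algebraMap ℂ K (p₀ ^ 2 - q₁ ^ 2) * x +
      algebraMap ℂ K (-(q₀ * (q₁ + p₀))) = 0 := by
    simp only [map_mul, map_add, map_sub, map_pow, map_neg]
    rw [hτs] at h2
    rw [hs] at hτx
    linear_combination (algebraMap ℂ K p₁ * x + algebraMap ℂ K p₀) * h2 -
      (algebraMap ℂ K p₁ * x - algebraMap ℂ K q₁) * hτx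
  obtain ⟨e1, e2, e3⟩ := h.eq_zero_of_quadratic hquad
  -- A Möbius map of order dividing 2 is traceless or the identity, and the identity is excluded by
  -- `hx`.
  have htr : q₁ = -p₀ := by
    by_contra hne
    have hne' : q₁ + p₀ ≠ 0 := fun h0 => hne (by linear_combination h0)
    have hp₁ : p₁ = 0 := (mul_eq_zero.mp e1).resolve_right hne'
    have hq₀ : q₀ = 0 := (mul_eq_zero.mp (neg_eq_zero.mp e3)).resolve_right hne'
    have hpq : p₀ = q₁ := by
      have : (p₀ - q₁) * (q₁ + p₀) = 0 := by linear_combination e2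
      linear_combination (mul_eq_zero.mp this).resolve_right hne'
    apply hx
    refine mul_right_cancel₀ hs0 ?_
    rw [hτx, hs, hp₁, hq₀, hpq]
    simp
    ring
  subst htr
  set Δ := -p₀ * p₀ - q₀ * p₁ with hΔdef
  have hΔK : algebraMap ℂ K Δ ≠ 0 := by simpa using hΔ
  -- For a traceless map `τ s * s = -Δ`. Applying `τ y = Δ y / s³` twice then gives `(-Δ)³ = Δ²`.
  -- This normalization is what later excludes fixed roots.
  have hΔ1 : Δ = -1 := by
    have hss : τ s * s = algebraMap ℂ K (-Δ) := by
      rw [hτs, add_mul, mul_assoc, hτx]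
      simp only [hs, hΔdef, map_neg, map_sub, map_mul]
      ring
    have h3 := congrArg τ hτy
    simp only [map_mul, map_pow, hinv, AlgEquiv.commutes] at h3
    have h4 : y * algebraMap ℂ K (-Δ) ^ 3 = algebraMap ℂ K Δ ^ 2 * y := by
      rw [← hss]
      linear_combination s ^ 3 * h3 + algebraMap ℂ K Δ * hτy
    have h5 : algebraMap ℂ K (Δ ^ 2 * (Δ + 1)) = algebraMap ℂ K 0 := by
      refine mul_left_cancel₀ hy ?_
      simp only [map_mul, map_add, map_pow, map_one, map_zero, map_neg] at h4 ⊢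
      linear_combination -h4
    have h6 := (algebraMap ℂ K).injective h5
    linear_combination (mul_eq_zero.mp h6).resolve_left (pow_ne_zero 2 hΔ)
  have hpoly : C a * ∏ j, (C q₀ - C p₀ * X - C (r j) * (C p₁ * X + C p₀)) =
      C (Δ ^ 2) * linProd a r := by
    apply h.aeval_injective
    have h1 : τ y ^ 2 = algebraMap ℂ K a * ∏ j, (τ x - algebraMap ℂ K (r j)) := by
      rw [← map_pow, h.sq, aeval_linProd]
      simp
    have h2 : ∏ j, (algebraMap ℂ K q₀ - algebraMap ℂ K p₀ * x - algebraMap ℂ K (r j) * s) =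
        (∏ j, (τ x - algebraMap ℂ K (r j))) * s ^ 6 := by
      rw [show s ^ 6 = ∏ _j : Fin 6, s by simp, ← Finset.prod_mul_distrib]
      refine Finset.prod_congr rfl fun j _ => ?_
      rw [map_neg] at hτx
      linear_combination -hτx
    simp only [map_mul, map_prod, map_sub, map_add, aeval_C, aeval_X]
    rw [← hs, h2, ← h.sq, map_pow]
    linear_combination -s ^ 6 * h1 + (τ y * s ^ 3 + algebraMap ℂ K Δ * y) * hτy
  have hL (i : Fin 6) : r i * p₁ + p₀ ≠ 0 ∨ q₀ - p₀ * r i ≠ 0 := by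
    by_contra! h0
    apply hΔ
    rw [hΔdef]
    linear_combination -p₀ * h0.1 - p₁ * h0.2
  -- The relation `(τ y)² = f(τ x)` is the identity `hpoly`. Its right side vanishes at `rᵢ`, so the
  -- Möbius map sends `rᵢ` to some root `rⱼ`.
  have hex (i : Fin 6) : ∃ j, p₁ * (r i * r j) + p₀ * (r i + r j) = q₀ := by
    have h1 := congrArg (eval (r i)) hpoly
    have h2 : eval (r i) (linProd a r) = 0 := by
      simp [linProd, eval_prod, Finset.prod_eq_zero (Finset.mem_univ i)]
    rw [eval_mul, eval_mul, h2, mul_zero, eval_C, eval_prod] at h1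
    obtain ⟨j, -, hj⟩ := Finset.prod_eq_zero_iff.mp ((mul_eq_zero.mp h1).resolve_left ha)
    simp at hj
    exact ⟨j, by linear_combination -hj⟩
  choose σ hσ using hex
  have huniq (i j k : Fin 6) (hj : p₁ * (r i * r j) + p₀ * (r i + r j) = q₀)
      (hk : p₁ * (r i * r k) + p₀ * (r i + r k) = q₀) : j = k := by
    have h1 : (r i * p₁ + p₀) * (r j - r k) = 0 := by linear_combination hj - hk
    rcases mul_eq_zero.mp h1 with h1 | h1
    · rcases hL i with h2 | h2
      · exact absurd h1 h2
      · exact absurd (by linear_combination -hj + r j * h1) h2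
    · exact hr (sub_eq_zero.mp h1)
  refine ⟨σ, fun i => huniq (σ i) _ _ (hσ _) (by linear_combination hσ i), fun i hi => ?_,
    p₁, q₀, p₀, ?_, hσ⟩
  -- Suppose the root `rᵢ` were fixed. Cancelling `X - rᵢ` in `hpoly` and evaluating at `rᵢ` gives
  -- `-u⁶ = Δ² = 1`, whereas the fixed point equation gives `u² = -Δ = 1`.
  · have hii := hσ i
    rw [hi] at hii
    set u := p₀ + r i * p₁ with hu
    have hLi : C q₀ - C p₀ * X - C (r i) * (C p₁ * X + C p₀) = (X - C (r i)) * C (-u) := by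
      rw [← hii, hu]
      simp only [C_mul, C_add, C_neg]
      ring
    rw [linProd, ← Finset.mul_prod_erase _ _ (Finset.mem_univ i), hLi,
      ← Finset.mul_prod_erase _ _ (Finset.mem_univ i)] at hpoly
    have hcancel : C a * (C (-u) * ∏ j ∈ Finset.univ.erase i,
        (C q₀ - C p₀ * X - C (r j) * (C p₁ * X + C p₀))) =
        C (Δ ^ 2) * (C a * ∏ j ∈ Finset.univ.erase i, (X - C (r j))) := by
      refine mul_left_cancel₀ (X_sub_C_ne_zero (r i)) ?_
      linear_combination hpoly
    have hev := congrArg (eval (r i)) hcancel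
    have hLj (j : Fin 6) : q₀ - p₀ * r i - r j * (p₁ * r i + p₀) = u * (r i - r j) := by
      rw [hu]
      linear_combination -hii
    simp only [eval_mul, eval_C, eval_prod, eval_sub, eval_add, eval_X, hLj] at hev
    rw [Finset.prod_mul_distrib, Finset.prod_const, Finset.card_erase_of_mem (Finset.mem_univ i),
      Finset.card_univ, Fintype.card_fin] at hev
    have hprod : ∏ j ∈ Finset.univ.erase i, (r i - r j) ≠ 0 :=
      Finset.prod_ne_zero_iff.mpr fun j hj =>
        sub_ne_zero.mpr (hr.ne (Finset.ne_of_mem_erase hj).symm)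
    have hu6 : -u ^ 6 = Δ ^ 2 := by
      refine mul_left_cancel₀ ha (mul_right_cancel₀ hprod ?_)
      linear_combination hev
    have hu2 : u ^ 2 = 1 := by
      rw [hΔdef] at hΔ1
      rw [hu]
      linear_combination p₁ * hii - hΔ1
    rw [hΔ1, show u ^ 6 = (u ^ 2) ^ 3 by ring, hu2] at hu6
    norm_num at hu6
  · by_contra! h0
    apply hΔ
    rw [hΔdef, h0.1, h0.2.2]
    ring

/-- A field of genus 2 with an elliptic subfield of index 2 has an involution of the roots. -/
lemma hasInvolution {a : ℂ} (ha : a ≠ 0) {r : Fin 6 → ℂ} (hr : Function.Injective r)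
    (h : IsDoubleCover (linProd a r) x y) (hell : HasEllipticSubcover 2 K) : HasInvolution r := by
  have hf := squarefree_linProd ha hr
  have hd : (linProd a r).natDegree = 6 := natDegree_linProd ha r
  obtain ⟨E, hE, h2, -⟩ := hell
  obtain ⟨τ, hne, hinv, hfix⟩ := exists_algEquiv_of_finrank_eq_two E h2
  refine h.hasInvolution_of_algEquiv ha hr hinv fun hx => ?_
  exact h.not_isElliptic_of_fixed hf (by lia) hne hfix hx hE

end IsDoubleCover

/-! ### From involutions of the roots to elliptic subcovers -/

/-- One index is chosen from each orbit: 0, then `j` outside its orbit, then `k` outside both. -/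
lemma exists_representatives {σ : Fin 6 → Fin 6} (hσ : ∀ i, σ (σ i) = i) (hne : ∀ i, σ i ≠ i) :
    ∃ i j k : Fin 6, Function.Bijective ![i, σ i, j, σ j, k, σ k] := by
  have h2 : ∀ a b : Fin 6, ∃ j, j ≠ a ∧ j ≠ b := by decide
  have h4 : ∀ a b c d : Fin 6, ∃ j, j ≠ a ∧ j ≠ b ∧ j ≠ c ∧ j ≠ d := by decide
  obtain ⟨j, hj0, hj1⟩ := h2 0 (σ 0)
  obtain ⟨k, hk0, hk1, hk2, hk3⟩ := h4 0 (σ 0) j (σ j)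
  have e1 : σ j ≠ 0 := fun h => hj1 (by rw [← h, hσ])
  have e2 : σ j ≠ σ 0 := fun h => hj0 (by rw [← hσ j, h, hσ])
  have e3 : σ k ≠ 0 := fun h => hk1 (by rw [← h, hσ])
  have e4 : σ k ≠ σ 0 := fun h => hk0 (by rw [← hσ k, h, hσ])
  have e5 : σ k ≠ j := fun h => hk3 (by rw [← h, hσ])
  have e6 : σ k ≠ σ j := fun h => hk2 (by rw [← hσ k, h, hσ])
  refine ⟨0, j, k, Finite.injective_iff_bijective.mp ?_⟩
  rw [← List.nodup_ofFn]
  simp [e1.symm, e2.symm, e3.symm, e4.symm, e5.symm, e6.symm, hj0.symm, hj1.symm, hk0.symm,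
    hk1.symm, hk2.symm, hk3.symm, (hne 0).symm, (hne j).symm, (hne k).symm]

/-- Diagonalization of the involution. -/
lemma HasInvolution.exists_diagonalization {r : Fin 6 → ℂ} (hr : Function.Injective r)
    (h : HasInvolution r) : ∃ (σ : Fin 6 → Fin 6) (P Q R S : ℂ), (∀ i, σ (σ i) = i) ∧
      (∀ i, σ i ≠ i) ∧ P * S - Q * R ≠ 0 ∧
      ∀ i, (P * r i + Q) * (R * r (σ i) + S) + (P * r (σ i) + Q) * (R * r i + S) = 0 := by
  obtain ⟨σ, hσ, hne, b, c, d, hbcd, hB⟩ := h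
  -- In the degenerate case the relation times `b` factors as `(b rᵢ + d) (b r_{σ i} + d) = 0`. Each
  -- pair would then contain the single root `-d / b`, which is impossible for two disjoint pairs.
  have hdisc : d ^ 2 + b * c ≠ 0 := by
    intro h0
    have hb : b ≠ 0 := by
      rintro rfl
      have hd : d = 0 := by simpa using h0
      subst hd
      have := hB 0
      simp at this hbcd
      exact hbcd this.symm
    have hi (i : Fin 6) : b * r i + d = 0 ∨ b * r (σ i) + d = 0 :=
      mul_eq_zero.mp (by linear_combination b * hB i + h0)
    have huniq {i j : Fin 6} (h1 : b * r i + d = 0) (h2 : b * r j + d = 0) : i = j :=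
      hr (mul_left_cancel₀ hb (by linear_combination h1 - h2))
    have h2 : ∀ a b : Fin 6, ∃ j, j ≠ a ∧ j ≠ b := by decide
    obtain ⟨j, hj0, hj1⟩ := h2 0 (σ 0)
    rcases hi 0 with e1 | e1 <;> rcases hi j with e2 | e2
    · exact hj0 (huniq e2 e1)
    · exact hj1 (by rw [← huniq e2 e1, hσ])
    · exact hj1 (huniq e2 e1)
    · exact hj0 (by rw [← hσ j, huniq e2 e1, hσ])
  by_cases hb : b = 0
  · subst hb
    have hd : d ≠ 0 := by rintro rfl; simp at hdisc
    refine ⟨σ, 2 * d, -c, 0, 1, hσ, hne, by simpa using hd, fun i => ?_⟩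
    linear_combination 2 * hB i
  · obtain ⟨δ, hδ⟩ := IsAlgClosed.exists_pow_nat_eq (d ^ 2 + b * c) two_pos
    have hδ0 : δ ≠ 0 := by
      rintro rfl
      exact hdisc (by rw [← hδ]; norm_num)
    -- The fixed points `(-d ± δ) / b` are sent to 0 and ∞, so the involution becomes `z ↦ -z`. For
    -- `b = 0` above, ∞ is already a fixed point and the other one, `c / (2 d)`, is sent to 0.
    refine ⟨σ, b, d - δ, b, d + δ, hσ, hne, ?_, fun i => ?_⟩
    · rw [show b * (d + δ) - (d - δ) * b = 2 * (b * δ) by ring]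
      exact mul_ne_zero two_ne_zero (mul_ne_zero hb hδ0)
    · linear_combination 2 * b * hB i - 2 * hδ

namespace IsDoubleCover

variable {K : Type} [Field K] [Algebra ℂ K] {f : ℂ[X]} {x y : K}

lemma linear_ne_zero (h : IsDoubleCover f x y) {P Q : ℂ} (hPQ : P ≠ 0 ∨ Q ≠ 0) :
    algebraMap ℂ K P * x + algebraMap ℂ K Q ≠ 0 := by
  intro h0
  have := h.eq_zero_of_quadratic (u := 0) (v := P) (w := Q) (by simpa using h0)
  tauto

/-- Effect of a linear fractional transformation on the equation of a curve of genus 2. -/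
lemma mobius {a : ℂ} {r : Fin 6 → ℂ} (h : IsDoubleCover (linProd a r) x y) {P Q R S : ℂ}
    (hdet : P * S - Q * R ≠ 0) (hr : ∀ i, R * r i + S ≠ 0) :
    IsDoubleCover (linProd (a * (∏ i, (R * r i + S)) / (P * S - Q * R) ^ 6)
      fun i => (P * r i + Q) / (R * r i + S))
      ((algebraMap ℂ K P * x + algebraMap ℂ K Q) / (algebraMap ℂ K R * x + algebraMap ℂ K S))
      (y / (algebraMap ℂ K R * x + algebraMap ℂ K S) ^ 3) := by
  have hs : algebraMap ℂ K R * x + algebraMap ℂ K S ≠ 0 := h.linear_ne_zero (by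
    by_contra! h0
    simp [h0] at hdet)
  have hdetK : algebraMap ℂ K (P * S - Q * R) ≠ 0 := (_root_.map_ne_zero _).mpr hdet
  set s := algebraMap ℂ K R * x + algebraMap ℂ K S with hsdef
  set z := (algebraMap ℂ K P * x + algebraMap ℂ K Q) / s with hz
  have hzs : z * s = algebraMap ℂ K P * x + algebraMap ℂ K Q := div_mul_cancel₀ _ hs
  have hx : x * (algebraMap ℂ K P - algebraMap ℂ K R * z) =
      algebraMap ℂ K S * z - algebraMap ℂ K Q := by
    linear_combination -hzs + z * hsdef
  have hPR : (algebraMap ℂ K P - algebraMap ℂ K R * z) * s = algebraMap ℂ K (P * S - Q * R) := by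
    simp only [map_sub, map_mul]
    linear_combination -algebraMap ℂ K R * hzs + algebraMap ℂ K P * hsdef
  have hPR0 : algebraMap ℂ K P - algebraMap ℂ K R * z ≠ 0 := by
    intro h0
    rw [h0, zero_mul] at hPR
    exact hdetK hPR.symm
  set A := IntermediateField.adjoin ℂ {z, y / s ^ 3}
  have hzA : z ∈ A := IntermediateField.subset_adjoin ℂ _ (Set.mem_insert _ _)
  have hxA : x ∈ A := by
    rw [eq_div_of_mul_eq hPR0 hx]
    exact div_mem (sub_mem (mul_mem (algebraMap_mem _ _) hzA) (algebraMap_mem _ _))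
      (sub_mem (algebraMap_mem _ _) (mul_mem (algebraMap_mem _ _) hzA))
  refine h.of_mem ?_ hxA ?_
  · have hfac (i : Fin 6) : z - algebraMap ℂ K ((P * r i + Q) / (R * r i + S)) =
        (x - algebraMap ℂ K (r i)) * (algebraMap ℂ K (P * S - Q * R) /
          ((algebraMap ℂ K (R * r i + S)) * s)) := by
      have hρ : algebraMap ℂ K (R * r i + S) ≠ 0 := (_root_.map_ne_zero _).mpr (hr i)
      refine mul_right_cancel₀ (mul_ne_zero hρ hs) ?_
      rw [mul_assoc (x - _), div_mul_cancel₀ _ (mul_ne_zero hρ hs), map_div₀, sub_mul,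
        ← mul_assoc (algebraMap ℂ K (P * r i + Q) / _), div_mul_cancel₀ _ hρ]
      simp only [map_sub, map_mul, map_add]
      linear_combination (algebraMap ℂ K R * algebraMap ℂ K (r i) + algebraMap ℂ K S) * hzs -
        (algebraMap ℂ K P * algebraMap ℂ K (r i) + algebraMap ℂ K Q) * hsdef
    have hprod : ∏ i, (algebraMap ℂ K (R * r i + S)) ≠ 0 :=
      Finset.prod_ne_zero_iff.mpr fun i _ => (_root_.map_ne_zero _).mpr (hr i)
    rw [div_pow, h.sq, aeval_linProd, aeval_linProd, Finset.prod_congr rfl fun i _ => hfac i,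
      Finset.prod_mul_distrib, Finset.prod_div_distrib, Finset.prod_mul_distrib, Finset.prod_const,
      Finset.prod_const, Finset.card_univ, Fintype.card_fin, map_div₀, map_mul, map_prod, map_pow]
    generalize algebraMap ℂ K (P * S - Q * R) = D at hdetK
    field_simp
  · have := mul_mem (IntermediateField.subset_adjoin ℂ {z, y / s ^ 3}
      (Set.mem_insert_of_mem _ rfl))
      (pow_mem (add_mem (mul_mem (algebraMap_mem A R) hxA) (algebraMap_mem A S)) 3)
    rwa [← hsdef, div_mul_cancel₀ _ (pow_ne_zero 3 hs)] at this

/-- The curve `w² = a (z² - e₁) (z² - e₂) (z² - e₃)` is a double cover of an elliptic curve. -/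
lemma hasEllipticSubcover_of_even {a : ℂ} (ha : a ≠ 0) {e : Fin 3 → ℂ} (he : Function.Injective e)
    {z w : K} (h : IsDoubleCover f z w) (hf : Squarefree f) (hd : f.natDegree = 2 * 3)
    (heven : ∀ {L : Type} [Field L] [Algebra ℂ L] (t : L),
      aeval t f = algebraMap ℂ L a * ∏ i, (t ^ 2 - algebraMap ℂ L (e i))) :
    HasEllipticSubcover 2 K := by
  set E := IntermediateField.adjoin ℂ {z ^ 2, w} with hE
  have hz0 : z ≠ 0 := by
    rintro h0
    exact h.transcendental (h0 ▸ isAlgebraic_zero)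
  have hzE : z ^ 2 ∈ E := IntermediateField.subset_adjoin ℂ _ (Set.mem_insert _ _)
  have hwE : w ∈ E := IntermediateField.subset_adjoin ℂ _ (Set.mem_insert_of_mem _ rfl)
  -- Since `f` is even, there is an endomorphism with `z ↦ -z` and `w ↦ w`. It is the identity on
  -- `E` but moves `z`.
  have hz : z ∉ E := by
    obtain ⟨ρ, hρz, hρw⟩ := h.exists_algHom hf (by lia) (x' := -z) (y' := w)
      (fun halg => h.transcendental (by simpa using halg.neg)) (by
        rw [h.sq, heven, heven, neg_sq])
    have hfix (t : K) (ht : t ∈ E) : ρ t = t := by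
      induction ht using IntermediateField.adjoin_induction with
      | mem t ht =>
        rcases ht with rfl | rfl
        · rw [map_pow, hρz, neg_sq]
        · exact hρw
      | algebraMap c => exact ρ.commutes c
      | add a b _ _ ha hb => rw [map_add, ha, hb]
      | inv a _ ha => rw [map_inv₀, ha]
      | mul a b _ _ ha hb => rw [map_mul, ha, hb]
    intro hmem
    have h1 := hfix z hmem
    rw [hρz] at h1
    have h2 : algebraMap ℂ K 2 * z = 0 := by
      rw [map_ofNat]
      linear_combination -h1
    exact (mul_ne_zero (by simp) hz0) h2
  have hell : IsEllipticFunctionField E := by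
    refine isEllipticFunctionField_of_cubic ha he (x := (⟨z ^ 2, hzE⟩ : E)) (y := ⟨w, hwE⟩) ?_
    refine of_adjoin_eq_top (z := (⟨z ^ 2, hzE⟩ : E)) ?_ ?_ ?_
    · intro halg
      exact h.transcendental (IsAlgebraic.of_pow two_pos (IntermediateField.isAlgebraic_iff.mp halg))
    · apply Subtype.ext
      rw [aeval_linProd]
      have := h.sq
      rw [heven] at this
      simpa using this
    · apply IntermediateField.lift_injective
      rw [IntermediateField.lift_adjoin, IntermediateField.lift_top, Set.image_pair]
  have hint : IsIntegral E z := by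
    refine ⟨X ^ 2 - C ⟨z ^ 2, hzE⟩, monic_X_pow_sub_C _ two_ne_zero, ?_⟩
    simp
  have hmin : (minpoly E z).natDegree = 2 := by
    apply le_antisymm
    · have h1 : (X ^ 2 - C (⟨z ^ 2, hzE⟩ : E)).natDegree = 2 := natDegree_X_pow_sub_C
      rw [← h1]
      refine natDegree_le_of_dvd (minpoly.dvd _ _ ?_) (monic_X_pow_sub_C _ two_ne_zero).ne_zero
      simp
    · rw [minpoly.two_le_natDegree_iff hint]
      rintro ⟨t, ht⟩
      exact hz (ht ▸ t.2)
  have htop : IntermediateField.adjoin E {z} = ⊤ := by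
    have hle : IntermediateField.adjoin ℂ {z, w} ≤
        (IntermediateField.adjoin E {z}).restrictScalars ℂ := by
      rw [IntermediateField.adjoin_le_iff]
      rintro _ (rfl | rfl)
      · exact IntermediateField.subset_adjoin E _ rfl
      · exact algebraMap_mem (IntermediateField.adjoin E {z}) (⟨_, hwE⟩ : E)
    rw [h.adjoin_eq] at hle
    rw [eq_top_iff]
    intro t _
    exact hle (IntermediateField.mem_top (x := t))
  have hrank : Module.finrank E K = 2 := by
    rw [← hmin, ← IntermediateField.adjoin.finrank hint, htop, IntermediateField.finrank_top']
  refine ⟨E, hell, hrank, fun E' hle hE' => ?_⟩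
  -- Maximality: the degree is prime, so an intermediate field is `E` or `K`, and `K` has genus 2.
  have hsimple := IntermediateField.isSimpleOrder_of_finrank_prime E K (hrank ▸ Nat.prime_two)
  rcases hsimple.eq_bot_or_eq_top (IntermediateField.extendScalars hle) with h1 | h1
  · refine le_antisymm (fun t ht => ?_) hle
    have : t ∈ IntermediateField.extendScalars hle := ht
    rw [h1, IntermediateField.mem_bot] at this
    obtain ⟨u, rfl⟩ := this
    exact u.2
  · exfalso
    have htop' : E' = ⊤ := by
      rw [eq_top_iff]
      intro t _
      have : t ∈ IntermediateField.extendScalars hle := h1 ▸ IntermediateField.mem_top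
      exact this
    subst htop'
    obtain ⟨W, hW, ⟨φ⟩⟩ := hE'
    exact h.not_isEllipticFunctionField hf hd ⟨W, hW, ⟨φ.trans IntermediateField.topEquiv⟩⟩

/-- In the diagonalizing coordinate the roots satisfy `q (σ i) = -q i`. The factors of each pair
combine to `z² - qᵢ²`, so the sextic is a cubic in `z²` with distinct roots. -/
lemma hasEllipticSubcover {a : ℂ} (ha : a ≠ 0) {r : Fin 6 → ℂ} (hr : Function.Injective r)
    (h : IsDoubleCover (linProd a r) x y) (hinv : HasInvolution r) : HasEllipticSubcover 2 K := by
  obtain ⟨σ, P, Q, R, S, hσ, hne, hdet, hB⟩ := hinv.exists_diagonalization hr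
  -- No root goes to ∞: as a fixed point of `z ↦ -z`, ∞ would force `r (σ i) = r i`.
  have hR (i : Fin 6) : R * r i + S ≠ 0 := by
    intro h0
    have h1 := hB i
    rw [h0, mul_zero, add_zero] at h1
    rcases mul_eq_zero.mp h1 with h1 | h1
    · exact hdet (by linear_combination P * h0 - R * h1)
    · have h2 : R * (r (σ i) - r i) = 0 := by linear_combination h1 - h0
      have hR0 := (mul_eq_zero.mp h2).resolve_right (sub_ne_zero.mpr (hr.ne (hne i)))
      have hS0 : S = 0 := by simpa [hR0] using h0
      simp [hR0, hS0] at hdet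
  have hcov := h.mobius hdet hR
  set b := a * (∏ i, (R * r i + S)) / (P * S - Q * R) ^ 6
  have hb : b ≠ 0 := div_ne_zero (mul_ne_zero ha (Finset.prod_ne_zero_iff.mpr fun i _ => hR i))
    (pow_ne_zero 6 hdet)
  set q : Fin 6 → ℂ := fun i => (P * r i + Q) / (R * r i + S) with hq
  have hqinj : Function.Injective q := by
    intro i j hij
    simp only [hq] at hij
    rw [div_eq_div_iff (hR i) (hR j)] at hij
    exact hr (mul_left_cancel₀ hdet (by linear_combination hij))
  have hqσ (i : Fin 6) : q (σ i) = -q i := by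
    simp only [hq]
    rw [eq_neg_iff_add_eq_zero, div_add_div _ _ (hR _) (hR _), div_eq_zero_iff]
    left
    linear_combination hB i
  obtain ⟨i, j, k, hbij⟩ := exists_representatives hσ hne
  have hsq {u v : Fin 6} (h : q u ^ 2 = q v ^ 2) : u = v ∨ u = σ v := by
    rcases sq_eq_sq_iff_eq_or_eq_neg.mp h with h | h
    · exact Or.inl (hqinj h)
    · exact Or.inr (hqinj (by rw [h, hqσ]))
  refine hcov.hasEllipticSubcover_of_even hb (e := ![q i ^ 2, q j ^ 2, q k ^ 2]) ?_
    (squarefree_linProd hb hqinj) (natDegree_linProd hb _) fun t => ?_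
  · have hn := List.nodup_ofFn.mpr hbij.1
    simp at hn
    intro u v huv
    fin_cases u <;> fin_cases v <;> simp at huv ⊢ <;> have := hsq huv <;> grind
  · rw [aeval_linProd, ← (Equiv.ofBijective _ hbij).prod_comp, Fin.prod_univ_six,
      Fin.prod_univ_three]
    simp [hqσ]
    left
    ring

end IsDoubleCover

/-! ### Polynomial identities by Kronecker substitution -/

/-- Polynomial expressions with integer coefficients. -/
inductive PolyExpr
  | var (i : ℕ)
  | num (n : ℤ)
  | add (p q : PolyExpr)
  | sub (p q : PolyExpr)
  | mul (p q : PolyExpr)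
  | pow (p : PolyExpr) (n : ℕ)

namespace PolyExpr

instance : Add PolyExpr := ⟨add⟩
instance : Sub PolyExpr := ⟨sub⟩
instance : Mul PolyExpr := ⟨mul⟩
instance : HPow PolyExpr ℕ PolyExpr := ⟨pow⟩

/-- The value of a polynomial expression in a commutative ring. -/
def eval {R : Type} [CommRing R] (v : List R) : PolyExpr → R
  | var i => v.getD i 0
  | num n => n
  | add p q => p.eval v + q.eval v
  | sub p q => p.eval v - q.eval v
  | mul p q => p.eval v * q.eval v
  | pow p n => p.eval v ^ n

/-- The value of a polynomial expression at integers. -/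
def evalInt (v : List ℤ) : PolyExpr → ℤ
  | var i => v.getD i 0
  | num n => n
  | add p q => Int.add (p.evalInt v) (q.evalInt v)
  | sub p q => Int.sub (p.evalInt v) (q.evalInt v)
  | mul p q => Int.mul (p.evalInt v) (q.evalInt v)
  | pow p n => Int.pow (p.evalInt v) n

/-- An upper bound for the sum of the absolute values of the coefficients. -/
def bound (v : List ℕ) : PolyExpr → ℕ
  | var i => v.getD i 0
  | num n => n.natAbs
  | add p q => Nat.add (p.bound v) (q.bound v)
  | sub p q => Nat.add (p.bound v) (q.bound v)
  | mul p q => Nat.mul (p.bound v) (q.bound v)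
  | pow p n => Nat.pow (p.bound v) n

variable {R : Type} [CommRing R] (v : List R) (p q : PolyExpr)

lemma eval_add : (p + q).eval v = p.eval v + q.eval v := rfl
lemma eval_sub : (p - q).eval v = p.eval v - q.eval v := rfl
lemma eval_mul : (p * q).eval v = p.eval v * q.eval v := rfl
lemma eval_pow (n : ℕ) : (p ^ n).eval v = p.eval v ^ n := rfl
lemma eval_num (n : ℤ) : (num n).eval v = n := rfl
lemma eval_var (i : ℕ) : (var i).eval v = v.getD i 0 := rfl

lemma evalInt_eq (v : List ℤ) : p.evalInt v = p.eval v := by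
  induction p with
  | var i => rfl
  | num n => simp [evalInt, eval]
  | add p q hp hq => rw [evalInt, eval, hp, hq]; rfl
  | sub p q hp hq => rw [evalInt, eval, hp, hq]; rfl
  | mul p q hp hq => rw [evalInt, eval, hp, hq]; rfl
  | pow p n hp => rw [evalInt, eval, hp]; rfl

lemma map_eval {S : Type} [CommRing S] (f : R →+* S) : f (p.eval v) = p.eval (v.map f) := by
  induction p with
  | var i =>
    simp only [eval, List.getD_eq_getElem?_getD, List.getElem?_map]
    cases v[i]? <;> simp
  | num n => simp [eval]
  | add p q hp hq => simp [eval, hp, hq]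
  | sub p q hp hq => simp [eval, hp, hq]
  | mul p q hp hq => simp [eval, hp, hq]
  | pow p n hp => simp [eval, hp]

end PolyExpr

/-- A size function on a ring, like the sum of the absolute values of the coefficients on a
polynomial ring over `ℤ`, for which nonzero multiples of `N` have size at least `N`. -/
structure SizeFunction (A : Type) [CommRing A] where
  size : A → ℕ
  size_int : ∀ n : ℤ, size n ≤ n.natAbs
  size_add : ∀ a b, size (a + b) ≤ size a + size b
  size_neg : ∀ a, size (-a) ≤ size a
  size_mul : ∀ a b, size (a * b) ≤ size a * size b
  eq_zero : ∀ (N : ℕ) (a : A), size (N * a) < N → N * a = 0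

namespace SizeFunction

variable {A : Type} [CommRing A] (l : SizeFunction A)

/-- The absolute value on `ℤ`. -/
def int : SizeFunction ℤ where
  size := Int.natAbs
  size_int n := le_rfl
  size_add := Int.natAbs_add_le
  size_neg a := by simp
  size_mul a b := (Int.natAbs_mul a b).le
  eq_zero N a h := by
    rw [Int.natAbs_mul, Int.natAbs_natCast] at h
    have : a.natAbs = 0 := by
      by_contra h0
      exact absurd h (not_lt.mpr (Nat.le_mul_of_pos_right N (Nat.pos_of_ne_zero h0)))
    rw [Int.natAbs_eq_zero.mp this, mul_zero]

lemma size_zero : l.size 0 = 0 := by simpa using l.size_int 0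

lemma size_sub (a b : A) : l.size (a - b) ≤ l.size a + l.size b := by
  rw [sub_eq_add_neg]
  exact (l.size_add _ _).trans (by gcongr; exact l.size_neg b)

/-- The sum of the sizes of the coefficients. -/
def polySize (p : A[X]) : ℕ := ∑ i ∈ p.support, l.size (p.coeff i)

lemma polySize_eq {p : A[X]} {s : Finset ℕ} (h : p.support ⊆ s) :
    l.polySize p = ∑ i ∈ s, l.size (p.coeff i) :=
  Finset.sum_subset h fun i _ hi => by rw [notMem_support_iff.mp hi, l.size_zero]

lemma polySize_add (p q : A[X]) : l.polySize (p + q) ≤ l.polySize p + l.polySize q := by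
  rw [l.polySize_eq support_add, l.polySize_eq (s := p.support ∪ q.support)
    Finset.subset_union_left, l.polySize_eq (s := p.support ∪ q.support) Finset.subset_union_right,
    ← Finset.sum_add_distrib]
  exact Finset.sum_le_sum fun i _ => by rw [coeff_add]; exact l.size_add _ _

lemma polySize_sum {ι : Type} (s : Finset ι) (f : ι → A[X]) :
    l.polySize (∑ i ∈ s, f i) ≤ ∑ i ∈ s, l.polySize (f i) := by
  classical
  induction s using Finset.induction_on with
  | empty => simp [polySize]
  | insert a s ha ih =>
    rw [Finset.sum_insert ha, Finset.sum_insert ha]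
    exact (l.polySize_add _ _).trans (by gcongr)

lemma polySize_monomial (n : ℕ) (a : A) : l.polySize (monomial n a) = l.size a := by
  rw [l.polySize_eq (support_monomial_subset n a)]
  simp

lemma size_coeff_le (p : A[X]) (n : ℕ) : l.size (p.coeff n) ≤ l.polySize p := by
  by_cases h : n ∈ p.support
  · exact Finset.single_le_sum (f := fun i => l.size (p.coeff i)) (fun _ _ => Nat.zero_le _) h
  · rw [notMem_support_iff.mp h, l.size_zero]
    exact Nat.zero_le _

/-- The size function on the polynomial ring. -/
def poly : SizeFunction A[X] where
  size := l.polySize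
  size_int n := by
    rw [← C_eq_intCast, ← monomial_zero_left, l.polySize_monomial]
    exact l.size_int n
  size_add := l.polySize_add
  size_neg p := by
    rw [polySize, support_neg]
    exact Finset.sum_le_sum fun i _ => by rw [coeff_neg]; exact l.size_neg _
  size_mul p q := by
    have h : l.polySize p * l.polySize q =
        ∑ i ∈ p.support, ∑ j ∈ q.support, l.size (p.coeff i) * l.size (q.coeff j) :=
      Finset.sum_mul_sum ..
    rw [h, mul_eq_sum_sum]
    refine (l.polySize_sum _ _).trans (Finset.sum_le_sum fun i _ => ?_)
    rw [Polynomial.sum]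
    refine (l.polySize_sum _ _).trans (Finset.sum_le_sum fun j _ => ?_)
    rw [l.polySize_monomial]
    exact l.size_mul _ _
  eq_zero N p h := by
    ext n
    rw [← C_eq_natCast, coeff_C_mul, coeff_zero]
    refine l.eq_zero N _ (lt_of_le_of_lt ?_ h)
    rw [← coeff_C_mul, C_eq_natCast]
    exact l.size_coeff_le _ n

lemma polySize_mul_X (p : A[X]) : l.polySize (p * X) = l.polySize p := by
  have hs (q : A[X]) : q.support ⊆ Finset.range (q.natDegree + 1) := fun i hi =>
    Finset.mem_range_succ_iff.mpr (le_natDegree_of_mem_supp i hi)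
  rw [l.polySize_eq (hs p), l.polySize_eq (s := Finset.range (p.natDegree + 1 + 1))
    ((hs _).trans (Finset.range_mono (by gcongr; exact natDegree_mul_le.trans (by gcongr; exact natDegree_X_le)))),
    Finset.sum_range_succ']
  simp [l.size_zero]

/-- A polynomial of small size that vanishes at a large integer is zero. -/
lemma eq_zero_of_eval_eq_zero [IsDomain A] [CharZero A] {N : ℕ} (p : A[X])
    (h : p.eval (N : A) = 0) (hN : l.polySize p < N) : p = 0 := by
  induction hd : p.natDegree using Nat.strong_induction_on generalizing p with
  | _ d ih =>
    have hN0 : (N : A) ≠ 0 := by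
      rw [Nat.cast_ne_zero]
      lia
    have hp := divX_mul_X_add p
    -- From `p(N) = 0` the constant coefficient is a multiple of `N`, and its size is below `N`, so
    -- it is zero. The induction continues with `p / X`, which has the same size.
    have h0 : p.coeff 0 = 0 := by
      have h1 : p.coeff 0 = N * -(p.divX.eval (N : A)) := by
        have := congrArg (Polynomial.eval (N : A)) hp
        rw [h] at this
        simp at this
        linear_combination this
      rw [h1]
      refine l.eq_zero N _ (lt_of_le_of_lt ?_ hN)
      rw [← h1]
      exact l.size_coeff_le p 0
    rw [h0, C_0, add_zero] at hp
    by_cases hpd : p.natDegree = 0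
    · rw [eq_C_of_natDegree_eq_zero hpd, h0, C_0]
    · have : p.divX = 0 := by
        refine ih p.divX.natDegree ?_ _ ?_ ?_ rfl
        · rw [natDegree_divX_eq_natDegree_tsub_one]
          lia
        · rw [← hp, eval_mul, eval_X] at h
          exact (mul_eq_zero.mp h).resolve_right hN0
        · rwa [← l.polySize_mul_X, hp]
      rw [← hp, this, zero_mul]

/-- `bound` evaluates the expression with every number replaced by its absolute value and every
minus by a plus, so no cancellation is credited. -/
lemma size_eval_le {v : List A} {b : List ℕ} (h : List.Forall₂ (fun a n => l.size a ≤ n) v b)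
    (p : PolyExpr) : l.size (p.eval v) ≤ p.bound b := by
  induction p with
  | var i =>
    simp only [PolyExpr.eval, PolyExpr.bound]
    induction h generalizing i with
    | nil => simp [l.size_zero]
    | cons h _ ih =>
      cases i with
      | zero => simpa using h
      | succ i => simpa using ih i
  | num n => exact l.size_int n
  | add p q hp hq => exact (l.size_add _ _).trans (Nat.add_le_add hp hq)
  | sub p q hp hq => exact (l.size_sub _ _).trans (Nat.add_le_add hp hq)
  | mul p q hp hq => exact (l.size_mul _ _).trans (Nat.mul_le_mul hp hq)
  | pow p n hp =>
    simp only [PolyExpr.eval, PolyExpr.bound]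
    refine le_trans ?_ (Nat.pow_le_pow_left hp n)
    induction n with
    | zero => simpa using l.size_int 1
    | succ n ih =>
      rw [pow_succ, pow_succ]
      exact (l.size_mul _ _).trans (Nat.mul_le_mul ih le_rfl)

end SizeFunction

namespace PolyExpr

/-- The integers in the list grow fast enough for the values at them to determine the polynomial;
the list starts with the integer for the last variable, and is preceded by `j` free variables. -/
def Separates (p : PolyExpr) : List ℕ → ℕ → Bool
  | [], _ => true
  | N :: L, j => Nat.blt (p.bound (L.reverse ++ List.replicate (j + 1) 1)) N && p.Separates L (j + 1)

/-- Induction over the integers, turning one of them back into a variable at each step. The ring `A`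
plays the part of `ℤ[xs]`: the second hypothesis is its universal property with respect to `R`. The
head `N` of the list stands just before `xs`; the ring grows to `A[X]`, where `p` with `X` for `N`
vanishes because its value at `N` does and its size is below `N`. -/
lemma eval_eq_zero_of_separates {R : Type} [CommRing R] (p : PolyExpr) (L : List ℕ) :
    ∀ {A : Type} [CommRing A] [IsDomain A] [CharZero A] (l : SizeFunction A) (xs : List A),
      (∀ x ∈ xs, l.size x ≤ 1) →
      (∀ w : List R, w.length = xs.length → ∃ f : A →+* R, xs.map f = w) →
      p.Separates L xs.length = true → p.eval (L.reverse.map (Nat.cast : ℕ → A) ++ xs) = 0 →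
      ∀ w : List R, w.length = L.length + xs.length → p.eval w = 0 := by
  induction L with
  | nil =>
    intro A _ _ _ l xs _ hU _ h0 w hw
    obtain ⟨f, rfl⟩ := hU w (by simpa using hw)
    rw [← map_eval]
    simpa using congrArg f h0
  | cons N L ih =>
    intro A _ _ _ l xs hxs hU hsep h0 w hw
    rw [Separates, Bool.and_eq_true, Nat.blt_eq] at hsep
    refine ih l.poly (X :: xs.map C) ?_ ?_ (by simpa using hsep.2) ?_ w (by simp at hw ⊢; lia)
    · intro x hx
      rw [List.mem_cons, List.mem_map] at hx
      rcases hx with rfl | ⟨a, ha, rfl⟩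
      · change l.polySize X ≤ 1
        rw [← monomial_one_one_eq_X, l.polySize_monomial]
        simpa using l.size_int 1
      · change l.polySize (C a) ≤ 1
        rw [← monomial_zero_left, l.polySize_monomial]
        exact hxs a ha
    · rintro (_ | ⟨w₀, w⟩) hw
      · simp at hw
      · obtain ⟨f, hf⟩ := hU w (by simpa using hw)
        -- The universal property passes from `A` to `A[X]` by sending the new variable to `w₀`.
        refine ⟨eval₂RingHom f w₀, ?_⟩
        rw [List.map_cons, List.map_map]
        congr 1
        · simp
        · rw [← hf]
          refine List.map_congr_left fun a _ => ?_
          simp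
    · refine l.eq_zero_of_eval_eq_zero (N := N) _ ?_ (lt_of_le_of_lt ?_ hsep.1)
      · have := map_eval (L.reverse.map (Nat.cast : ℕ → A[X]) ++ (X :: xs.map C)) p
          (evalRingHom (N : A))
        rw [coe_evalRingHom] at this
        rw [this, ← h0]
        congr 1
        simp [Function.comp_def]
      · refine l.poly.size_eval_le ?_ p
        refine List.rel_append ?_ ?_
        · rw [List.forall₂_map_left_iff, List.forall₂_same]
          intro n _
          simpa using l.poly.size_int n
        · rw [List.replicate_succ]
          refine List.Forall₂.cons ?_ ?_
          · change l.polySize X ≤ 1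
            rw [← monomial_one_one_eq_X, l.polySize_monomial]
            simpa using l.size_int 1
          · rw [List.forall₂_map_left_iff, List.forall₂_iff_get]
            refine ⟨by simp, fun i h1 h2 => ?_⟩
            change l.polySize (C _) ≤ _
            rw [← monomial_zero_left, l.polySize_monomial]
            simpa using hxs _ (List.get_mem xs ⟨i, by simpa using h1⟩)

/-- A polynomial identity holds in every commutative ring if it holds at integers that grow fast
enough. -/
theorem eval_eq_zero {R : Type} [CommRing R] (p : PolyExpr) (L : List ℕ)
    (hsep : p.Separates L 0 = true) (h : p.evalInt (L.reverse.map Int.ofNat) = 0) (w : List R)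
    (hw : w.length = L.length) : p.eval w = 0 := by
  refine p.eval_eq_zero_of_separates L SizeFunction.int [] (by simp) (fun w hw => ?_) hsep ?_ w hw
  · exact ⟨Int.castRingHom R, (List.length_eq_zero_iff.mp (by simpa using hw)).symm⟩
  · rw [List.append_nil, ← evalInt_eq]
    exact h

end PolyExpr

/-! ### The Igusa invariants and the fifteen determinants -/

namespace PolyExpr

/-- The sum of three products of two entries of a table. -/
def pairSum (D : Fin 6 → Fin 6 → PolyExpr) (i j k l : Fin 6) : PolyExpr :=
  D i j * D k l + D i k * D j l + D i l * D j k

/-- The product of the entries of a table along a triangle. -/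
def triangle (D : Fin 6 → Fin 6 → PolyExpr) (i j k : Fin 6) : PolyExpr :=
  D i j * D j k * D k i

/-- The sum over the bijections `{i, j, k} → {l, m, n}` of products of entries of a table. -/
def matchSum (D : Fin 6 → Fin 6 → PolyExpr) (i j k l m n : Fin 6) : PolyExpr :=
  D i l * D j m * D k n + D i l * D j n * D k m + D i m * D j l * D k n +
  D i m * D j n * D k l + D i n * D j l * D k m + D i n * D j m * D k l

/-- The sum over the splittings of the six indices into two triples. -/
def sumSplit (t : Fin 6 → Fin 6 → Fin 6 → Fin 6 → Fin 6 → Fin 6 → PolyExpr) : PolyExpr :=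
  t 0 1 2 3 4 5 + t 0 1 3 2 4 5 + t 0 1 4 2 3 5 + t 0 1 5 2 3 4 + t 0 2 3 1 4 5 +
  t 0 2 4 1 3 5 + t 0 2 5 1 3 4 + t 0 3 4 1 2 5 + t 0 3 5 1 2 4 + t 0 4 5 1 2 3

/-- The Igusa invariant `i₂` in terms of the squared differences of the roots. -/
def i2 (D : Fin 6 → Fin 6 → PolyExpr) : PolyExpr :=
  D 0 1 * pairSum D 2 3 4 5 + D 0 2 * pairSum D 1 3 4 5 + D 0 3 * pairSum D 1 2 4 5 +
    D 0 4 * pairSum D 1 2 3 5 + D 0 5 * pairSum D 1 2 3 4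

/-- The Igusa invariant `i₄` in terms of the squared differences of the roots. -/
def i4 (D : Fin 6 → Fin 6 → PolyExpr) : PolyExpr :=
  sumSplit fun i j k l m n => triangle D i j k * triangle D l m n

/-- The Igusa invariant `i₆` in terms of the squared differences of the roots. -/
def i6 (D : Fin 6 → Fin 6 → PolyExpr) : PolyExpr :=
  sumSplit fun i j k l m n => triangle D i j k * triangle D l m n * matchSum D i j k l m n

/-- The Igusa invariant `i₁₀` in terms of the squared differences of the roots. -/
def i10 (D : Fin 6 → Fin 6 → PolyExpr) : PolyExpr :=
  D 0 1 * D 0 2 * D 0 3 * D 0 4 * D 0 5 * D 1 2 * D 1 3 * D 1 4 * D 1 5 * D 2 3 * D 2 4 * D 2 5 *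
    D 3 4 * D 3 5 * D 4 5

/-- The invariant `χ₃₀` in terms of the Igusa invariants. -/
def chi30 (i2 i4 i6 i10 : PolyExpr) : PolyExpr :=
  num (-19245600) * i10 ^ 2 * i4 * i2 ^ 3 + num 507384000 * i10 ^ 2 * i4 ^ 2 * i2
  + num 77436 * i10 * i4 ^ 3 * i2 ^ 4 - num 81 * i2 ^ 3 * i6 ^ 4 - i2 ^ 7 * i4 ^ 4
  + num 384 * i4 ^ 6 * i6 - num 78 * i2 ^ 5 * i4 ^ 5 + num 31104 * i6 ^ 5
  - num 3499200 * i10 * i2 * i6 ^ 3 + num 104976000 * i10 ^ 2 * i2 ^ 2 * i6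
  + num 972 * i10 * i2 ^ 6 * i4 ^ 2 + num 8748 * i10 * i2 ^ 4 * i6 ^ 2
  + num 1332 * i2 ^ 4 * i4 ^ 4 * i6 - num 8910 * i2 ^ 3 * i4 ^ 3 * i6 ^ 2
  - num 1728 * i4 ^ 5 * i2 ^ 2 * i6 + num 6048 * i4 ^ 4 * i2 * i6 ^ 2
  + num 29376 * i2 ^ 2 * i4 ^ 2 * i6 ^ 3 - num 47952 * i2 * i4 * i6 ^ 4
  + num 41472 * i10 * i4 ^ 5 - num 236196 * i10 ^ 2 * i2 ^ 5 + num 159 * i4 ^ 6 * i2 ^ 3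
  - num 80 * i4 ^ 7 * i2 - num 125971200000 * i10 ^ 3 - num 592272 * i10 * i4 ^ 4 * i2 ^ 2
  - num 870912 * i10 * i2 ^ 3 * i4 ^ 2 * i6 + num 3090960 * i10 * i2 ^ 2 * i4 * i6 ^ 2
  - num 5832 * i10 * i2 ^ 5 * i4 * i6 + num 4743360 * i10 * i4 ^ 3 * i2 * i6
  - num 6912 * i4 ^ 3 * i6 ^ 3 + num 12 * i2 ^ 6 * i4 ^ 3 * i6
  - num 54 * i2 ^ 5 * i4 ^ 2 * i6 ^ 2 + num 108 * i2 ^ 4 * i4 * i6 ^ 3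
  - num 2099520000 * i10 ^ 2 * i4 * i6 - num 9331200 * i10 * i4 ^ 2 * i6 ^ 2

/-- The product over the fifteen splittings of the six indices into three pairs. -/
def prodPairs (t : Fin 6 → Fin 6 → Fin 6 → Fin 6 → Fin 6 → Fin 6 → PolyExpr) : PolyExpr :=
  t 0 1 2 3 4 5 * t 0 1 2 4 3 5 * t 0 1 2 5 3 4 * t 0 2 1 3 4 5 * t 0 2 1 4 3 5 *
  t 0 2 1 5 3 4 * t 0 3 1 2 4 5 * t 0 3 1 4 2 5 * t 0 3 1 5 2 4 * t 0 4 1 2 3 5 *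
  t 0 4 1 3 2 5 * t 0 4 1 5 2 3 * t 0 5 1 2 3 4 * t 0 5 1 3 2 4 * t 0 5 1 4 2 3

/-- The determinant of the matrix with the rows `(1, aᵢ + aⱼ, aᵢ aⱼ)`, in terms of the
differences of the `a`. -/
def pairDet (e : Fin 6 → Fin 6 → PolyExpr) (i j k l m n : Fin 6) : PolyExpr :=
  e i l * e k n * e m j + e j k * e l m * e n i

/-- The table of the differences of `a, b, c, 0, 1, ∞`. -/
def normalDiff (i j : Fin 6) : PolyExpr :=
  ![![num 0, var 0 - var 1, var 0 - var 2, var 0, var 0 - num 1, num 1],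
    ![var 1 - var 0, num 0, var 1 - var 2, var 1, var 1 - num 1, num 1],
    ![var 2 - var 0, var 2 - var 1, num 0, var 2, var 2 - num 1, num 1],
    ![num 0 - var 0, num 0 - var 1, num 0 - var 2, num 0, num (-1), num 1],
    ![num 1 - var 0, num 1 - var 1, num 1 - var 2, num 1, num 0, num 1],
    ![num (-1), num (-1), num (-1), num (-1), num (-1), num 0]] i j

/-- The difference of `χ₃₀` and a multiple of the square of the product of the determinants. -/
def chiIdentity (e : Fin 6 → Fin 6 → PolyExpr) : PolyExpr :=
  chi30 (i2 fun i j => e i j ^ 2) (i4 fun i j => e i j ^ 2) (i6 fun i j => e i j ^ 2)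
    (i10 fun i j => e i j ^ 2) + num 40310784 * prodPairs (pairDet e) ^ 2

/-- The expression is evaluated at `a = 2 ^ 90`, `b = 2 ^ 2762`, `c = 2 ^ 84900`. Each integer
exceeds the bound obtained with the preceding ones inserted and 1 for the remaining variables. The
factor is `40310784 = 2¹¹ 3⁹`. -/
lemma eval_chiIdentity_normalDiff {R : Type} [CommRing R] (a b c : R) :
    (chiIdentity normalDiff).eval [a, b, c] = 0 :=
  eval_eq_zero _ [2 ^ 84900, 2 ^ 2762, 2 ^ 90] (by decide +kernel) (by decide +kernel) _ rfl

end PolyExpr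

/-- The roots are, up to scaling, the images of `a, b, c, 0, 1, ∞` under a Möbius map. -/
lemma exists_sub_eq_normalDiff {r : Fin 6 → ℂ} (hr : Function.Injective r) :
    ∃ (a b c : ℂ) (s : Fin 6 → ℂ), (∀ i, s i ≠ 0) ∧
      ∀ i j, r i - r j = s i * s j * (PolyExpr.normalDiff i j).eval [a, b, c] := by
  have h (i j : Fin 6) (hij : i ≠ j) : r i - r j ≠ 0 := sub_ne_zero.mpr (hr.ne hij)
  have h43 := h 4 3 (by decide)
  have h45 := h 4 5 (by decide)
  have h35 := h 3 5 (by decide)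
  -- The map `φ` sends `r₃, r₄, r₅` to `0, 1, ∞`. Its differences are `φᵢ - φⱼ = δ² (rᵢ - rⱼ) / ((rᵢ
  -- - r₅) (rⱼ - r₅))`. The root `δ` is taken so that the factor `δ²` splits between `i` and `j`,
  -- and `s₅ = δ` then fits the entries 1 for ∞.
  obtain ⟨δ, hδ⟩ := IsAlgClosed.exists_pow_nat_eq
    ((r 4 - r 5) * (r 3 - r 5) / (r 4 - r 3)) two_pos
  have hδ0 : δ ≠ 0 := by
    rintro rfl
    rw [zero_pow two_ne_zero] at hδ
    exact div_ne_zero (mul_ne_zero h45 h35) h43 hδ.symm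
  set φ : Fin 6 → ℂ := fun i => (r 4 - r 5) * (r i - r 3) / ((r 4 - r 3) * (r i - r 5)) with hφ
  have h3 : φ 3 = 0 := by simp [hφ]
  have h4 : φ 4 = 1 := by simp only [hφ]; field_simp
  have key (i j : Fin 6) (hi : i ≠ 5) (hj : j ≠ 5) :
      r i - r j = (r i - r 5) / δ * ((r j - r 5) / δ) * (φ i - φ j) := by
    have hi := h i 5 hi
    have hj := h j 5 hj
    have : (r i - r 5) / δ * ((r j - r 5) / δ) * (φ i - φ j) =
        (r i - r 5) * (r j - r 5) * (φ i - φ j) / δ ^ 2 := by ring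
    rw [this, hδ]
    simp only [hφ]
    field_simp
    ring
  refine ⟨φ 0, φ 1, φ 2, fun i => if i = 5 then δ else (r i - r 5) / δ, fun i => ?_, fun i j => ?_⟩
  · by_cases hi : i = 5
    · simp [hi, hδ0]
    · simp [hi, hδ0, h i 5 hi]
  · by_cases hi : i = 5 <;> by_cases hj : j = 5
    · subst hi hj
      simp [PolyExpr.normalDiff, PolyExpr.eval_num]
    · subst hi
      have : (PolyExpr.normalDiff 5 j).eval [φ 0, φ 1, φ 2] = -1 := by
        fin_cases j <;> simp [PolyExpr.normalDiff, PolyExpr.eval_num] at hj ⊢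
      simp only [this, if_true, if_neg hj]
      field_simp
      ring
    · subst hj
      have : (PolyExpr.normalDiff i 5).eval [φ 0, φ 1, φ 2] = 1 := by
        fin_cases i <;> simp [PolyExpr.normalDiff, PolyExpr.eval_num] at hi ⊢
      simp only [this, if_true, if_neg hi]
      field_simp
    · rw [key i j hi hj]
      simp only [if_neg hi, if_neg hj]
      congr 1
      fin_cases i <;> fin_cases j <;> first
        | exact absurd rfl hi
        | exact absurd rfl hj
        | simp [PolyExpr.normalDiff, PolyExpr.eval_num, PolyExpr.eval_sub, PolyExpr.eval_var,
            h3, h4]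

/-- The determinant of the matrix with the rows `(1, aᵢ + aⱼ, aᵢ aⱼ)`, which vanishes if an
involution of the projective line exchanges the members of each of three pairs. -/
def pairDet (a : Fin 6 → ℂ) (i j k l m n : Fin 6) : ℂ :=
  (a i - a l) * (a k - a n) * (a m - a j) + (a j - a k) * (a l - a m) * (a n - a i)

/-- The product over the fifteen splittings of the six indices into three pairs. -/
def prodPairs (t : Fin 6 → Fin 6 → Fin 6 → Fin 6 → Fin 6 → Fin 6 → ℂ) : ℂ :=
  t 0 1 2 3 4 5 * t 0 1 2 4 3 5 * t 0 1 2 5 3 4 * t 0 2 1 3 4 5 * t 0 2 1 4 3 5 *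
  t 0 2 1 5 3 4 * t 0 3 1 2 4 5 * t 0 3 1 4 2 5 * t 0 3 1 5 2 4 * t 0 4 1 2 3 5 *
  t 0 4 1 3 2 5 * t 0 4 1 5 2 3 * t 0 5 1 2 3 4 * t 0 5 1 3 2 4 * t 0 5 1 4 2 3

namespace Sextic

variable (S : Sextic) {e : Fin 6 → Fin 6 → PolyExpr} {v : List ℂ} {s : Fin 6 → ℂ}

/-- In every term of an invariant each root occurs in the same number of squared differences: 1, 2,
3, 5 for `i₂, i₄, i₆, i₁₀`. Hence the scale factors come out as a power of `∏ sᵢ`. -/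
lemma i2_eq (h : ∀ i j, S.root i - S.root j = s i * s j * (e i j).eval v) :
    S.i2 = S.lead ^ 2 * (∏ i, s i) ^ 2 * (PolyExpr.i2 fun i j => e i j ^ 2).eval v := by
  simp only [i2, pairSum, sqDiff, h, PolyExpr.i2, PolyExpr.pairSum, PolyExpr.eval_add,
    PolyExpr.eval_mul, PolyExpr.eval_pow, Fin.prod_univ_six]
  ring

lemma i4_eq (h : ∀ i j, S.root i - S.root j = s i * s j * (e i j).eval v) :
    S.i4 = (S.lead ^ 2 * (∏ i, s i) ^ 2) ^ 2 *
      (PolyExpr.i4 fun i j => e i j ^ 2).eval v := by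
  simp only [i4, sumSplit, split4, triangle, sqDiff, h, PolyExpr.i4, PolyExpr.sumSplit,
    PolyExpr.triangle, PolyExpr.eval_add, PolyExpr.eval_mul, PolyExpr.eval_pow, Fin.prod_univ_six]
  ring

lemma matchSum_eq (h : ∀ i j, S.root i - S.root j = s i * s j * (e i j).eval v)
    (i j k l m n : Fin 6) : S.matchSum i j k l m n = (s i * s j * s k * s l * s m * s n) ^ 2 *
      (PolyExpr.matchSum (fun i j => e i j ^ 2) i j k l m n).eval v := by
  simp only [matchSum, sqDiff, h, PolyExpr.matchSum, PolyExpr.eval_add, PolyExpr.eval_mul,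
    PolyExpr.eval_pow]
  ring

lemma i6_eq (h : ∀ i j, S.root i - S.root j = s i * s j * (e i j).eval v) :
    S.i6 = (S.lead ^ 2 * (∏ i, s i) ^ 2) ^ 3 *
      (PolyExpr.i6 fun i j => e i j ^ 2).eval v := by
  simp only [i6, sumSplit, split6, triangle, S.matchSum_eq h, sqDiff, h, PolyExpr.i6,
    PolyExpr.sumSplit, PolyExpr.triangle, PolyExpr.eval_add, PolyExpr.eval_mul, PolyExpr.eval_pow,
    Fin.prod_univ_six]
  ring

lemma i10_eq (h : ∀ i j, S.root i - S.root j = s i * s j * (e i j).eval v) :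
    S.i10 = (S.lead ^ 2 * (∏ i, s i) ^ 2) ^ 5 *
      (PolyExpr.i10 fun i j => e i j ^ 2).eval v := by
  simp only [i10, sqDiff, h, PolyExpr.i10, PolyExpr.eval_mul, PolyExpr.eval_pow,
    Fin.prod_univ_six, Fin.reduceLT, if_true, if_false]
  ring

lemma pairDet_eq (h : ∀ i j, S.root i - S.root j = s i * s j * (e i j).eval v)
    (i j k l m n : Fin 6) : pairDet S.root i j k l m n = s i * s j * s k * s l * s m * s n *
      (PolyExpr.pairDet e i j k l m n).eval v := by
  simp only [pairDet, h, PolyExpr.pairDet, PolyExpr.eval_add, PolyExpr.eval_mul]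
  ring

lemma prodPairs_eq (h : ∀ i j, S.root i - S.root j = s i * s j * (e i j).eval v) :
    prodPairs (pairDet S.root) = (∏ i, s i) ^ 15 *
      (PolyExpr.prodPairs (PolyExpr.pairDet e)).eval v := by
  simp only [prodPairs, S.pairDet_eq h, PolyExpr.prodPairs, PolyExpr.eval_mul, Fin.prod_univ_six]
  ring

/-- Both sides are homogeneous of weight 15 in `a₀² (∏ sᵢ)²`, apart from the differences in normal
position. The identity for the roots `a, b, c, 0, 1, ∞` therefore suffices. -/
theorem chi30_eq (hr : Function.Injective S.root) :
    S.chi30 = -40310784 * S.lead ^ 30 * prodPairs (pairDet S.root) ^ 2 := by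
  obtain ⟨a, b, c, s, -, h⟩ := exists_sub_eq_normalDiff hr
  have key := PolyExpr.eval_chiIdentity_normalDiff a b c
  rw [S.prodPairs_eq h, chi30, S.i2_eq h, S.i4_eq h, S.i6_eq h, S.i10_eq h]
  rw [PolyExpr.chiIdentity, PolyExpr.chi30] at key
  simp only [PolyExpr.eval_add, PolyExpr.eval_sub, PolyExpr.eval_mul, PolyExpr.eval_pow,
    PolyExpr.eval_num] at key
  push_cast at key
  linear_combination (S.lead ^ 2 * (∏ i, s i) ^ 2) ^ 15 * key

end Sextic

/-! ### The criterion for an elliptic subcover of degree 2 -/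

/-- The three conditions on the pairs are linear in `(b, d, -c)`, so a nonzero solution exists when
the determinant of the system vanishes. This determinant is `-pairDet`. -/
lemma hasInvolution_of_pairDet_eq_zero {r : Fin 6 → ℂ} (σ : Fin 6 → Fin 6) (i k m : Fin 6)
    (h : pairDet r i (σ i) k (σ k) m (σ m) = 0) (hσ : ∀ i, σ (σ i) = i) (hσ' : ∀ i, σ i ≠ i)
    (hc : ∀ x, x = i ∨ x = σ i ∨ x = k ∨ x = σ k ∨ x = m ∨ x = σ m) : HasInvolution r := by
  have hdet : (Matrix.of ![![r i * r (σ i), r i + r (σ i), 1], ![r k * r (σ k), r k + r (σ k), 1],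
      ![r m * r (σ m), r m + r (σ m), 1]]).det = 0 := by
    rw [Matrix.det_fin_three]
    simp only [pairDet] at h
    simp
    linear_combination -h
  obtain ⟨v, hv0, hv⟩ := Matrix.exists_mulVec_eq_zero_iff.mpr hdet
  refine ⟨σ, hσ, hσ', v 0, -v 2, v 1, ?_, fun x => ?_⟩
  · by_contra! h0
    refine hv0 (funext fun j => ?_)
    fin_cases j
    · exact h0.1
    · exact h0.2.2
    · exact neg_eq_zero.mp h0.2.1
  · have h0 := congrFun hv 0
    have h1 := congrFun hv 1
    have h2 := congrFun hv 2
    simp [Matrix.mulVec, dotProduct, Fin.sum_univ_three] at h0 h1 h2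
    rcases hc x with rfl | rfl | rfl | rfl | rfl | rfl
    · linear_combination h0
    · rw [hσ]; linear_combination h0
    · linear_combination h1
    · rw [hσ]; linear_combination h1
    · linear_combination h2
    · rw [hσ]; linear_combination h2

lemma pairDet_eq_zero_of_involution {r : Fin 6 → ℂ} {σ : Fin 6 → Fin 6} {b c d : ℂ}
    (h0 : b ≠ 0 ∨ c ≠ 0 ∨ d ≠ 0) (h : ∀ i, b * (r i * r (σ i)) + d * (r i + r (σ i)) = c)
    (i k m : Fin 6) : pairDet r i (σ i) k (σ k) m (σ m) = 0 := by
  have hdet : (Matrix.of ![![r i * r (σ i), r i + r (σ i), 1], ![r k * r (σ k), r k + r (σ k), 1],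
      ![r m * r (σ m), r m + r (σ m), 1]]).det = 0 := by
    refine Matrix.exists_mulVec_eq_zero_iff.mp ⟨![b, d, -c], fun hv => ?_, funext fun j => ?_⟩
    · have h1 := congrFun hv 0
      have h2 := congrFun hv 1
      have h3 := congrFun hv 2
      simp at h1 h2 h3
      tauto
    · have hi := h i
      have hk := h k
      have hm := h m
      fin_cases j <;> simp [Matrix.mulVec, dotProduct, Fin.sum_univ_three]
      · linear_combination hi
      · linear_combination hk
      · linear_combination hm
  rw [Matrix.det_fin_three] at hdet
  simp at hdet
  rw [pairDet]
  linear_combination -hdet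

set_option synthInstance.maxSize 1000 in
/-- The fixed point free involutions of six indices correspond to the splittings into pairs. -/
lemma pairing_cases : ∀ a₀ : Fin 6, a₀ ≠ 0 → ∀ a₁ : Fin 6, a₁ ≠ 1 → (a₀ = 1 ↔ a₁ = 0) → a₀ ≠ a₁ →
    ∀ a₂ : Fin 6, a₂ ≠ 2 → (a₀ = 2 ↔ a₂ = 0) → (a₁ = 2 ↔ a₂ = 1) → a₀ ≠ a₂ → a₁ ≠ a₂ →
    ∀ a₃ : Fin 6, a₃ ≠ 3 → (a₀ = 3 ↔ a₃ = 0) → (a₁ = 3 ↔ a₃ = 1) → (a₂ = 3 ↔ a₃ = 2) →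
      a₀ ≠ a₃ → a₁ ≠ a₃ → a₂ ≠ a₃ →
    ∀ a₄ : Fin 6, a₄ ≠ 4 → (a₀ = 4 ↔ a₄ = 0) → (a₁ = 4 ↔ a₄ = 1) → (a₂ = 4 ↔ a₄ = 2) →
      (a₃ = 4 ↔ a₄ = 3) → a₀ ≠ a₄ → a₁ ≠ a₄ → a₂ ≠ a₄ → a₃ ≠ a₄ →
      (a₀ = 1 ∧ a₂ = 3 ∧ a₄ = 5) ∨ (a₀ = 1 ∧ a₂ = 4 ∧ a₃ = 5) ∨ (a₀ = 1 ∧ a₂ = 5 ∧ a₃ = 4) ∨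
      (a₀ = 2 ∧ a₁ = 3 ∧ a₄ = 5) ∨ (a₀ = 2 ∧ a₁ = 4 ∧ a₃ = 5) ∨ (a₀ = 2 ∧ a₁ = 5 ∧ a₃ = 4) ∨
      (a₀ = 3 ∧ a₁ = 2 ∧ a₄ = 5) ∨ (a₀ = 3 ∧ a₁ = 4 ∧ a₂ = 5) ∨ (a₀ = 3 ∧ a₁ = 5 ∧ a₂ = 4) ∨
      (a₀ = 4 ∧ a₁ = 2 ∧ a₃ = 5) ∨ (a₀ = 4 ∧ a₁ = 3 ∧ a₂ = 5) ∨ (a₀ = 4 ∧ a₁ = 5 ∧ a₂ = 3) ∨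
      (a₀ = 5 ∧ a₁ = 2 ∧ a₃ = 4) ∨ (a₀ = 5 ∧ a₁ = 3 ∧ a₂ = 4) ∨ (a₀ = 5 ∧ a₁ = 4 ∧ a₂ = 3) := by
  decide +kernel

/-- The fifteen factors correspond to the fifteen fixed point free involutions `σ` of the indices;
three values of `σ`, one for each pair, determine it. -/
lemma hasInvolution_iff (r : Fin 6 → ℂ) : HasInvolution r ↔ prodPairs (pairDet r) = 0 := by
  simp only [prodPairs, mul_eq_zero, or_assoc]
  constructor
  · rintro ⟨σ, hσ, hσ', b, c, d, h0, h⟩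
    have key := pairDet_eq_zero_of_involution h0 h
    have hinj (i j : Fin 6) (hij : i ≠ j) : σ i ≠ σ j := fun h => hij (by rw [← hσ i, h, hσ])
    have hiff (i j : Fin 6) : σ i = j ↔ σ j = i :=
      ⟨fun h => by rw [← h, hσ], fun h => by rw [← h, hσ]⟩
    have hz {i j k l m n : Fin 6} (h : σ i = j ∧ σ k = l ∧ σ m = n) :
        pairDet r i j k l m n = 0 := by
      obtain ⟨rfl, rfl, rfl⟩ := h
      exact key i k m
    exact (pairing_cases (σ 0) (hσ' 0) (σ 1) (hσ' 1) (hiff 0 1) (hinj 0 1 (by decide))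
      (σ 2) (hσ' 2) (hiff 0 2) (hiff 1 2) (hinj 0 2 (by decide)) (hinj 1 2 (by decide))
      (σ 3) (hσ' 3) (hiff 0 3) (hiff 1 3) (hiff 2 3) (hinj 0 3 (by decide)) (hinj 1 3 (by decide))
      (hinj 2 3 (by decide)) (σ 4) (hσ' 4) (hiff 0 4) (hiff 1 4) (hiff 2 4) (hiff 3 4)
      (hinj 0 4 (by decide)) (hinj 1 4 (by decide)) (hinj 2 4 (by decide))
      (hinj 3 4 (by decide))).imp
      hz <| .imp hz <| .imp hz <| .imp hz <| .imp hz <| .imp hz <| .imp hz <| .imp hz <| .imp hz <| .imp hz <| .imp hz <| .imp hz <| .imp hz <| .imp hz hz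
  · rintro (h | h | h | h | h | h | h | h | h | h | h | h | h | h | h)
    · exact hasInvolution_of_pairDet_eq_zero ![1, 0, 3, 2, 5, 4] 0 2 4 h
        (by decide) (by decide) (by decide)
    · exact hasInvolution_of_pairDet_eq_zero ![1, 0, 4, 5, 2, 3] 0 2 3 h
        (by decide) (by decide) (by decide)
    · exact hasInvolution_of_pairDet_eq_zero ![1, 0, 5, 4, 3, 2] 0 2 3 h
        (by decide) (by decide) (by decide)
    · exact hasInvolution_of_pairDet_eq_zero ![2, 3, 0, 1, 5, 4] 0 1 4 h
        (by decide) (by decide) (by decide)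
    · exact hasInvolution_of_pairDet_eq_zero ![2, 4, 0, 5, 1, 3] 0 1 3 h
        (by decide) (by decide) (by decide)
    · exact hasInvolution_of_pairDet_eq_zero ![2, 5, 0, 4, 3, 1] 0 1 3 h
        (by decide) (by decide) (by decide)
    · exact hasInvolution_of_pairDet_eq_zero ![3, 2, 1, 0, 5, 4] 0 1 4 h
        (by decide) (by decide) (by decide)
    · exact hasInvolution_of_pairDet_eq_zero ![3, 4, 5, 0, 1, 2] 0 1 2 h
        (by decide) (by decide) (by decide)
    · exact hasInvolution_of_pairDet_eq_zero ![3, 5, 4, 0, 2, 1] 0 1 2 h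
        (by decide) (by decide) (by decide)
    · exact hasInvolution_of_pairDet_eq_zero ![4, 2, 1, 5, 0, 3] 0 1 3 h
        (by decide) (by decide) (by decide)
    · exact hasInvolution_of_pairDet_eq_zero ![4, 3, 5, 1, 0, 2] 0 1 2 h
        (by decide) (by decide) (by decide)
    · exact hasInvolution_of_pairDet_eq_zero ![4, 5, 3, 2, 0, 1] 0 1 2 h
        (by decide) (by decide) (by decide)
    · exact hasInvolution_of_pairDet_eq_zero ![5, 2, 1, 4, 3, 0] 0 1 3 h
        (by decide) (by decide) (by decide)
    · exact hasInvolution_of_pairDet_eq_zero ![5, 3, 4, 1, 2, 0] 0 1 2 h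
        (by decide) (by decide) (by decide)
    · exact hasInvolution_of_pairDet_eq_zero ![5, 4, 3, 2, 1, 0] 0 1 2 h
        (by decide) (by decide) (by decide)

lemma isDoubleCover_root (f : ℂ[X]) [Fact (Irreducible (coverEquation f))] :
    IsDoubleCover f (AdjoinRoot.of (coverEquation f) (algebraMap ℂ[X] (RatFunc ℂ) X))
      (AdjoinRoot.root (coverEquation f)) := by
  have ha (p : ℂ[X]) : aeval (AdjoinRoot.of (coverEquation f) (algebraMap ℂ[X] (RatFunc ℂ) X)) p =
      AdjoinRoot.of (coverEquation f) (algebraMap ℂ[X] (RatFunc ℂ) p) := by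
    induction p using Polynomial.induction_on' with
    | add p q hp hq => simp only [map_add, hp, hq]
    | monomial n c =>
      rw [aeval_monomial, ← C_mul_X_pow_eq_monomial]
      simp only [map_mul, map_pow]
      rfl
  refine ⟨?_, ?_, ?_⟩
  · rintro ⟨p, hp, h⟩
    rw [ha, map_eq_zero, map_eq_zero_iff _ (IsFractionRing.injective ℂ[X] (RatFunc ℂ))] at h
    exact hp h
  · have h : eval₂ (AdjoinRoot.of (coverEquation f)) (AdjoinRoot.root (coverEquation f))
        (X ^ 2 - C (algebraMap ℂ[X] (RatFunc ℂ) f)) = 0 := AdjoinRoot.eval₂_root (coverEquation f)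
    simp only [eval₂_sub, eval₂_pow, eval₂_X, eval₂_C] at h
    rw [ha]
    exact sub_eq_zero.mp h
  · refine eq_top_iff.mpr fun z _ => ?_
    set S := IntermediateField.adjoin ℂ
      {AdjoinRoot.of (coverEquation f) (algebraMap ℂ[X] (RatFunc ℂ) X),
        AdjoinRoot.root (coverEquation f)}
    have hx : AdjoinRoot.of (coverEquation f) (algebraMap ℂ[X] (RatFunc ℂ) X) ∈ S :=
      IntermediateField.subset_adjoin ℂ _ (by simp)
    have hy : AdjoinRoot.root (coverEquation f) ∈ S :=
      IntermediateField.subset_adjoin ℂ _ (by simp)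
    have hp (p : ℂ[X]) : AdjoinRoot.of (coverEquation f) (algebraMap ℂ[X] (RatFunc ℂ) p) ∈ S := by
      rw [← ha]
      rw [aeval_eq_sum_range]
      exact S.sum_mem fun i _ => S.smul_mem (pow_mem hx i)
    have hg (g : RatFunc ℂ) : AdjoinRoot.of (coverEquation f) g ∈ S := by
      rw [← RatFunc.num_div_denom g, map_div₀]
      exact S.div_mem (hp _) (hp _)
    induction z using AdjoinRoot.induction_on with
    | ih p =>
      rw [← AdjoinRoot.aeval_eq, aeval_eq_sum_range]
      refine S.sum_mem fun i _ => ?_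
      rw [Algebra.smul_def]
      exact S.mul_mem (hg _) (pow_mem hy i)

theorem GenusTwoCurve.hasEllipticSubcover_iff (D : GenusTwoCurve) :
    HasEllipticSubcover 2 D.FunctionField ↔ D.chi30 = 0 := by
  have h : IsDoubleCover (linProd D.lead D.root)
      (AdjoinRoot.of D.equation (algebraMap ℂ[X] (RatFunc ℂ) X)) (AdjoinRoot.root D.equation) := by
    -- `D.equation` is `coverEquation D.poly`, and `D.poly` is `linProd D.lead D.root`, by
    -- definition.
    have : Fact (Irreducible (coverEquation D.poly)) := ⟨D.equation_irreducible⟩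
    exact isDoubleCover_root D.poly
  rw [D.chi30_eq D.root_injective]
  have : (-40310784 * D.lead ^ 30 * prodPairs (pairDet D.root) ^ 2 = 0) ↔ HasInvolution D.root := by
    rw [hasInvolution_iff]
    simp [D.lead_ne_zero]
  rw [this]
  exact ⟨fun hell => h.hasInvolution D.lead_ne_zero D.root_injective hell,
    fun hinv => h.hasEllipticSubcover D.lead_ne_zero D.root_injective hinv⟩

/-! ### The invariants in terms of the coefficients -/

namespace PolyExpr

/-- The elementary symmetric polynomials in a list of expressions. -/
def esymm : List PolyExpr → ℕ → PolyExpr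
  | _, 0 => num 1
  | [], _ + 1 => num 0
  | p :: L, k + 1 => esymm L (k + 1) + p * esymm L k

/-- The elementary symmetric polynomials in six variables. -/
def esymm6 (k : ℕ) : PolyExpr := esymm [var 0, var 1, var 2, var 3, var 4, var 5] k

/-- The table of the differences of six variables. -/
def rootDiff (i j : Fin 6) : PolyExpr := var i - var j

/-- The invariant `i₂` in terms of the elementary symmetric functions of the roots. -/
def i2Coeff (e : ℕ → PolyExpr) : PolyExpr :=
  num 6 * e 3 ^ 2 - num 16 * e 4 * e 2 + num 40 * e 5 * e 1 - num 240 * e 6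

/-- The invariant `i₄` in terms of the elementary symmetric functions of the roots. -/
def i4Coeff (e : ℕ → PolyExpr) : PolyExpr :=
  num 4 * e 4 ^ 2 * e 2 ^ 2 - num 12 * e 4 ^ 2 * e 3 * e 1 + num 48 * e 4 ^ 3
    - num 12 * e 5 * e 3 * e 2 ^ 2 + num 36 * e 5 * e 3 ^ 2 * e 1 + num 4 * e 5 * e 4 * e 2 * e 1
    - num 180 * e 5 * e 4 * e 3 - num 80 * e 5 ^ 2 * e 1 ^ 2 + num 300 * e 5 ^ 2 * e 2
    + num 48 * e 6 * e 2 ^ 3 - num 180 * e 6 * e 3 * e 2 * e 1 + num 324 * e 6 * e 3 ^ 2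
    + num 300 * e 6 * e 4 * e 1 ^ 2 - num 504 * e 6 * e 4 * e 2 - num 540 * e 6 * e 5 * e 1
    + num 1620 * e 6 ^ 2

/-- The invariant `i₆` in terms of the elementary symmetric functions of the roots. -/
def i6Coeff (e : ℕ → PolyExpr) : PolyExpr :=
  num 8 * e 4 ^ 2 * e 3 ^ 2 * e 2 ^ 2 - num 24 * e 4 ^ 2 * e 3 ^ 3 * e 1
    - num 24 * e 4 ^ 3 * e 2 ^ 3 + num 76 * e 4 ^ 3 * e 3 * e 2 * e 1 + num 60 * e 4 ^ 3 * e 3 ^ 2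
    - num 36 * e 4 ^ 4 * e 1 ^ 2 - num 160 * e 4 ^ 4 * e 2 - num 24 * e 5 * e 3 ^ 3 * e 2 ^ 2
    + num 72 * e 5 * e 3 ^ 4 * e 1 + num 76 * e 5 * e 4 * e 3 * e 2 ^ 3
    - num 238 * e 5 * e 4 * e 3 ^ 2 * e 2 * e 1 - num 198 * e 5 * e 4 * e 3 ^ 3
    + num 28 * e 5 * e 4 ^ 2 * e 2 ^ 2 * e 1 + num 26 * e 5 * e 4 ^ 2 * e 3 * e 1 ^ 2
    + num 492 * e 5 * e 4 ^ 2 * e 3 * e 2 + num 616 * e 5 * e 4 ^ 3 * e 1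
    - num 36 * e 5 ^ 2 * e 2 ^ 4 + num 26 * e 5 ^ 2 * e 3 * e 2 ^ 2 * e 1
    + num 176 * e 5 ^ 2 * e 3 ^ 2 * e 1 ^ 2 + num 330 * e 5 ^ 2 * e 3 ^ 2 * e 2
    + num 64 * e 5 ^ 2 * e 4 * e 2 * e 1 ^ 2 - num 640 * e 5 ^ 2 * e 4 * e 2 ^ 2
    - num 1860 * e 5 ^ 2 * e 4 * e 3 * e 1 - num 900 * e 5 ^ 2 * e 4 ^ 2
    - num 320 * e 5 ^ 3 * e 1 ^ 3 + num 1600 * e 5 ^ 3 * e 2 * e 1 + num 2250 * e 5 ^ 3 * e 3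
    + num 60 * e 6 * e 3 ^ 2 * e 2 ^ 3 - num 198 * e 6 * e 3 ^ 3 * e 2 * e 1
    + num 162 * e 6 * e 3 ^ 4 - num 160 * e 6 * e 4 * e 2 ^ 4
    + num 492 * e 6 * e 4 * e 3 * e 2 ^ 2 * e 1 + num 330 * e 6 * e 4 * e 3 ^ 2 * e 1 ^ 2
    - num 468 * e 6 * e 4 * e 3 ^ 2 * e 2 - num 640 * e 6 * e 4 ^ 2 * e 2 * e 1 ^ 2
    + num 424 * e 6 * e 4 ^ 2 * e 2 ^ 2 - num 876 * e 6 * e 4 ^ 2 * e 3 * e 1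
    - num 96 * e 6 * e 4 ^ 3 + num 616 * e 6 * e 5 * e 2 ^ 3 * e 1
    - num 1860 * e 6 * e 5 * e 3 * e 2 * e 1 ^ 2 - num 876 * e 6 * e 5 * e 3 * e 2 ^ 2
    + num 1818 * e 6 * e 5 * e 3 ^ 2 * e 1 + num 1600 * e 6 * e 5 * e 4 * e 1 ^ 3
    + num 3472 * e 6 * e 5 * e 4 * e 2 * e 1 + num 3060 * e 6 * e 5 * e 4 * e 3
    - num 2240 * e 6 * e 5 ^ 2 * e 1 ^ 2 - num 18600 * e 6 * e 5 ^ 2 * e 2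
    - num 900 * e 6 ^ 2 * e 2 ^ 2 * e 1 ^ 2 - num 96 * e 6 ^ 2 * e 2 ^ 3
    + num 2250 * e 6 ^ 2 * e 3 * e 1 ^ 3 + num 3060 * e 6 ^ 2 * e 3 * e 2 * e 1
    - num 10044 * e 6 ^ 2 * e 3 ^ 2 - num 18600 * e 6 ^ 2 * e 4 * e 1 ^ 2
    + num 20664 * e 6 ^ 2 * e 4 * e 2 + num 59940 * e 6 ^ 2 * e 5 * e 1 - num 119880 * e 6 ^ 3

variable {R : Type} [CommRing R] (v : List R)

/-- Here and for `i₄` and `i₆`, both sides are polynomials in the six roots and are compared at fast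
growing powers of 2. The list is in reverse order, so its last entry is the value of the first root.
-/
lemma eval_i2 (hv : v.length = 6) :
    (i2 fun i j => rootDiff i j ^ 2).eval v = (i2Coeff esymm6).eval v := by
  refine sub_eq_zero.mp ((eval_sub ..).symm.trans
    (eval_eq_zero ((i2 fun i j => rootDiff i j ^ 2) - i2Coeff esymm6)
      [2 ^ 2880, 2 ^ 986, 2 ^ 338, 2 ^ 114, 2 ^ 39, 2 ^ 14] (by decide +kernel) (by decide +kernel) v hv))

lemma eval_i4 (hv : v.length = 6) :
    (i4 fun i j => rootDiff i j ^ 2).eval v = (i4Coeff esymm6).eval v := by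
  refine sub_eq_zero.mp ((eval_sub ..).symm.trans
    (eval_eq_zero ((i4 fun i j => rootDiff i j ^ 2) - i4Coeff esymm6)
      [2 ^ 61332, 2 ^ 12482, 2 ^ 2539, 2 ^ 517, 2 ^ 105, 2 ^ 22] (by decide +kernel) (by decide +kernel) v hv))

lemma eval_i6 (hv : v.length = 6) :
    (i6 fun i j => rootDiff i j ^ 2).eval v = (i6Coeff esymm6).eval v := by
  refine sub_eq_zero.mp ((eval_sub ..).symm.trans
    (eval_eq_zero ((i6 fun i j => rootDiff i j ^ 2) - i6Coeff esymm6)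
      [2 ^ 523227, 2 ^ 75265, 2 ^ 10826, 2 ^ 1557, 2 ^ 224, 2 ^ 33] (by decide +kernel) (by decide +kernel) v hv))

end PolyExpr

/-! ### The quotient monopole curve -/

namespace PolyExpr

/-- The invariant `i₂` of the quotient sextic in terms of `α³` and `γ²`. -/
def quotientI2 : PolyExpr := num (-32) * var 0 - num 216 * var 1 - num 960

/-- The invariant `i₄` of the quotient sextic in terms of `α³` and `γ²`. -/
def quotientI4 : PolyExpr :=
  num 64 * var 0 ^ 2 + num 864 * var 0 * var 1 - num 2496 * var 0 + num 2916 * var 1 ^ 2 +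
    num 18144 * var 1 + num 25920

/-- The invariant `i₆` of the quotient sextic in terms of `α³` and `γ²`. -/
def quotientI6 : PolyExpr :=
  num (-157464) * var 1 ^ 3 - num 1749600 * var 1 ^ 2 - num 6397056 * var 1 - num 7672320 -
    num 69984 * var 0 * var 1 ^ 2 - num 285120 * var 0 * var 1 - num 10368 * var 0 ^ 2 * var 1 +
    num 648960 * var 0 - num 3840 * var 0 ^ 2 - num 512 * var 0 ^ 3

/-- The invariant `i₁₀` of the quotient sextic in terms of `α³` and `γ²`. -/
def quotientI10 : PolyExpr :=
  num (-47775744) - num 23887872 * var 1 - num 884736 * var 0 * var 1 + num 3538944 * var 0 -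
    num 2985984 * var 1 ^ 2 - num 65536 * var 0 ^ 2

/-- The polynomial `chiFactor` in terms of `α³` and `γ²`. -/
def quotientFactor : PolyExpr :=
  num (-8000000) + num 1146000 * var 0 - num 53088 * var 0 ^ 2 + num 784 * var 0 ^ 3 -
    num 6480000 * var 1 + num 327240 * var 0 * var 1 + num 7128 * var 1 * var 0 ^ 2 -
    num 1749600 * var 1 ^ 2 - num 10935 * var 1 ^ 2 * var 0 - num 157464 * var 1 ^ 3

/-- The difference of `χ₃₀` of the quotient sextic and its factorization. -/
def quotientIdentity : PolyExpr :=
  chi30 quotientI2 quotientI4 quotientI6 quotientI10 +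
    num 1437659997167803170816 * (var 1 * var 0 ^ 2 * quotientFactor ^ 2)

/-- All invariants of the quotient sextic are polynomials in `u = α³` and `v = γ²`, so two variables
of low degree suffice. -/
lemma eval_quotientIdentity {R : Type} [CommRing R] (u v : R) :
    quotientIdentity.eval [u, v] = 0 :=
  eval_eq_zero _ [2 ^ 2181, 2 ^ 141] (by decide +kernel) (by decide +kernel) _ rfl

end PolyExpr

namespace Sextic

variable (S : Sextic)

/-- The elementary symmetric functions of the roots. -/
def esymm (k : ℕ) : ℂ := (PolyExpr.esymm6 k).eval (List.ofFn S.root)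

lemma rootDiff_eq (i j : Fin 6) : S.root i - S.root j =
    (1 : Fin 6 → ℂ) i * (1 : Fin 6 → ℂ) j * (PolyExpr.rootDiff i j).eval (List.ofFn S.root) := by
  fin_cases i <;> fin_cases j <;>
    simp [PolyExpr.rootDiff, PolyExpr.eval_sub, PolyExpr.eval_var]

lemma poly_eq_esymm : S.poly = C S.lead * (X ^ 6 - C (S.esymm 1) * X ^ 5 + C (S.esymm 2) * X ^ 4 -
    C (S.esymm 3) * X ^ 3 + C (S.esymm 4) * X ^ 2 - C (S.esymm 5) * X + C (S.esymm 6)) := by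
  rw [poly]
  congr 1
  simp [esymm, PolyExpr.esymm6, PolyExpr.esymm, PolyExpr.eval_add, PolyExpr.eval_mul,
    PolyExpr.eval_num, PolyExpr.eval_var, Fin.prod_univ_six]
  ring

variable {S} {α γ : ℝ}

lemma coeff_quotientSextic (h : S.poly = quotientSextic α γ) : S.lead = 1 ∧ S.esymm 1 = 0 ∧ S.esymm 2 = 2 * α ∧
    S.esymm 3 = -2 * γ ∧ S.esymm 4 = α ^ 2 ∧ S.esymm 5 = -2 * α * γ ∧
    S.esymm 6 = γ ^ 2 + 4 := by
  have hq : quotientSextic α γ = X ^ 6 + C (2 * α : ℂ) * X ^ 4 + C (2 * γ : ℂ) * X ^ 3 +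
      C (α ^ 2 : ℂ) * X ^ 2 + C (2 * α * γ : ℂ) * X + C (γ ^ 2 + 4 : ℂ) := by
    simp only [quotientSextic, map_add, map_mul, map_pow, map_ofNat]
    ring
  rw [S.poly_eq_esymm, hq] at h
  have hc (n : ℕ) := congrArg (fun p => coeff p n) h
  have h6 := hc 6
  have h5 := hc 5
  have h4 := hc 4
  have h3 := hc 3
  have h2 := hc 2
  have h1 := hc 1
  have h0 := hc 0
  simp only [coeff_add, coeff_sub, coeff_C_mul, coeff_X_pow, coeff_X, coeff_C] at *
  norm_num at h0 h1 h2 h3 h4 h5 h6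
  simp only [h6, true_and, one_mul] at h0 h1 h2 h3 h4 h5 ⊢
  exact ⟨h5.resolve_left one_ne_zero, h4, by linear_combination -h3, h2, by linear_combination -h1, h0⟩

variable (S) in
lemma i2_eq_coeff : S.i2 = S.lead ^ 2 * (PolyExpr.i2Coeff PolyExpr.esymm6).eval
    (List.ofFn S.root) := by
  rw [S.i2_eq S.rootDiff_eq, PolyExpr.eval_i2 _ (List.length_ofFn ..)]
  simp

variable (S) in
lemma i4_eq_coeff : S.i4 = S.lead ^ 4 * (PolyExpr.i4Coeff PolyExpr.esymm6).eval
    (List.ofFn S.root) := by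
  rw [S.i4_eq S.rootDiff_eq, PolyExpr.eval_i4 _ (List.length_ofFn ..)]
  simp only [Pi.one_apply, Finset.prod_const_one]
  ring

variable (S) in
lemma i6_eq_coeff : S.i6 = S.lead ^ 6 * (PolyExpr.i6Coeff PolyExpr.esymm6).eval
    (List.ofFn S.root) := by
  rw [S.i6_eq S.rootDiff_eq, PolyExpr.eval_i6 _ (List.length_ofFn ..)]
  simp only [Pi.one_apply, Finset.prod_const_one]
  ring

lemma i2_quotientSextic (h : S.poly = quotientSextic α γ) :
    S.i2 = -32 * (α : ℂ) ^ 3 - 216 * γ ^ 2 - 960 := by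
  obtain ⟨hl, h1, h2, h3, h4, h5, h6⟩ := coeff_quotientSextic h
  simp only [esymm] at h1 h2 h3 h4 h5 h6
  rw [i2_eq_coeff]
  simp only [PolyExpr.i2Coeff, PolyExpr.eval_add, PolyExpr.eval_sub, PolyExpr.eval_mul,
    PolyExpr.eval_pow, PolyExpr.eval_num, hl, h1, h2, h3, h4, h5, h6]
  push_cast
  ring

lemma i4_quotientSextic (h : S.poly = quotientSextic α γ) :
    S.i4 = 64 * (α : ℂ) ^ 6 + 864 * α ^ 3 * γ ^ 2 - 2496 * α ^ 3 + 2916 * γ ^ 4 + 18144 * γ ^ 2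
        + 25920 := by
  obtain ⟨hl, h1, h2, h3, h4, h5, h6⟩ := coeff_quotientSextic h
  simp only [esymm] at h1 h2 h3 h4 h5 h6
  rw [i4_eq_coeff]
  simp only [PolyExpr.i4Coeff, PolyExpr.eval_add, PolyExpr.eval_sub, PolyExpr.eval_mul,
    PolyExpr.eval_pow, PolyExpr.eval_num, hl, h1, h2, h3, h4, h5, h6]
  push_cast
  ring

lemma i6_quotientSextic (h : S.poly = quotientSextic α γ) :
    S.i6 = -157464 * (γ : ℂ) ^ 6 - 1749600 * γ ^ 4 - 6397056 * γ ^ 2 - 7672320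
        - 69984 * α ^ 3 * γ ^ 4 - 285120 * α ^ 3 * γ ^ 2 - 10368 * α ^ 6 * γ ^ 2
        + 648960 * α ^ 3 - 3840 * α ^ 6 - 512 * α ^ 9 := by
  obtain ⟨hl, h1, h2, h3, h4, h5, h6⟩ := coeff_quotientSextic h
  simp only [esymm] at h1 h2 h3 h4 h5 h6
  rw [i6_eq_coeff]
  simp only [PolyExpr.i6Coeff, PolyExpr.eval_add, PolyExpr.eval_sub, PolyExpr.eval_mul,
    PolyExpr.eval_pow, PolyExpr.eval_num, hl, h1, h2, h3, h4, h5, h6]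
  push_cast
  ring

variable (S) in
/-- The discriminant as a product of values of the derivative. -/
lemma i10_eq_prod_derivative (hl : S.lead = 1) :
    S.i10 = -∏ i, S.poly.derivative.eval (S.root i) := by
  -- Each of the fifteen squares splits as `d j k * -d k j`, which gives the sign `(-1)¹⁵`.
  have key (d : Fin 6 → Fin 6 → ℂ) (hd : ∀ i j, d j i = -d i j) :
      (∏ j : Fin 6, ∏ k : Fin 6, if j < k then d j k ^ 2 else 1) =
        -∏ i, ∏ j, if i = j then 1 else d i j := by
    simp only [Fin.prod_univ_six, Fin.reduceLT, Fin.reduceEq, if_true, if_false]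
    rw [hd 0 1, hd 0 2, hd 0 3, hd 0 4, hd 0 5, hd 1 2, hd 1 3, hd 1 4, hd 1 5, hd 2 3, hd 2 4,
      hd 2 5, hd 3 4, hd 3 5, hd 4 5]
    ring
  have hder (i : Fin 6) : S.poly.derivative.eval (S.root i) =
      ∏ j, if i = j then 1 else S.root i - S.root j := by
    rw [poly, hl, C_1, one_mul]
    fin_cases i <;> simp [Fin.prod_univ_six]
  simp only [i10, hl, one_pow, one_mul, sqDiff, hder]
  exact key (fun i j => S.root i - S.root j) (fun i j => by ring)

/-- With `g = x³ + α x + γ` the sextic is `f = g² + 4` and `f' = 2 g g'`. The products of `g` and of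
`g'` over the roots of `f` are found by reciprocity, as products of values of `f` at the roots of
`g` and of `g'`. -/
lemma i10_quotientSextic (h : S.poly = quotientSextic α γ) :
    S.i10 = -47775744 - 23887872 * (γ : ℂ) ^ 2 - 884736 * α ^ 3 * γ ^ 2 + 3538944 * α ^ 3
        - 2985984 * γ ^ 4 - 65536 * α ^ 6 := by
  obtain ⟨hl, -⟩ := coeff_quotientSextic h
  set g : ℂ → ℂ := fun z => z ^ 3 + α * z + γ with hg
  have heval (z : ℂ) : ∏ i, (S.root i - z) = g z ^ 2 + 4 := by
    have h0 := congrArg (Polynomial.eval z) h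
    simp [poly, hl, quotientSextic, Fin.prod_univ_six] at h0
    rw [Fin.prod_univ_six]
    simp only [hg]
    linear_combination h0
  have hder (i : Fin 6) : S.poly.derivative.eval (S.root i) =
      2 * g (S.root i) * (3 * S.root i ^ 2 + α) := by
    rw [h]
    simp only [quotientSextic, hg, derivative_add, derivative_mul, derivative_pow, derivative_X,
      derivative_C, derivative_ofNat, eval_add, eval_mul, eval_pow, eval_X, eval_C, eval_one,
      eval_zero]
    norm_num
  obtain ⟨x, y, z, hxyz⟩ : ∃ x y z : ℂ, ∀ w, g w = (w - x) * (w - y) * (w - z) := by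
    let P : Cubic ℂ := ⟨1, 0, α, γ⟩
    obtain ⟨x, y, z, h3⟩ := (Cubic.splits_iff_roots_eq_three (φ := RingHom.id ℂ) (P := P)
      one_ne_zero).mp (IsAlgClosed.splits _)
    refine ⟨x, y, z, fun w => ?_⟩
    have := congrArg (Polynomial.eval w) (Cubic.eq_prod_three_roots (P := P) one_ne_zero h3)
    simp [P, Cubic.toPoly, Cubic.map] at this
    exact this
  have hgx : g x = 0 := by simp [hxyz]
  have hgy : g y = 0 := by simp [hxyz]
  have hgz : g z = 0 := by simp [hxyz]
  -- At each of the three roots of `g` the value of `f` is 4.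
  have hg64 : ∏ i, g (S.root i) = 64 := by
    simp only [hxyz]
    rw [Finset.prod_mul_distrib, Finset.prod_mul_distrib, heval, heval, heval, hgx, hgy, hgz]
    norm_num
  obtain ⟨δ, hδ⟩ := IsAlgClosed.exists_pow_nat_eq (-α / 3 : ℂ) two_pos
  -- The roots of `g'` are `±δ`, and `729 = 3⁶` collects the leading coefficients.
  have hg' : ∏ i, (3 * S.root i ^ 2 + α) = 729 * ((g δ ^ 2 + 4) * (g (-δ) ^ 2 + 4)) := by
    rw [← heval, ← heval, ← Finset.prod_mul_distrib]
    have (i : Fin 6) : 3 * S.root i ^ 2 + α = 3 * ((S.root i - δ) * (S.root i - -δ)) := by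
      linear_combination 3 * hδ
    simp only [this]
    rw [Finset.prod_mul_distrib]
    norm_num
  rw [i10_eq_prod_derivative S hl]
  simp only [hder]
  rw [Finset.prod_mul_distrib, Finset.prod_mul_distrib, hg64, hg']
  have hα : (α : ℂ) = -3 * δ ^ 2 := by linear_combination 3 * hδ
  simp only [hg, hα]
  norm_num
  ring

lemma chi30_quotientSextic (h : S.poly = quotientSextic α γ) :
    S.chi30 = -1437659997167803170816 * ((γ ^ 2 * α ^ 6 * chiFactor α γ ^ 2 : ℝ) : ℂ) := by
  have key := PolyExpr.eval_quotientIdentity ((α : ℂ) ^ 3) ((γ : ℂ) ^ 2)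
  have h2 : S.i2 = PolyExpr.quotientI2.eval [(α : ℂ) ^ 3, (γ : ℂ) ^ 2] := by
    rw [i2_quotientSextic h]
    simp [PolyExpr.quotientI2, PolyExpr.eval_sub, PolyExpr.eval_mul,
      PolyExpr.eval_num, PolyExpr.eval_var]
  have h4 : S.i4 = PolyExpr.quotientI4.eval [(α : ℂ) ^ 3, (γ : ℂ) ^ 2] := by
    rw [i4_quotientSextic h]
    simp [PolyExpr.quotientI4, PolyExpr.eval_add, PolyExpr.eval_sub, PolyExpr.eval_mul,
      PolyExpr.eval_num, PolyExpr.eval_var, PolyExpr.eval_pow]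
    ring
  have h6 : S.i6 = PolyExpr.quotientI6.eval [(α : ℂ) ^ 3, (γ : ℂ) ^ 2] := by
    rw [i6_quotientSextic h]
    simp [PolyExpr.quotientI6, PolyExpr.eval_add, PolyExpr.eval_sub, PolyExpr.eval_mul,
      PolyExpr.eval_num, PolyExpr.eval_var, PolyExpr.eval_pow]
    ring
  have h10 : S.i10 = PolyExpr.quotientI10.eval [(α : ℂ) ^ 3, (γ : ℂ) ^ 2] := by
    rw [i10_quotientSextic h]
    simp [PolyExpr.quotientI10, PolyExpr.eval_add, PolyExpr.eval_sub, PolyExpr.eval_mul,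
      PolyExpr.eval_num, PolyExpr.eval_var, PolyExpr.eval_pow]
    ring
  have hQ : ((chiFactor α γ : ℝ) : ℂ) =
      PolyExpr.quotientFactor.eval [(α : ℂ) ^ 3, (γ : ℂ) ^ 2] := by
    rw [chiFactor]
    simp [PolyExpr.quotientFactor, PolyExpr.eval_add, PolyExpr.eval_sub, PolyExpr.eval_mul,
      PolyExpr.eval_num, PolyExpr.eval_var, PolyExpr.eval_pow]
    ring
  have hα : PolyExpr.eval [(α : ℂ) ^ 3, (γ : ℂ) ^ 2] (.var 0) = (α : ℂ) ^ 3 := rfl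
  have hγ : PolyExpr.eval [(α : ℂ) ^ 3, (γ : ℂ) ^ 2] (.var 1) = (γ : ℂ) ^ 2 := rfl
  push_cast
  rw [chi30, h2, h4, h6, h10, hQ]
  rw [PolyExpr.quotientIdentity, PolyExpr.chi30] at key
  simp only [PolyExpr.eval_add, PolyExpr.eval_sub, PolyExpr.eval_mul, PolyExpr.eval_pow,
    PolyExpr.eval_num, hα, hγ] at key
  push_cast at key
  linear_combination key

end Sextic

/-! ### The locus of the quotient curves with an elliptic subcover -/

lemma Sextic.root_injective_iff (S : Sextic) (hl : S.lead ≠ 0) :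
    Function.Injective S.root ↔ S.i10 ≠ 0 := by
  rw [i10, Ne, mul_eq_zero, not_or, and_iff_right (pow_ne_zero _ hl), ← Ne]
  simp only [Finset.prod_ne_zero_iff, Finset.mem_univ, true_imp_iff]
  constructor
  · intro h j k
    split_ifs with hjk
    · exact pow_ne_zero _ (sub_ne_zero.mpr (h.ne hjk.ne))
    · exact one_ne_zero
  · intro h j k hjk
    by_contra hne
    rcases lt_or_gt_of_ne hne with hlt | hlt
    · have := h j k
      simp [hlt, sqDiff, hjk] at this
    · have := h k j
      simp [hlt, sqDiff, hjk] at this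

lemma exists_sextic_poly_eq {f : ℂ[X]} (hf : f.natDegree = 6) : ∃ S : Sextic, S.poly = f := by
  have hs := IsAlgClosed.splits f
  have hc : f.roots.toList.length = 6 := by
    rw [Multiset.length_toList, ← hs.natDegree_eq_card_roots, hf]
  refine ⟨⟨f.leadingCoeff, fun i => f.roots.toList.get (i.cast hc.symm)⟩, ?_⟩
  conv_rhs => rw [hs.eq_prod_roots]
  rw [Sextic.poly]
  congr 1
  have (l : List ℂ) : (l.map fun a => X - C a).prod = ∏ i, (X - C (l.get i)) := by
    conv_lhs => rw [← List.ofFn_get l, List.map_ofFn, List.prod_ofFn]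
    rfl
  conv_rhs => rw [← Multiset.coe_toList f.roots]
  rw [Multiset.map_coe, Multiset.prod_coe, this]
  exact Fintype.prod_equiv (finCongr hc.symm) _ _ fun i => rfl

lemma natDegree_quotientSextic (α γ : ℝ) : (quotientSextic α γ).natDegree = 6 := by
  rw [quotientSextic]
  compute_degree!

/-- Over `ℂ` the sextic factors as `(g + 2i) (g - 2i)` with `g = x³ + α x + γ`. For real parameters
the discriminants of the factors are conjugate, so their product is the sum of squares below, and
`-4096` is the squared resultant `(4i)⁶` of the factors. Vanishing forces `γ = 0` and `α³ = 27`. -/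
lemma i10_quotientSextic_eq_zero_iff {S : Sextic} {α γ : ℝ} (h : S.poly = quotientSextic α γ) :
    S.i10 = 0 ↔ (α, γ) = (3, 0) := by
  have hi : S.i10 = ((-4096 * ((4 * α ^ 3 + 27 * (γ ^ 2 - 4)) ^ 2 + (108 * γ) ^ 2) : ℝ) : ℂ) := by
    rw [Sextic.i10_quotientSextic h]
    push_cast
    ring
  rw [hi, Complex.ofReal_eq_zero, Prod.mk.injEq]
  constructor
  · intro h0
    have hγ : γ = 0 := by
      refine pow_eq_zero_iff two_ne_zero |>.mp (le_antisymm ?_ (sq_nonneg γ))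
      nlinarith [sq_nonneg (4 * α ^ 3 + 27 * (γ ^ 2 - 4))]
    subst hγ
    have h1 : 4 * α ^ 3 + 27 * (0 ^ 2 - 4) = 0 := by
      refine pow_eq_zero_iff two_ne_zero |>.mp ?_
      linear_combination (-1 / 4096) * h0
    refine ⟨?_, rfl⟩
    have h2 : (α - 3) * (α ^ 2 + 3 * α + 9) = 0 := by linear_combination h1 / 4
    rcases mul_eq_zero.mp h2 with h3 | h3
    · linarith
    · nlinarith [sq_nonneg (α + 3 / 2)]
  · rintro ⟨rfl, rfl⟩
    norm_num

lemma exists_genusTwoCurve_iff (α γ : ℝ) :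
    (∃ D : GenusTwoCurve, D.poly = quotientSextic α γ) ↔ (α, γ) ≠ (3, 0) := by
  constructor
  · rintro ⟨D, hD⟩
    rw [Ne, ← i10_quotientSextic_eq_zero_iff hD]
    exact (D.root_injective_iff D.lead_ne_zero).mp D.root_injective
  · intro h
    obtain ⟨S, hS⟩ := exists_sextic_poly_eq (natDegree_quotientSextic α γ)
    have hl : S.lead ≠ 0 := by
      rw [(Sextic.coeff_quotientSextic hS).1]
      exact one_ne_zero
    rw [Ne, ← i10_quotientSextic_eq_zero_iff hS] at h
    exact ⟨⟨S, hl, (S.root_injective_iff hl).mpr h⟩, hS⟩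

lemma chi30_quotientSextic_eq_zero_iff {S : Sextic} {α γ : ℝ}
    (h : S.poly = quotientSextic α γ) :
    S.chi30 = 0 ↔ γ ^ 2 * α ^ 6 * chiFactor α γ ^ 2 = 0 := by
  rw [Sextic.chi30_quotientSextic h, mul_eq_zero, Complex.ofReal_eq_zero]
  norm_num

lemma mem_ellipticLocus_iff (α γ : ℝ) : (α, γ) ∈ ellipticLocus ↔
    (α, γ) ≠ (3, 0) ∧ γ ^ 2 * α ^ 6 * chiFactor α γ ^ 2 = 0 := by
  rw [← exists_genusTwoCurve_iff]
  constructor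
  · rintro ⟨D, hD, hell⟩
    exact ⟨⟨D, hD⟩, (chi30_quotientSextic_eq_zero_iff hD).mp (D.hasEllipticSubcover_iff.mp hell)⟩
  · rintro ⟨⟨D, hD⟩, h⟩
    exact ⟨D, hD, D.hasEllipticSubcover_iff.mpr ((chi30_quotientSextic_eq_zero_iff hD).mpr h)⟩

/-- As a polynomial in `γ` the factor has leading coefficient `-157464`, whatever `α` is. -/
lemma finite_chiFactor_eq_zero (α : ℝ) : {γ : ℝ | chiFactor α γ = 0}.Finite := by
  let p : ℝ[X] := C (-157464) * X ^ 6 + C (-1749600 - 10935 * α ^ 3) * X ^ 4 +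
    C (-6480000 + 327240 * α ^ 3 + 7128 * α ^ 6) * X ^ 2 +
    C (-8000000 + 1146000 * α ^ 3 - 53088 * α ^ 6 + 784 * α ^ 9)
  have hp : p ≠ 0 := by
    intro h
    have := congrArg (fun q => coeff q 6) h
    simp only [p, coeff_add, coeff_C_mul, coeff_X_pow, coeff_C] at this
    norm_num at this
  refine (finite_setOfPred_isRoot hp).subset fun γ hγ => ?_
  simp only [Set.mem_ofPred_eq, IsRoot, p, eval_add, eval_mul, eval_C, eval_pow, eval_X]
  rw [Set.mem_ofPred_eq, chiFactor] at hγ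
  linear_combination hγ

/-- Intermediate values on `[0, α³]`: for `γ = 0` the term `784 α⁹` dominates and is positive, for
`γ = α³` the term `-157464 γ⁶` dominates and is negative. -/
lemma exists_chiFactor_eq_zero {α : ℝ} (hα : 10 ≤ α) : ∃ γ, 0 < γ ∧ chiFactor α γ = 0 := by
  have hcont : ContinuousOn (chiFactor α) (Set.Icc 0 (α ^ 3)) := by
    unfold chiFactor
    fun_prop
  have ha : 1000 ≤ α ^ 3 := by
    calc (1000 : ℝ) = 10 ^ 3 := by norm_num
      _ ≤ α ^ 3 := by gcongr
  have h0 : 0 < chiFactor α 0 := by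
    have h : chiFactor α 0 =
        (α ^ 3) ^ 2 * (784 * α ^ 3 - 53088) + (1146000 * α ^ 3 - 8000000) := by
      rw [chiFactor]
      ring
    rw [h]
    have h1 : 0 < 784 * α ^ 3 - 53088 := by linarith
    have h2 : 0 < 1146000 * α ^ 3 - 8000000 := by linarith
    positivity
  have h1 : chiFactor α (α ^ 3) < 0 := by
    rw [chiFactor]
    set a := α ^ 3
    have h9 : α ^ 9 = a ^ 3 := by ring
    have h6 : α ^ 6 = a ^ 2 := by ring
    rw [h9, h6]
    have h2 : 0 ≤ a * (a - 1000) := mul_nonneg (by linarith) (by linarith)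
    have h4 : 0 ≤ a ^ 3 * (a - 1000) := mul_nonneg (by positivity) (by linarith)
    have h5 : 0 ≤ a ^ 4 := by positivity
    have h5 : 0 ≤ a ^ 5 := by positivity
    have h6 : 0 ≤ a ^ 6 := by positivity
    nlinarith
  obtain ⟨γ, hγ, h⟩ := intermediate_value_Icc' (by positivity) hcont ⟨h1.le, h0.le⟩
  refine ⟨γ, lt_of_le_of_ne hγ.1 ?_, h⟩
  rintro rfl
  exact h0.ne' h

lemma infinite_ellipticLocus : {p : ℝ × ℝ | p ∈ ellipticLocus ∧ p.1 ≠ 0 ∧ p.2 ≠ 0}.Infinite := by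
  -- The projection to `α` contains `[10, ∞)`.
  refine Set.Infinite.of_image Prod.fst ((Set.Ici_infinite (10 : ℝ)).mono fun α hα => ?_)
  obtain ⟨γ, hγ, h⟩ := exists_chiFactor_eq_zero hα
  have hα : 10 ≤ α := hα
  refine ⟨(α, γ), ⟨(mem_ellipticLocus_iff α γ).mpr ⟨?_, by rw [h]; ring⟩, ?_, hγ.ne'⟩, rfl⟩
  · rw [Ne, Prod.mk.injEq]
    exact fun h => hγ.ne' h.2
  · exact (by linarith : (0 : ℝ) < α).ne'

lemma eq_zero_or_chiFactor_eq_zero {α γ : ℝ} (hα : α ≠ 0) (h : (α, γ) ∈ ellipticLocus) :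
    γ = 0 ∨ chiFactor α γ = 0 := by
  simpa [hα] using ((mem_ellipticLocus_iff α γ).mp h).2

end

theorem mainTheorem6 :
    -- the criterion for genus 2 curves
    (∀ D : GenusTwoCurve, HasEllipticSubcover 2 D.FunctionField ↔ D.chi30 = 0) ∧
    -- the invariants of the curve `y² = (x³ + αx + γ)² + 4`
    (∀ (α γ : ℝ) (S : Sextic), S.poly = quotientSextic α γ →
      S.i2 = ((-32 * α ^ 3 - 216 * γ ^ 2 - 960 : ℝ) : ℂ) ∧
      S.i4 = ((64 * α ^ 6 + 864 * α ^ 3 * γ ^ 2 - 2496 * α ^ 3 + 2916 * γ ^ 4 + 18144 * γ ^ 2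
        + 25920 : ℝ) : ℂ) ∧
      S.i6 = ((-157464 * γ ^ 6 - 1749600 * γ ^ 4 - 6397056 * γ ^ 2 - 7672320
        - 69984 * α ^ 3 * γ ^ 4 - 285120 * α ^ 3 * γ ^ 2 - 10368 * α ^ 6 * γ ^ 2
        + 648960 * α ^ 3 - 3840 * α ^ 6 - 512 * α ^ 9 : ℝ) : ℂ) ∧
      S.i10 = ((-47775744 - 23887872 * γ ^ 2 - 884736 * α ^ 3 * γ ^ 2 + 3538944 * α ^ 3
        - 2985984 * γ ^ 4 - 65536 * α ^ 6 : ℝ) : ℂ) ∧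
      (S.chi30 = 0 ↔ γ ^ 2 * α ^ 6 * chiFactor α γ ^ 2 = 0)) ∧
    -- the curve is non-singular except for one pair of real parameters
    (∀ α γ : ℝ, (∃ D : GenusTwoCurve, D.poly = quotientSextic α γ) ↔ (α, γ) ≠ (3, 0)) ∧
    -- the parameters for which the curve has an elliptic subcover of degree 2
    (∀ α γ : ℝ, (α, γ) ∈ ellipticLocus ↔
      (α, γ) ≠ (3, 0) ∧ γ ^ 2 * α ^ 6 * chiFactor α γ ^ 2 = 0) ∧
    (∀ γ : ℝ, (0, γ) ∈ ellipticLocus) ∧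
    (∀ α γ : ℝ, α ≠ 0 → (α, γ) ∈ ellipticLocus → γ = 0 ∨ chiFactor α γ = 0) ∧
    (∀ α : ℝ, α ≠ 0 → {γ : ℝ | (α, γ) ∈ ellipticLocus}.Finite) ∧
    {p : ℝ × ℝ | p ∈ ellipticLocus ∧ p.1 ≠ 0 ∧ p.2 ≠ 0}.Infinite := by
  refine ⟨fun D => D.hasEllipticSubcover_iff, fun α γ S h => ⟨?_, ?_, ?_, ?_,
    chi30_quotientSextic_eq_zero_iff h⟩, exists_genusTwoCurve_iff, mem_ellipticLocus_iff,
    fun γ => ?_, fun α γ hα h => ?_, fun α hα => ?_, infinite_ellipticLocus⟩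
  · rw [Sextic.i2_quotientSextic h]
    push_cast
    ring
  · rw [Sextic.i4_quotientSextic h]
    push_cast
    ring
  · rw [Sextic.i6_quotientSextic h]
    push_cast
    ring
  · rw [Sextic.i10_quotientSextic h]
    push_cast
    ring
  · rw [mem_ellipticLocus_iff, Ne, Prod.mk.injEq]
    exact ⟨fun h => by norm_num at h, by ring⟩
  · exact eq_zero_or_chiFactor_eq_zero hα h
  · exact ((Set.finite_singleton 0).union (finite_chiFactor_eq_zero α)).subset
      fun γ h => eq_zero_or_chiFactor_eq_zero hα h
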